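/- Let $n\ge 1$ and equip $\mathbb{CP}^n$ with the Fubini–Study metric $g$ whose Kähler form is $\tfrac{i}{2}\partial\overline{\partial}\log(1+|z|^2)$ in every affine chart. Let $\mu$ be its Riemannian volume measure, $\operatorname{vol}(\mathbb{CP}^n)=\mu(\mathbb{CP}^n)$, and $\Delta f=-\frac{1}{\sqrt{|\det g|}}\sum_{i,j}\partial_{x_j}\bigl(g^{ij}\sqrt{|\det g|}\,\partial_{x_i}f\bigr)$ its Laplace–Beltrami operator. A Green's function is a function $G$ on pairs of distinct points of $\mathbb{CP}^n$ that is smooth and symmetric, such that every $G(p,\cdot)$ is integrable, $\int G(p,q)\,d\mu(q)$ does not depend on $p$, and $$\phi(p)=\frac{1}{\operatorname{vol}(\mathbb{CP}^n)}\int\phi\,d\mu+\int G(p,q)\,\Delta\phi(q)\,d\mu(q)\qquad\text{for all }\phi\in C^2(\mathbb{CP}^n,\mathbb{R}),\ p\in\mathbb{CP}^n .$$ For $N\in\mathbb{N}$ and vortex strengths $\Gamma_1,\dots,\Gamma_N\in\mathbb{R}\setminus\{0\}$, the Hamiltonian of the $N$ point vortex problem (without self-interaction terms) is $$H_G(\zeta)=\sum_{1\le\alpha<\beta\le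 N}\Gamma_\alpha\Gamma_\beta\,G(\zeta_\alpha,\zeta_\beta)$$ on the set of $N$-tuples $\zeta=(\zeta_1,\dots,\zeta_N)$ of pairwise distinct points of $\mathbb{CP}^n$. **Theorem.** The geodesic distance of the Fubini–Study metric is $$r(\xi,\eta)=\arccos\sqrt{\frac{\langle\xi,\eta\rangle\langle\eta,\xi\rangle}{\langle\xi,\xi\rangle\langle\eta,\eta\rangle}},$$ where $\langle\cdot,\cdot\rangle$ is the Hermitian inner product of $\mathbb{C}^{n+1}$, evaluated at representatives of the two points. There is a Green's function $G$ of $\mathbb{CP}^n$ such that, for all $N$, $\Gamma$ and $\zeta$, $$H_G(\zeta)=-\frac{(n-1)!}{2\pi^n}\sum_{1\le\alpha<\beta\le N}\Gamma_\alpha\Gamma_\beta\left(\log\sin r(\zeta_\alpha,\zeta_\beta)-\sum_{j=1}^{n-1}\frac{1}{2j\,\sin^{2j}r(\zeta_\alpha,\zeta_\beta)}\right).$$ Green's function, and with it the Hamiltonian, is unique up to an additive constant: for every Green's function $G$ there is a $c\in\mathbb{R}$ such that, for all $N$, $\Gamma$ and $\zeta$, $H_G(\zeta)$ is the right-hand side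 above plus $c\sum_{1\le\alpha<\beta\le N}\Gamma_\alpha\Gamma_\beta$. -/

import Mathlib

open scoped Manifold ContDiff ENNReal Bundle
open MeasureTheory

noncomputable section

namespace VortexCP

/-! ### Complex projective space as a smooth manifold -/

/-- Complex projective space `ℂℙⁿ`: the lines of `ℂⁿ⁺¹`. -/
abbrev CP (n : ℕ) : Type := Projectivization ℂ (EuclideanSpace ℂ (Fin (n + 1)))

/-- The coordinate space `ℂⁿ`, a real vector space of dimension `2n`. Its measure `volume` is
Lebesgue measure in the `2n` real coordinates. -/
abbrev Coord (n : ℕ) : Type := Fin n → ℂ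

/-- The quotient topology of `ℂⁿ⁺¹ ∖ {0} → ℂℙⁿ`. -/
instance instTopologicalSpaceCP (n : ℕ) : TopologicalSpace (CP n) :=
  TopologicalSpace.coinduced (Projectivization.mk' ℂ) inferInstance

instance instMeasurableSpaceCP (n : ℕ) : MeasurableSpace (CP n) := borel (CP n)

instance instBorelSpaceCP (n : ℕ) : BorelSpace (CP n) := ⟨rfl⟩

/-- The domain `{[ξ] | ξᵢ ≠ 0}` of the `i`-th affine chart. -/
def affineDomain {n : ℕ} (i : Fin (n + 1)) : Set (CP n) := {p | p.rep i ≠ 0}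

/-- Homogeneous vector `ξ` with `ξᵢ = 1` and the remaining entries `z`, in order. -/
def affineVec {n : ℕ} (i : Fin (n + 1)) (z : Coord n) : EuclideanSpace ℂ (Fin (n + 1)) :=
  WithLp.toLp 2 (i.insertNth (1 : ℂ) z : Fin (n + 1) → ℂ)

theorem affineVec_ne_zero {n : ℕ} (i : Fin (n + 1)) (z : Coord n) : affineVec i z ≠ 0 := by
  intro h
  have := congrArg (fun v : EuclideanSpace ℂ (Fin (n + 1)) => v i) h
  simp [affineVec] at this

/-- The inverse of the `i`-th affine chart: `z ↦ [z₁ : … : 1 : … : zₙ]`, the `1` in place `i`. -/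
def affinePoint {n : ℕ} (i : Fin (n + 1)) (z : Coord n) : CP n :=
  Projectivization.mk ℂ (affineVec i z) (affineVec_ne_zero i z)

/-- The affine coordinates `(ξₖ / ξᵢ)_{k ≠ i}` of `[ξ]`. -/
def affineCoord {n : ℕ} (i : Fin (n + 1)) (p : CP n) : Coord n :=
  fun k => p.rep (i.succAbove k) / p.rep i

theorem rep_mk {n : ℕ} (v : EuclideanSpace ℂ (Fin (n + 1))) (hv : v ≠ 0) :
    ∃ a : ℂ, a ≠ 0 ∧ ∀ k, (Projectivization.mk ℂ v hv).rep k = a * v k := by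
  obtain ⟨a, ha⟩ := Projectivization.exists_smul_eq_mk_rep ℂ v hv
  exact ⟨a, a.ne_zero, fun k => by rw [← ha]; rfl⟩

theorem mk_mem_affineDomain {n : ℕ} (i : Fin (n + 1)) (v : EuclideanSpace ℂ (Fin (n + 1)))
    (hv : v ≠ 0) : Projectivization.mk ℂ v hv ∈ affineDomain i ↔ v i ≠ 0 := by
  obtain ⟨a, ha, h⟩ := rep_mk v hv
  simp [affineDomain, h, ha]

theorem affineCoord_mk {n : ℕ} (i : Fin (n + 1)) (v : EuclideanSpace ℂ (Fin (n + 1)))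
    (hv : v ≠ 0) :
    affineCoord i (Projectivization.mk ℂ v hv) = fun k => v (i.succAbove k) / v i := by
  obtain ⟨a, ha, h⟩ := rep_mk v hv
  funext k
  simp only [affineCoord, h]
  exact mul_div_mul_left _ _ ha

theorem isQuotientMap_mk' (n : ℕ) :
    Topology.IsQuotientMap
      (Projectivization.mk' ℂ : {v : EuclideanSpace ℂ (Fin (n + 1)) // v ≠ 0} → CP n) :=
  ⟨⟨rfl⟩, fun p => ⟨⟨p.rep, p.rep_nonzero⟩, p.mk_rep⟩⟩

theorem mk'_preimage_affineDomain {n : ℕ} (i : Fin (n + 1)) :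
    (Projectivization.mk' ℂ : {v : EuclideanSpace ℂ (Fin (n + 1)) // v ≠ 0} → CP n) ⁻¹'
      affineDomain i = {v | v.1 i ≠ 0} := by
  ext v
  exact mk_mem_affineDomain i v.1 v.2

theorem isOpen_affineDomain {n : ℕ} (i : Fin (n + 1)) : IsOpen (affineDomain (n := n) i) := by
  rw [← (isQuotientMap_mk' n).isOpen_preimage, mk'_preimage_affineDomain]
  exact isOpen_ne_fun (by fun_prop) continuous_const

theorem continuous_affinePoint {n : ℕ} (i : Fin (n + 1)) :
    Continuous (affinePoint (n := n) i) := by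
  have h : Continuous (affineVec (n := n) i) := by
    unfold affineVec
    fun_prop
  exact (isQuotientMap_mk' n).continuous.comp
    (h.subtype_mk (fun z => affineVec_ne_zero i z))

theorem continuousOn_affineCoord {n : ℕ} (i : Fin (n + 1)) :
    ContinuousOn (affineCoord (n := n) i) (affineDomain i) := by
  rw [(isQuotientMap_mk' n).continuousOn_isOpen_iff (isOpen_affineDomain i),
    mk'_preimage_affineDomain]
  have h : affineCoord (n := n) i ∘ Projectivization.mk' ℂ =
      fun v k => v.1 (i.succAbove k) / v.1 i := by
    funext v
    exact affineCoord_mk i v.1 v.2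
  rw [h, continuousOn_pi]
  intro k
  exact ContinuousOn.div (by fun_prop) (by fun_prop) (fun v hv => hv)

theorem affineCoord_affinePoint {n : ℕ} (i : Fin (n + 1)) (z : Coord n) :
    affineCoord i (affinePoint i z) = z := by
  rw [affinePoint, affineCoord_mk]
  funext k
  simp [affineVec]

theorem affinePoint_affineCoord {n : ℕ} (i : Fin (n + 1)) (p : CP n) (hp : p ∈ affineDomain i) :
    affinePoint i (affineCoord i p) = p := by
  have hp' : p.rep i ≠ 0 := hp
  conv_rhs => rw [← p.mk_rep]
  rw [affinePoint, Projectivization.mk_eq_mk_iff']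
  refine ⟨(p.rep i)⁻¹, ?_⟩
  ext k
  refine Fin.succAboveCases i ?_ (fun k => ?_) k
  · simp [affineVec, hp']
  · simp [affineVec, affineCoord, div_eq_inv_mul]

/-- The `i`-th affine chart of `ℂℙⁿ`. -/
def affineChart {n : ℕ} (i : Fin (n + 1)) : OpenPartialHomeomorph (CP n) (Coord n) where
  toFun := affineCoord i
  invFun := affinePoint i
  source := affineDomain i
  target := Set.univ
  map_source' _ _ := Set.mem_univ _
  map_target' z _ := by
    rw [affinePoint, mk_mem_affineDomain]
    simp [affineVec]
  left_inv' p hp := affinePoint_affineCoord i p hp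
  right_inv' z _ := affineCoord_affinePoint i z
  open_source := isOpen_affineDomain i
  open_target := isOpen_univ
  continuousOn_toFun := continuousOn_affineCoord i
  continuousOn_invFun := (continuous_affinePoint i).continuousOn

theorem exists_rep_ne_zero {n : ℕ} (p : CP n) :
    (Finset.univ.filter fun i => p.rep i ≠ 0).Nonempty := by
  by_contra h
  apply p.rep_nonzero
  ext i
  by_contra hi
  exact h ⟨i, by simpa using hi⟩

/-- The least `i` such that the homogeneous coordinate `ξᵢ` of `p = [ξ]` is not zero. It selects
one of the affine charts around `p`. -/
def chartIndex {n : ℕ} (p : CP n) : Fin (n + 1) :=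
  (Finset.univ.filter fun i => p.rep i ≠ 0).min' (exists_rep_ne_zero p)

theorem mem_affineDomain_chartIndex {n : ℕ} (p : CP n) : p ∈ affineDomain (chartIndex p) := by
  have h := Finset.min'_mem _ (exists_rep_ne_zero p)
  exact (Finset.mem_filter.mp h).2

/-- The standard atlas of `ℂℙⁿ`, consisting of the `n + 1` affine charts. -/
instance instChartedSpaceCP (n : ℕ) : ChartedSpace (Coord n) (CP n) where
  atlas := Set.range affineChart
  chartAt p := affineChart (chartIndex p)
  mem_chart_source p := mem_affineDomain_chartIndex p
  chart_mem_atlas p := ⟨chartIndex p, rfl⟩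

/-- `ℂℙⁿ` is a smooth real manifold (modelled on `ℂⁿ`, of real dimension `2n`). -/
instance instIsManifoldCP (n : ℕ) : IsManifold 𝓘(ℝ, Coord n) ∞ (CP n) := by
  apply isManifold_of_contDiffOn
  rintro _ _ ⟨i, rfl⟩ ⟨j, rfl⟩
  simp only [modelWithCornersSelf_coe, modelWithCornersSelf_coe_symm, Function.comp_id,
    Function.id_comp, Set.preimage_id, Set.range_id, Set.inter_univ]
  have key : ∀ z : Coord n, (affineChart j) ((affineChart i).symm z) =
      fun k => affineVec i z (j.succAbove k) / affineVec i z j :=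
    fun z => affineCoord_mk j _ _
  have hv : ∀ k : Fin (n + 1), ContDiff ℂ ∞ (fun z : Coord n => affineVec i z k) := by
    intro k
    refine Fin.succAboveCases i ?_ (fun k => ?_) k
    · simpa [affineVec] using contDiff_const
    · simpa [affineVec] using contDiff_apply ℂ ℂ k
  have hs : ∀ z ∈ ((affineChart (n := n) i).symm.trans (affineChart j)).source,
      affineVec i z j ≠ 0 := by
    intro z hz
    rw [OpenPartialHomeomorph.trans_source] at hz
    exact (mk_mem_affineDomain j _ (affineVec_ne_zero i z)).1 hz.2
  refine ContDiffOn.congr (f := fun z k => affineVec i z (j.succAbove k) / affineVec i z j)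
    ?_ (fun z _ => key z)
  rw [contDiffOn_pi]
  intro k
  exact ((hv _).contDiffOn.div (hv _).contDiffOn hs).restrict_scalars ℝ

/-! ### The Fubini–Study metric -/

/-- The real part of the Fubini–Study Hermitian form at the point with affine coordinate `z`,
`((1 + |z|²) ⟨v, w⟩ - ⟨v, z⟩ ⟨z, w⟩) / (1 + |z|²)²`, where `⟨v, w⟩ = ∑ k, conj (v k) * w k`.
It belongs to the Kähler form `(i/2) ∂∂̄ log (1 + |z|²)`, and it is given by the same formula in
each affine chart. -/
def fubiniStudyForm {n : ℕ} (z v w : Coord n) : ℝ :=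
  (((1 + star z ⬝ᵥ z) * (star v ⬝ᵥ w) - (star v ⬝ᵥ z) * (star z ⬝ᵥ w)) /
    (1 + star z ⬝ᵥ z) ^ 2).re

theorem one_add_star_dotProduct_self {n : ℕ} (z : Coord n) :
    (1 + star z ⬝ᵥ z : ℂ) = ((1 + ∑ k, Complex.normSq (z k) : ℝ) : ℂ) := by
  simp [dotProduct, Complex.normSq_eq_conj_mul_self]

theorem one_add_sum_normSq_pos {n : ℕ} (z : Coord n) :
    0 < 1 + ∑ k, Complex.normSq (z k) :=
  add_pos_of_pos_of_nonneg one_pos (Finset.sum_nonneg fun _ _ => Complex.normSq_nonneg _)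

theorem fubiniStudyForm_symm {n : ℕ} (z v w : Coord n) :
    fubiniStudyForm z v w = fubiniStudyForm z w v := by
  have h : ∀ a b : Coord n, star a ⬝ᵥ b = starRingEnd ℂ (star b ⬝ᵥ a) := by
    intro a b
    simp [dotProduct, mul_comm]
  unfold fubiniStudyForm
  rw [one_add_star_dotProduct_self, ← Complex.ofReal_pow, Complex.div_ofReal_re,
    Complex.div_ofReal_re]
  congr 1
  rw [h v w, h v z, h z w]
  simp only [Complex.sub_re, Complex.mul_re, Complex.conj_re, Complex.conj_im, Complex.ofReal_re,
    Complex.ofReal_im]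
  ring

/-- `fubiniStudyForm z v v ≥ |v|² / (1 + |z|²)²`, by the Cauchy–Schwarz inequality. -/
theorem le_fubiniStudyForm_self {n : ℕ} (z v : Coord n) :
    (∑ k, Complex.normSq (v k)) / (1 + ∑ k, Complex.normSq (z k)) ^ 2 ≤
      fubiniStudyForm z v v := by
  have hc : ∀ a b : Coord n, star a ⬝ᵥ b =
      inner ℂ (WithLp.toLp 2 a : EuclideanSpace ℂ (Fin n)) (WithLp.toLp 2 b) := by
    intro a b
    rw [EuclideanSpace.inner_eq_star_dotProduct, dotProduct_comm]
  have hn : ∀ a : Coord n, ∑ k, Complex.normSq (a k) =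
      ‖(WithLp.toLp 2 a : EuclideanSpace ℂ (Fin n))‖ ^ 2 := by
    intro a
    rw [EuclideanSpace.norm_sq_eq]
    simp [Complex.normSq_eq_norm_sq]
  unfold fubiniStudyForm
  rw [one_add_star_dotProduct_self, ← Complex.ofReal_pow, Complex.div_ofReal_re]
  apply div_le_div_of_nonneg_right _ (sq_nonneg _)
  have h1 : ((star v ⬝ᵥ z) * (star z ⬝ᵥ v)).re = ‖star v ⬝ᵥ z‖ ^ 2 := by
    rw [hc, hc]
    refine (inner_mul_symm_re_eq_norm (𝕜 := ℂ) _ _).trans ?_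
    rw [norm_mul, norm_inner_symm (WithLp.toLp 2 z), sq]
  have h2 : (star v ⬝ᵥ v).re = ∑ k, Complex.normSq (v k) := by
    simp [dotProduct, Complex.normSq_apply]
  have h3 : ‖star v ⬝ᵥ z‖ ≤ ‖(WithLp.toLp 2 v : EuclideanSpace ℂ (Fin n))‖ *
      ‖(WithLp.toLp 2 z : EuclideanSpace ℂ (Fin n))‖ := by
    rw [hc]
    exact norm_inner_le_norm _ _
  have h4 := pow_le_pow_left₀ (norm_nonneg _) h3 2
  rw [Complex.sub_re, Complex.re_ofReal_mul, h1, h2, hn, hn]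
  nlinarith [h4]

/-- `fubiniStudyForm z` as a continuous real bilinear form. -/
def fubiniStudyBilin {n : ℕ} (z : Coord n) : Coord n →L[ℝ] Coord n →L[ℝ] ℝ :=
  have hl : ∀ (c : ℝ) (v w : Coord n), fubiniStudyForm z v (c • w) =
      c • fubiniStudyForm z v w := by
    intro c v w
    unfold fubiniStudyForm
    rw [dotProduct_smul, dotProduct_smul, mul_smul_comm, mul_smul_comm, ← smul_sub, smul_div_assoc,
      Complex.smul_re]
  have ha : ∀ v w x : Coord n, fubiniStudyForm z v (w + x) =
      fubiniStudyForm z v w + fubiniStudyForm z v x := by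
    intro v w x
    unfold fubiniStudyForm
    rw [dotProduct_add, dotProduct_add, ← Complex.add_re, ← add_div]
    congr 2
    ring
  (LinearMap.mk₂ ℝ (fubiniStudyForm z)
    (fun v w x => by
      rw [fubiniStudyForm_symm, ha, fubiniStudyForm_symm z x v, fubiniStudyForm_symm z x w])
    (fun c v w => by rw [fubiniStudyForm_symm, hl, fubiniStudyForm_symm z w v])
    ha hl).toContinuousBilinearMap

theorem fubiniStudyBilin_apply {n : ℕ} (z v w : Coord n) :
    fubiniStudyBilin z v w = fubiniStudyForm z v w := rfl

theorem fubiniStudyForm_pos {n : ℕ} (z v : Coord n) (hv : v ≠ 0) :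
    0 < fubiniStudyForm z v v := by
  refine lt_of_lt_of_le (div_pos ?_ (pow_pos (one_add_sum_normSq_pos z) 2))
    (le_fubiniStudyForm_self z v)
  obtain ⟨k, hk⟩ := Function.ne_iff.1 hv
  exact Finset.sum_pos' (fun _ _ => Complex.normSq_nonneg _)
    ⟨k, Finset.mem_univ k, Complex.normSq_pos.2 hk⟩

theorem fubiniStudyForm_isVonNBounded {n : ℕ} (z : Coord n) :
    Bornology.IsVonNBounded ℝ {v : Coord n | fubiniStudyForm z v v < 1} := by
  refine (NormedSpace.isVonNBounded_closedBall ℝ (Coord n)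
    (1 + ∑ k, Complex.normSq (z k))).subset fun v hv => ?_
  have hS := one_add_sum_normSq_pos z
  have h1 := (le_fubiniStudyForm_self z v).trans_lt hv
  rw [div_lt_one (pow_pos hS 2)] at h1
  rw [mem_closedBall_zero_iff, pi_norm_le_iff_of_nonneg hS.le]
  intro k
  refine le_of_sq_le_sq ?_ hS.le
  refine le_trans ?_ h1.le
  rw [← Complex.normSq_eq_norm_sq]
  exact Finset.single_le_sum (f := fun k => Complex.normSq (v k))
    (fun _ _ => Complex.normSq_nonneg _) (Finset.mem_univ k)

/-- The Fubini–Study metric, a Riemannian metric on the tangent bundle of `ℂℙⁿ`. In Mathlib the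
tangent space at `p` is the coordinate space of the preferred chart at `p`, here the affine chart
number `chartIndex p`. -/
def fubiniStudy (n : ℕ) :
    Bundle.RiemannianMetric (fun p : CP n => TangentSpace 𝓘(ℝ, Coord n) p) where
  inner p := fubiniStudyBilin (affineCoord (chartIndex p) p)
  symm p v w := fubiniStudyForm_symm _ v w
  pos p v hv := fubiniStudyForm_pos _ v hv
  continuousAt p := by
    have h : Continuous fun v : Coord n =>
        fubiniStudyBilin (affineCoord (chartIndex p) p) v v := by fun_prop
    exact h.continuousAt
  isVonNBounded p := fubiniStudyForm_isVonNBounded _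

instance instRiemannianBundleCP (n : ℕ) :
    Bundle.RiemannianBundle (fun p : CP n => TangentSpace 𝓘(ℝ, Coord n) p) := ⟨fubiniStudy n⟩

/-- The geodesic distance of the Fubini–Study metric: the infimum of the lengths of the `C¹`
paths from `p` to `q`. -/
def geodesicDist {n : ℕ} (p q : CP n) : ℝ≥0∞ :=
  Manifold.riemannianEDist 𝓘(ℝ, Coord n) p q

/-- `r(ξ, η) = arccos √(⟨ξ, η⟩ ⟨η, ξ⟩ / (⟨ξ, ξ⟩ ⟨η, η⟩))`, for the Hermitian inner product of
`ℂⁿ⁺¹` and any representatives `ξ` of `p` and `η` of `q` (the quotient is a real number that does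
not depend on them). -/
def fsDist {n : ℕ} (p q : CP n) : ℝ :=
  Real.arccos (√((inner ℂ p.rep q.rep * inner ℂ q.rep p.rep) /
    (inner ℂ p.rep p.rep * inner ℂ q.rep q.rep) : ℂ).re)

theorem fsDist_mk {n : ℕ} (v w : EuclideanSpace ℂ (Fin (n + 1))) (hv : v ≠ 0) (hw : w ≠ 0) :
    fsDist (Projectivization.mk ℂ v hv) (Projectivization.mk ℂ w hw) =
      Real.arccos (√((inner ℂ v w * inner ℂ w v) / (inner ℂ v v * inner ℂ w w) : ℂ).re) := by
  obtain ⟨a, ha⟩ := Projectivization.exists_smul_eq_mk_rep ℂ v hv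
  obtain ⟨b, hb⟩ := Projectivization.exists_smul_eq_mk_rep ℂ w hw
  have ha0 : (a : ℂ) ≠ 0 := a.ne_zero
  have hb0 : (b : ℂ) ≠ 0 := b.ne_zero
  have ha1 : starRingEnd ℂ (a : ℂ) ≠ 0 := by simp
  have hb1 : starRingEnd ℂ (b : ℂ) ≠ 0 := by simp
  unfold fsDist
  rw [← ha, ← hb]
  simp only [Units.smul_def, inner_smul_left, inner_smul_right]
  have hv0 : inner ℂ v v ≠ 0 := inner_self_ne_zero.2 hv
  have hw0 : inner ℂ w w ≠ 0 := inner_self_ne_zero.2 hw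
  congr 3
  field_simp

/-! ### Volume and Laplace–Beltrami operator of the Fubini–Study metric -/

/-- The real coordinate directions `∂/∂xₖ` (`inl k`) and `∂/∂yₖ` (`inr k`), where
`zₖ = xₖ + i yₖ`. -/
def coordDir {n : ℕ} : Fin n ⊕ Fin n → Coord n :=
  Sum.elim (fun k => Pi.single k 1) (fun k => Pi.single k Complex.I)

/-- The real `2n × 2n` matrix `(g_{ab})` of the Fubini–Study metric in affine coordinates. -/
def metricMatrix {n : ℕ} (z : Coord n) : Matrix (Fin n ⊕ Fin n) (Fin n ⊕ Fin n) ℝ :=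
  Matrix.of fun a b => fubiniStudyForm z (coordDir a) (coordDir b)

/-- The Riemannian volume density `√|det g|` in affine coordinates. -/
def volDensity {n : ℕ} (z : Coord n) : ℝ := √|(metricMatrix z).det|

/-- The Riemannian volume measure `μ` of `ℂℙⁿ`, which is `√|det g| dx dy` in each affine chart.
It is assembled from the charts along the partition of `ℂℙⁿ` into the sets
`{p | chartIndex p = i}`, each of which lies in the domain of chart `i`. -/
def volumeFS (n : ℕ) : Measure (CP n) :=
  Measure.sum fun i : Fin (n + 1) =>
    (((volume : Measure (Coord n)).withDensity fun z => ENNReal.ofReal (volDensity z)).map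
      (affinePoint i)).restrict {p | chartIndex p = i}

/-- The Laplace–Beltrami operator in affine coordinates, with the sign for which it is
nonnegative: `-(1 / √|det g|) ∑ a b, ∂_b (g^{ab} √|det g| ∂_a f)`. -/
def coordLaplacian {n : ℕ} (f : Coord n → ℝ) (z : Coord n) : ℝ :=
  -(1 / volDensity z) * ∑ a, ∑ b,
    fderiv ℝ (fun y => (metricMatrix y)⁻¹ a b * volDensity y * fderiv ℝ f y (coordDir a)) z
      (coordDir b)

/-- The Laplace–Beltrami operator of `ℂℙⁿ` on functions of class `C²`, computed in an affine
chart around the point. -/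
def laplaceBeltrami {n : ℕ} (φ : CP n → ℝ) (p : CP n) : ℝ :=
  coordLaplacian (φ ∘ affinePoint (chartIndex p)) (affineCoord (chartIndex p) p)

/-- `G` is a Green's function of the Laplace–Beltrami operator of `ℂℙⁿ`. The values of `G` on the
diagonal are irrelevant. -/
structure IsGreenFunction {n : ℕ} (G : CP n → CP n → ℝ) : Prop where
  /-- `G(p, ·)` is integrable, so that the integrals below make sense. -/
  integrable : ∀ p, Integrable (G p) (volumeFS n)
  /-- Green's representation formula for functions of class `C²`. -/
  representation : ∀ φ : CP n → ℝ, ContMDiff 𝓘(ℝ, Coord n) 𝓘(ℝ, ℝ) 2 φ → ∀ p,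
    φ p = 1 / (volumeFS n).real Set.univ * ∫ q, φ q ∂(volumeFS n) +
      ∫ q, G p q * laplaceBeltrami φ q ∂(volumeFS n)
  /-- Smoothness off the diagonal. -/
  smooth : ContMDiffOn (𝓘(ℝ, Coord n).prod 𝓘(ℝ, Coord n)) 𝓘(ℝ, ℝ) ∞
    (fun x : CP n × CP n => G x.1 x.2) {x | x.1 ≠ x.2}
  symm : ∀ p q, p ≠ q → G p q = G q p
  integral_const : ∃ c, ∀ p, ∫ q, G p q ∂(volumeFS n) = c

/-! ### Point vortices -/

/-- The big diagonal: `N`-tuples of points at least two of which coincide. -/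
def bigDiagonal (N : ℕ) (M : Type*) : Set (Fin N → M) :=
  {y | ∃ j k, j ≠ k ∧ y j = y k}

/-- The Hamiltonian of `N` point vortices with strengths `Γ` for the Green's function `G`, without
self-interaction (Robin) terms, on the phase space of `N`-tuples of distinct points. -/
def vortexHamiltonian {n N : ℕ} (G : CP n → CP n → ℝ) (Γ : Fin N → ℝ)
    (ζ : ↥(bigDiagonal N (CP n))ᶜ) : ℝ :=
  ∑ α, ∑ β ∈ Finset.Ioi α, Γ α * Γ β * G (ζ.1 α) (ζ.1 β)

end VortexCP

end

open VortexCP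

/-!
Everything is expressed through one function, `cosSq p q = |⟨ξ, η⟩|² / (|ξ|² |η|²)`, the square of
`cos r(p, q)`.

*Geodesic distance.* The function `arccos √(cosSq p ·)` is a limit of smooth functions whose
gradients have norm at most one (`smoothedDist`), so `fsDist` is a lower bound for the length of a
path. The projection of a great circle arc attains the bound (`geodesicDist_eq`).

*Laplace–Beltrami operator.* Lifted to functions on `ℂⁿ⁺¹ ∖ {0}` that are invariant under scaling,
`Δ` becomes `-|ξ|²` times the Euclidean Laplacian (`laplaceBeltrami_toCP`), and the volume measure
is the image of Lebesgue measure with a radial weight (`lintegral_comp_toCP`). Hence `Δ` is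
symmetric (`integral_mul_laplaceBeltrami_comm`) and the volume is `πⁿ / n!`. With `t = cosSq p ·`,
`Δ tᵏ⁺¹ = 4 (k + 1) (k + 1 + n) tᵏ⁺¹ - 4 (k + 1)² tᵏ` (`laplaceBeltrami_cosSq_pow`), so the moments
`mₖ = ∫ tᵏ` satisfy `(k + 1 + n) mₖ₊₁ = (k + 1) mₖ` and do not depend on `p`.

*Green's function.* The functions `tᵏ / mₖ` are probability densities that concentrate at `p`, and
`Δ` maps `tᵏ⁺¹ / (4 (k + 1)² mₖ)` to the difference of two consecutive ones. The series
`∑ tᵏ⁺¹ / (4 (k + 1)² mₖ)` therefore telescopes under `Δ`, from `1 / vol` to the point mass at `p`,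
which is Green's representation formula (`integral_greenSeries_mul_laplaceBeltrami`). Its terms are
positive with integrals `1 / (4 (k + 1) (k + 1 + n))`, which gives integrability and justifies the
interchange of sum and integral. The coefficients are binomial coefficients divided by `k + 1`, and
summation gives the closed form in `1 - t = sin² r` (`greenSeries_eq`); the additive constant is
harmless since `∫ Δφ = 0`.

*Uniqueness.* The difference of two Green's functions, as a function of the second variable, is
orthogonal to all `Δ (cosSq w ·)ᵏ⁺¹`, so its integrals against the densities concentrating at `w`
are all equal to its mean. Thus its value at `w` is its mean, which is the same for all first
variables (`IsGreenFunction.exists_eq_add_const`).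
-/

namespace VortexCP

open Filter Topology Manifold

/-! ### Homogeneous coordinates -/

/-- The point `[ξ]` with homogeneous coordinates `ξ`, as a function on all of `ℂⁿ⁺¹`; at `ξ = 0` it
takes an irrelevant value. -/
noncomputable def toCP {n : ℕ} (ξ : Coord (n + 1)) : CP n :=
  open Classical in
  if h : ξ ≠ 0 then
    Projectivization.mk ℂ (WithLp.toLp 2 ξ : EuclideanSpace ℂ (Fin (n + 1))) (by simpa using h)
  else affinePoint 0 0

/-- The square of the Hermitian norm, `∑ k, |z k|²`. -/
noncomputable def nsq {m : ℕ} (z : Coord m) : ℝ := ∑ k, Complex.normSq (z k)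

theorem toCP_of_ne_zero {n : ℕ} {ξ : Coord (n + 1)} (h : ξ ≠ 0) :
    toCP ξ = Projectivization.mk ℂ (WithLp.toLp 2 ξ : EuclideanSpace ℂ (Fin (n + 1)))
      (by simpa using h) := by
  rw [toCP, dif_pos h]

theorem rep_ofLp_ne_zero {n : ℕ} (p : CP n) : p.rep.ofLp ≠ 0 := by
  simpa using p.rep_nonzero

theorem toCP_rep {n : ℕ} (p : CP n) : toCP p.rep.ofLp = p := by
  rw [toCP_of_ne_zero (rep_ofLp_ne_zero p)]
  exact p.mk_rep

theorem toCP_smul {n : ℕ} (c : ℂ) (hc : c ≠ 0) (ξ : Coord (n + 1)) (h : ξ ≠ 0) :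
    toCP (c • ξ) = toCP ξ := by
  rw [toCP_of_ne_zero h, toCP_of_ne_zero (smul_ne_zero hc h), Projectivization.mk_eq_mk_iff']
  exact ⟨c, rfl⟩

theorem affineVec_ofLp_ne_zero {n : ℕ} (i : Fin (n + 1)) (z : Coord n) :
    (affineVec i z).ofLp ≠ 0 := by
  simpa using affineVec_ne_zero i z

theorem affinePoint_eq_toCP {n : ℕ} (i : Fin (n + 1)) (z : Coord n) :
    affinePoint i z = toCP (affineVec i z).ofLp := by
  rw [toCP_of_ne_zero (affineVec_ofLp_ne_zero i z)]
  rfl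

theorem affineVec_ofLp_self {n : ℕ} (i : Fin (n + 1)) (z : Coord n) :
    (affineVec i z).ofLp i = 1 := by
  simp [affineVec]

theorem affineVec_ofLp_succAbove {n : ℕ} (i : Fin (n + 1)) (z : Coord n) (k : Fin n) :
    (affineVec i z).ofLp (i.succAbove k) = z k := by
  simp [affineVec]

theorem ne_zero_of_apply_ne_zero {m : ℕ} {ξ : Coord m} {i : Fin m} (h : ξ i ≠ 0) : ξ ≠ 0 := by
  rintro rfl
  exact h rfl

theorem toCP_mem_affineDomain {n : ℕ} (i : Fin (n + 1)) {ξ : Coord (n + 1)} (hξ : ξ ≠ 0) :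
    toCP ξ ∈ affineDomain i ↔ ξ i ≠ 0 := by
  rw [toCP_of_ne_zero hξ, mk_mem_affineDomain]

theorem affineCoord_toCP {n : ℕ} (i : Fin (n + 1)) {ξ : Coord (n + 1)} (h : ξ ≠ 0) :
    affineCoord i (toCP ξ) = fun k => ξ (i.succAbove k) / ξ i := by
  rw [toCP_of_ne_zero h, affineCoord_mk]

theorem toCP_eq_affinePoint {n : ℕ} (i : Fin (n + 1)) {ξ : Coord (n + 1)} (h : ξ i ≠ 0) :
    toCP ξ = affinePoint i (fun k => ξ (i.succAbove k) / ξ i) := by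
  have h0 := ne_zero_of_apply_ne_zero h
  rw [← affineCoord_toCP i h0, affinePoint_affineCoord]
  exact (toCP_mem_affineDomain i h0).2 h

theorem exists_apply_ne_zero {m : ℕ} {ξ : Coord m} (h : ξ ≠ 0) : ∃ i, ξ i ≠ 0 :=
  Function.ne_iff.1 h

/-! ### Smooth functions in affine and in homogeneous coordinates -/

theorem affineChart_mem_maximalAtlas {n : ℕ} (i : Fin (n + 1)) :
    affineChart (n := n) i ∈ IsManifold.maximalAtlas 𝓘(ℝ, Coord n) ∞ (CP n) :=
  IsManifold.subset_maximalAtlas ⟨i, rfl⟩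

theorem contMDiff_affinePoint {n : ℕ} (i : Fin (n + 1)) :
    ContMDiff 𝓘(ℝ, Coord n) 𝓘(ℝ, Coord n) ∞ (affinePoint (n := n) i) := by
  rw [← contMDiffOn_univ]
  exact contMDiffOn_symm_of_mem_maximalAtlas (affineChart_mem_maximalAtlas i)

theorem contMDiffOn_affineCoord {n : ℕ} (i : Fin (n + 1)) :
    ContMDiffOn 𝓘(ℝ, Coord n) 𝓘(ℝ, Coord n) ∞ (affineCoord (n := n) i) (affineDomain i) :=
  contMDiffOn_of_mem_maximalAtlas (affineChart_mem_maximalAtlas i)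

theorem contMDiffAt_affineCoord {n : ℕ} {i : Fin (n + 1)} {p : CP n} (hp : p ∈ affineDomain i) :
    ContMDiffAt 𝓘(ℝ, Coord n) 𝓘(ℝ, Coord n) ∞ (affineCoord (n := n) i) p :=
  (contMDiffOn_affineCoord i).contMDiffAt ((isOpen_affineDomain i).mem_nhds hp)

/-- A function on `ℂℙⁿ` of class `Cʳ` is so in the affine charts. -/
theorem contDiff_comp_affinePoint {n : ℕ} {r : ℕ∞} {φ : CP n → ℝ}
    (h : ContMDiff 𝓘(ℝ, Coord n) 𝓘(ℝ, ℝ) r φ) (i : Fin (n + 1)) :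
    ContDiff ℝ r (φ ∘ affinePoint i) := by
  rw [← contMDiff_iff_contDiff]
  exact h.comp ((contMDiff_affinePoint i).of_le (by exact_mod_cast le_top))

theorem contMDiff_of_comp_affinePoint {n : ℕ} {r : ℕ∞} {φ : CP n → ℝ}
    (h : ∀ i, ContDiff ℝ r (φ ∘ affinePoint i)) : ContMDiff 𝓘(ℝ, Coord n) 𝓘(ℝ, ℝ) r φ := by
  intro p
  have hp := mem_affineDomain_chartIndex p
  have h1 : ContMDiffAt 𝓘(ℝ, Coord n) 𝓘(ℝ, ℝ) r
      ((φ ∘ affinePoint (chartIndex p)) ∘ affineCoord (chartIndex p)) p :=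
    (contMDiff_iff_contDiff.2 (h (chartIndex p))).contMDiffAt.comp p
      ((contMDiffAt_affineCoord hp).of_le (by exact_mod_cast le_top))
  refine h1.congr_of_eventuallyEq ?_
  filter_upwards [(isOpen_affineDomain _).mem_nhds hp] with q hq
  simp [affinePoint_affineCoord _ _ hq]

theorem contDiffAt_affine_quotient {n : ℕ} {r : ℕ∞} {i : Fin (n + 1)} {ξ : Coord (n + 1)}
    (h : ξ i ≠ 0) :
    ContDiffAt ℝ r (fun (ξ : Coord (n + 1)) (k : Fin n) => ξ (i.succAbove k) / ξ i) ξ := by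
  rw [contDiffAt_pi]
  intro k
  have e (j : Fin (n + 1)) : ContDiffAt ℝ r (fun η : Coord (n + 1) => η j) ξ :=
    (contDiff_apply ℝ ℂ j).contDiffAt
  simp only [div_eq_mul_inv]
  exact (e _).mul ((e i).inv h)

/-- The lift of a function on `ℂℙⁿ` to homogeneous coordinates is as smooth as the function. -/
theorem contDiffAt_comp_toCP {n : ℕ} {r : ℕ∞} {φ : CP n → ℝ}
    (h : ContMDiff 𝓘(ℝ, Coord n) 𝓘(ℝ, ℝ) r φ) {ξ : Coord (n + 1)} (hξ : ξ ≠ 0) :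
    ContDiffAt ℝ r (φ ∘ toCP) ξ := by
  obtain ⟨i, hi⟩ := exists_apply_ne_zero hξ
  have h1 : ContDiffAt ℝ r ((φ ∘ affinePoint i) ∘
      fun (ξ : Coord (n + 1)) (k : Fin n) => ξ (i.succAbove k) / ξ i) ξ :=
    (contDiff_comp_affinePoint h i).contDiffAt.comp ξ (contDiffAt_affine_quotient hi)
  refine h1.congr_of_eventuallyEq ?_
  have : ∀ᶠ η : Coord (n + 1) in 𝓝 ξ, η i ≠ 0 :=
    (continuous_apply i).continuousAt.eventually_ne hi
  filter_upwards [this] with η hη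
  simp [toCP_eq_affinePoint i hη]

theorem continuousOn_toCP {n : ℕ} : ContinuousOn (toCP (n := n)) {0}ᶜ := by
  intro ξ hξ
  obtain ⟨i, hi⟩ := exists_apply_ne_zero hξ
  have h1 : ContinuousAt (affinePoint i ∘
      fun (ξ : Coord (n + 1)) (k : Fin n) => ξ (i.succAbove k) / ξ i) ξ :=
    (continuous_affinePoint i).continuousAt.comp
      (contDiffAt_affine_quotient (r := 0) hi).continuousAt
  refine (h1.congr ?_).continuousWithinAt
  have : ∀ᶠ η : Coord (n + 1) in 𝓝 ξ, η i ≠ 0 :=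
    (continuous_apply i).continuousAt.eventually_ne hi
  filter_upwards [this] with η hη
  simp [toCP_eq_affinePoint i hη]

theorem measurable_toCP {n : ℕ} : Measurable (toCP (n := n)) :=
  measurable_of_continuousOn_compl_singleton 0 continuousOn_toCP

/-! ### The squared cosine of the distance -/

theorem nsq_nonneg {m : ℕ} (z : Coord m) : 0 ≤ nsq z :=
  Finset.sum_nonneg fun _ _ => Complex.normSq_nonneg _

theorem nsq_pos {m : ℕ} {z : Coord m} (h : z ≠ 0) : 0 < nsq z := by
  obtain ⟨k, hk⟩ := exists_apply_ne_zero h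
  exact Finset.sum_pos' (fun _ _ => Complex.normSq_nonneg _)
    ⟨k, Finset.mem_univ k, Complex.normSq_pos.2 hk⟩

@[simp]
theorem nsq_zero {m : ℕ} : nsq (0 : Coord m) = 0 := by simp [nsq]

theorem nsq_smul {m : ℕ} (c : ℂ) (z : Coord m) : nsq (c • z) = Complex.normSq c * nsq z := by
  simp [nsq, Finset.mul_sum]

theorem contDiff_nsq {m : ℕ} {r : ℕ∞} : ContDiff ℝ r (nsq (m := m)) := by
  unfold nsq
  simp only [Complex.normSq_apply]
  refine ContDiff.sum fun k _ => ?_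
  have e : ContDiff ℝ r (fun η : Coord m => η k) := contDiff_apply ℝ ℂ k
  have e1 := Complex.reCLM.contDiff.comp e
  have e2 := Complex.imCLM.contDiff.comp e
  exact (e1.mul e1).add (e2.mul e2)

theorem continuous_nsq {m : ℕ} : Continuous (nsq (m := m)) :=
  (contDiff_nsq (r := 0)).continuous

theorem star_dotProduct_self {m : ℕ} (z : Coord m) : star z ⬝ᵥ z = (nsq z : ℂ) := by
  simp [dotProduct, nsq, Complex.normSq_eq_conj_mul_self]

theorem nsq_affineVec {n : ℕ} (i : Fin (n + 1)) (z : Coord n) :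
    nsq (affineVec i z).ofLp = 1 + nsq z := by
  simp [nsq, Fin.sum_univ_succAbove _ i, affineVec]

theorem inner_eq_star_dotProduct {m : ℕ} (a b : EuclideanSpace ℂ (Fin m)) :
    inner ℂ a b = star a.ofLp ⬝ᵥ b.ofLp := by
  rw [EuclideanSpace.inner_eq_star_dotProduct, dotProduct_comm]

theorem conj_star_dotProduct {m : ℕ} (a b : Coord m) :
    starRingEnd ℂ (star a ⬝ᵥ b) = star b ⬝ᵥ a := by
  simp [dotProduct, mul_comm]

theorem nsq_eq_norm_sq {m : ℕ} (z : Coord m) :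
    nsq z = ‖(WithLp.toLp 2 z : EuclideanSpace ℂ (Fin m))‖ ^ 2 := by
  rw [EuclideanSpace.norm_sq_eq]
  simp [nsq, Complex.normSq_eq_norm_sq]

/-- The Cauchy–Schwarz inequality. -/
theorem normSq_star_dotProduct_le {m : ℕ} (a b : Coord m) :
    Complex.normSq (star a ⬝ᵥ b) ≤ nsq a * nsq b := by
  have := norm_inner_le_norm (𝕜 := ℂ) (WithLp.toLp 2 a : EuclideanSpace ℂ (Fin m))
    (WithLp.toLp 2 b)
  rw [inner_eq_star_dotProduct] at this
  rw [Complex.normSq_eq_norm_sq, nsq_eq_norm_sq, nsq_eq_norm_sq, ← mul_pow]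
  exact pow_le_pow_left₀ (norm_nonneg _) this 2

/-- The quotient `|⟨w, ξ⟩|² / (|w|² |ξ|²)`. -/
noncomputable def overlap {m : ℕ} (w ξ : Coord m) : ℝ :=
  Complex.normSq (star w ⬝ᵥ ξ) / (nsq w * nsq ξ)

theorem overlap_nonneg {m : ℕ} (w ξ : Coord m) : 0 ≤ overlap w ξ :=
  div_nonneg (Complex.normSq_nonneg _) (mul_nonneg (nsq_nonneg _) (nsq_nonneg _))

theorem overlap_le_one {m : ℕ} (w ξ : Coord m) : overlap w ξ ≤ 1 :=
  div_le_one_of_le₀ (normSq_star_dotProduct_le w ξ) (mul_nonneg (nsq_nonneg _) (nsq_nonneg _))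

theorem overlap_comm {m : ℕ} (w ξ : Coord m) : overlap w ξ = overlap ξ w := by
  rw [overlap, overlap, ← conj_star_dotProduct, Complex.normSq_conj, mul_comm]

theorem overlap_smul_right {m : ℕ} (c : ℂ) (hc : c ≠ 0) (w ξ : Coord m) :
    overlap w (c • ξ) = overlap w ξ := by
  rw [overlap, overlap, nsq_smul, dotProduct_smul, smul_eq_mul, Complex.normSq_mul, mul_left_comm,
    mul_div_mul_left]
  simpa using hc

theorem overlap_smul_left {m : ℕ} (c : ℂ) (hc : c ≠ 0) (w ξ : Coord m) :
    overlap (c • w) ξ = overlap w ξ := by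
  rw [overlap_comm, overlap_smul_right c hc, overlap_comm]

/-- The squared cosine of the distance of two points of `ℂℙⁿ`. -/
noncomputable def cosSq {n : ℕ} (p q : CP n) : ℝ := overlap p.rep.ofLp q.rep.ofLp

theorem exists_rep_toCP {n : ℕ} {ξ : Coord (n + 1)} (h : ξ ≠ 0) :
    ∃ a : ℂ, a ≠ 0 ∧ (toCP ξ).rep.ofLp = a • ξ := by
  obtain ⟨a, ha, h1⟩ := rep_mk (WithLp.toLp 2 ξ : EuclideanSpace ℂ (Fin (n + 1))) (by simpa using h)
  refine ⟨a, ha, ?_⟩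
  rw [toCP_of_ne_zero h]
  funext k
  exact h1 k

theorem cosSq_toCP {n : ℕ} {w ξ : Coord (n + 1)} (hw : w ≠ 0) (h : ξ ≠ 0) :
    cosSq (toCP w) (toCP ξ) = overlap w ξ := by
  obtain ⟨a, ha, h1⟩ := exists_rep_toCP hw
  obtain ⟨b, hb, h2⟩ := exists_rep_toCP h
  rw [cosSq, h1, h2, overlap_smul_left a ha, overlap_smul_right b hb]

theorem cosSq_right_toCP {n : ℕ} (p : CP n) {ξ : Coord (n + 1)} (h : ξ ≠ 0) :
    cosSq p (toCP ξ) = overlap p.rep.ofLp ξ := by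
  conv_lhs => rw [← toCP_rep p]
  exact cosSq_toCP (rep_ofLp_ne_zero p) h

theorem cosSq_nonneg {n : ℕ} (p q : CP n) : 0 ≤ cosSq p q := overlap_nonneg _ _

theorem cosSq_le_one {n : ℕ} (p q : CP n) : cosSq p q ≤ 1 := overlap_le_one _ _

theorem cosSq_comm {n : ℕ} (p q : CP n) : cosSq p q = cosSq q p := overlap_comm _ _

theorem fsDist_eq {n : ℕ} (p q : CP n) : fsDist p q = Real.arccos √(cosSq p q) := by
  unfold fsDist cosSq overlap
  simp only [inner_eq_star_dotProduct, star_dotProduct_self]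
  congr 2
  rw [← conj_star_dotProduct p.rep.ofLp, ← Complex.ofReal_mul, Complex.div_ofReal_re,
    Complex.mul_conj, Complex.ofReal_re]

/-- Equality in the Cauchy–Schwarz inequality: `cosSq` separates the points of `ℂℙⁿ`. -/
theorem cosSq_eq_one_iff {n : ℕ} (p q : CP n) : cosSq p q = 1 ↔ p = q := by
  have hp := nsq_pos (rep_ofLp_ne_zero p)
  have hq := nsq_pos (rep_ofLp_ne_zero q)
  constructor
  · intro h
    rw [cosSq, overlap, div_eq_one_iff_eq (mul_pos hp hq).ne', Complex.normSq_eq_norm_sq,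
      nsq_eq_norm_sq, nsq_eq_norm_sq, ← mul_pow, ← inner_eq_star_dotProduct,
      pow_left_inj₀ (norm_nonneg _) (by positivity) two_ne_zero,
      norm_inner_eq_norm_iff p.rep_nonzero q.rep_nonzero] at h
    obtain ⟨r, hr, h⟩ := h
    rw [← p.mk_rep, ← q.mk_rep, Projectivization.mk_eq_mk_iff']
    refine ⟨r⁻¹, ?_⟩
    rw [h, smul_smul, inv_mul_cancel₀ hr, one_smul]
  · rintro rfl
    rw [cosSq, overlap, star_dotProduct_self, Complex.normSq_ofReal, div_self (mul_pos hp hp).ne']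

theorem cosSq_self {n : ℕ} (p : CP n) : cosSq p p = 1 := (cosSq_eq_one_iff p p).2 rfl

theorem cosSq_lt_one {n : ℕ} {p q : CP n} (h : p ≠ q) : cosSq p q < 1 :=
  (cosSq_le_one p q).lt_of_ne fun h1 => h ((cosSq_eq_one_iff p q).1 h1)

theorem sin_fsDist {n : ℕ} (p q : CP n) : Real.sin (fsDist p q) = √(1 - cosSq p q) := by
  rw [fsDist_eq, Real.sin_arccos, Real.sq_sqrt (cosSq_nonneg p q)]

/-! ### Smoothness of the squared cosine -/

theorem contDiff_star_dotProduct {m : ℕ} {r : ℕ∞} :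
    ContDiff ℝ r (fun x : Coord m × Coord m => star x.1 ⬝ᵥ x.2) := by
  unfold dotProduct
  refine ContDiff.sum fun k _ => ?_
  have e : ContDiff ℝ r (fun η : Coord m => η k) := contDiff_apply ℝ ℂ k
  exact ((Complex.conjCLE.toContinuousLinearMap.contDiff).comp (e.comp contDiff_fst)).mul
    (e.comp contDiff_snd)

theorem contDiff_normSq {r : ℕ∞} : ContDiff ℝ r (fun c : ℂ => Complex.normSq c) := by
  simp only [Complex.normSq_apply]
  have e1 := Complex.reCLM.contDiff (n := r)
  have e2 := Complex.imCLM.contDiff (n := r)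
  exact (e1.mul e1).add (e2.mul e2)

theorem contDiffAt_overlap_prod {m : ℕ} {r : ℕ∞} {x : Coord m × Coord m} (h1 : x.1 ≠ 0)
    (h2 : x.2 ≠ 0) : ContDiffAt ℝ r (fun x : Coord m × Coord m => overlap x.1 x.2) x := by
  unfold overlap
  refine ContDiffAt.div ?_ ?_ (mul_pos (nsq_pos h1) (nsq_pos h2)).ne'
  · exact (contDiff_normSq.comp contDiff_star_dotProduct).contDiffAt
  · exact ((contDiff_nsq.comp contDiff_fst).mul (contDiff_nsq.comp contDiff_snd)).contDiffAt

theorem contDiff_affineVec {n : ℕ} {r : ℕ∞} (i : Fin (n + 1)) :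
    ContDiff ℝ r (fun z : Coord n => (affineVec i z).ofLp) := by
  rw [contDiff_pi]
  intro k
  refine Fin.succAboveCases i ?_ (fun k => ?_) k
  · simpa [affineVec] using contDiff_const
  · simpa [affineVec] using contDiff_apply ℝ ℂ k

theorem contDiffAt_overlap {m : ℕ} {r : ℕ∞} {w ξ : Coord m} (hw : w ≠ 0) (h : ξ ≠ 0) :
    ContDiffAt ℝ r (overlap w) ξ :=
  (contDiffAt_overlap_prod (x := (w, ξ)) hw h).comp ξ (contDiffAt_const.prodMk contDiffAt_id)

theorem cosSq_comp_affinePoint {n : ℕ} (p : CP n) (i : Fin (n + 1)) :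
    cosSq p ∘ affinePoint i = overlap p.rep.ofLp ∘ fun z => (affineVec i z).ofLp := by
  funext z
  simp [affinePoint_eq_toCP, cosSq_right_toCP p (affineVec_ofLp_ne_zero i z)]

theorem contMDiff_cosSq {n : ℕ} {r : ℕ∞} (p : CP n) :
    ContMDiff 𝓘(ℝ, Coord n) 𝓘(ℝ, ℝ) r (cosSq p) := by
  refine contMDiff_of_comp_affinePoint fun i => ?_
  rw [cosSq_comp_affinePoint, contDiff_iff_contDiffAt]
  exact fun z => (contDiffAt_overlap (rep_ofLp_ne_zero p) (affineVec_ofLp_ne_zero i z)).comp z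
    (contDiff_affineVec i).contDiffAt

theorem continuous_cosSq {n : ℕ} (p : CP n) : Continuous (cosSq p) :=
  (contMDiff_cosSq (r := 0) p).continuous

theorem contMDiff_cosSq_prod {n : ℕ} :
    ContMDiff (𝓘(ℝ, Coord n).prod 𝓘(ℝ, Coord n)) 𝓘(ℝ, ℝ) ∞
      (fun x : CP n × CP n => cosSq x.1 x.2) := by
  rintro ⟨p, q⟩
  have hp := mem_affineDomain_chartIndex p
  have hq := mem_affineDomain_chartIndex q
  have h1 : ContDiff ℝ ∞ (fun x : Coord n × Coord n =>
      overlap (affineVec (chartIndex p) x.1).ofLp (affineVec (chartIndex q) x.2).ofLp) := by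
    rw [contDiff_iff_contDiffAt]
    intro x
    have a1 : ContDiff ℝ ∞ (fun x : Coord n × Coord n => (affineVec (chartIndex p) x.1).ofLp) :=
      (contDiff_affineVec (r := ⊤) (chartIndex p)).comp contDiff_fst
    have a2 : ContDiff ℝ ∞ (fun x : Coord n × Coord n => (affineVec (chartIndex q) x.2).ofLp) :=
      (contDiff_affineVec (r := ⊤) (chartIndex q)).comp contDiff_snd
    exact ContDiffAt.comp x
      (contDiffAt_overlap_prod (r := ⊤) (x := ((affineVec (chartIndex p) x.1).ofLp,
        (affineVec (chartIndex q) x.2).ofLp)) (affineVec_ofLp_ne_zero _ _)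
        (affineVec_ofLp_ne_zero _ _)) (a1.prodMk a2).contDiffAt
  have h2 : ContMDiffAt (𝓘(ℝ, Coord n).prod 𝓘(ℝ, Coord n)) 𝓘(ℝ, Coord n × Coord n) ∞
      (fun x : CP n × CP n => (affineCoord (chartIndex p) x.1, affineCoord (chartIndex q) x.2))
      (p, q) := by
    refine ContMDiffAt.prodMk_space ?_ ?_
    · exact (contMDiffAt_affineCoord hp).comp (I := 𝓘(ℝ, Coord n).prod 𝓘(ℝ, Coord n)) (p, q)
        contMDiffAt_fst
    · exact (contMDiffAt_affineCoord hq).comp (I := 𝓘(ℝ, Coord n).prod 𝓘(ℝ, Coord n)) (p, q)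
        contMDiffAt_snd
  have h3 := (contMDiff_iff_contDiff.2 h1).contMDiffAt.comp (p, q) h2
  refine h3.congr_of_eventuallyEq ?_
  have e : affineDomain (chartIndex p) ×ˢ affineDomain (chartIndex q) ∈ 𝓝 (p, q) :=
    prod_mem_nhds ((isOpen_affineDomain _).mem_nhds hp) ((isOpen_affineDomain _).mem_nhds hq)
  filter_upwards [e] with x hx
  simp only [Function.comp_apply]
  rw [← cosSq_toCP (affineVec_ofLp_ne_zero _ _) (affineVec_ofLp_ne_zero _ _),
    ← affinePoint_eq_toCP, ← affinePoint_eq_toCP, affinePoint_affineCoord _ _ hx.1,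
    affinePoint_affineCoord _ _ hx.2]

/-! ### The topology of complex projective space -/

theorem isCompact_nsq_eq_one {m : ℕ} : IsCompact {ξ : Coord m | nsq ξ = 1} := by
  refine Metric.isCompact_of_isClosed_isBounded (isClosed_eq continuous_nsq continuous_const) ?_
  refine (Metric.isBounded_closedBall (x := 0) (r := 1)).subset fun ξ hξ => ?_
  rw [mem_closedBall_zero_iff, pi_norm_le_iff_of_nonneg zero_le_one]
  intro k
  have h : Complex.normSq (ξ k) ≤ nsq ξ :=
    Finset.single_le_sum (f := fun k => Complex.normSq (ξ k))
      (fun _ _ => Complex.normSq_nonneg _) (Finset.mem_univ k)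
  rw [Complex.normSq_eq_norm_sq, hξ.out] at h
  exact le_of_sq_le_sq (by simpa using h) zero_le_one

/-- Every nonzero vector is a positive multiple of a unit vector. -/
theorem exists_smul_nsq_eq_one {m : ℕ} {ξ : Coord m} (h : ξ ≠ 0) :
    ∃ c : ℂ, c ≠ 0 ∧ nsq (c • ξ) = 1 := by
  have h0 := nsq_pos h
  refine ⟨((√(nsq ξ))⁻¹ : ℝ), ?_, ?_⟩
  · simpa using (Real.sqrt_pos.2 h0).ne'
  · rw [nsq_smul, Complex.normSq_ofReal, ← mul_inv, Real.mul_self_sqrt h0.le,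
      inv_mul_cancel₀ h0.ne']

instance instCompactSpaceCP (n : ℕ) : CompactSpace (CP n) := by
  have h1 : IsCompact (toCP (n := n) '' {ξ | nsq ξ = 1}) := by
    refine isCompact_nsq_eq_one.image_of_continuousOn (continuousOn_toCP.mono ?_)
    rintro ξ hξ rfl
    simp at hξ
  refine ⟨?_⟩
  convert! h1
  refine (Set.eq_univ_of_forall fun p => ?_).symm
  obtain ⟨c, hc, h⟩ := exists_smul_nsq_eq_one (rep_ofLp_ne_zero p)
  exact ⟨_, h, by rw [toCP_smul c hc _ (rep_ofLp_ne_zero p), toCP_rep]⟩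

instance instT2SpaceCP (n : ℕ) : T2Space (CP n) := by
  refine T2Space.of_injective_continuous (f := fun q p => cosSq (n := n) p q) ?_ ?_
  · intro q q' h
    have h1 := congrFun h q
    simp only [cosSq_self] at h1
    exact (cosSq_eq_one_iff q q').1 h1.symm
  · exact continuous_pi continuous_cosSq

instance instSecondCountableTopologyCP (n : ℕ) : SecondCountableTopology (CP n) :=
  ChartedSpace.secondCountable_of_sigmaCompact (Coord n) (CP n)

instance instMetrizableSpaceCP (n : ℕ) : TopologicalSpace.MetrizableSpace (CP n) :=
  TopologicalSpace.metrizableSpace_of_t3_secondCountable _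

/-! ### The gradient of the squared cosine -/

theorem nsq_add {m : ℕ} (a b : Coord m) :
    nsq (a + b) = nsq a + 2 * (star a ⬝ᵥ b).re + nsq b := by
  simp only [nsq, dotProduct, Complex.re_sum, Finset.mul_sum, ← Finset.sum_add_distrib]
  refine Finset.sum_congr rfl fun k _ => ?_
  simp [Complex.normSq_apply]
  ring

theorem hasDerivAt_quadratic (a b c : ℝ) : HasDerivAt (fun s : ℝ => a + s * b + s ^ 2 * c) b 0 := by
  have h := (((hasDerivAt_id (0 : ℝ)).mul_const b).const_add a).add
    (((hasDerivAt_id (0 : ℝ)).pow 2).mul_const c)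
  refine (h.congr_deriv (by simp)).congr_of_eventuallyEq (.of_forall fun s => ?_)
  simp

theorem hasLineDerivAt_nsq {m : ℕ} (ξ η : Coord m) :
    HasLineDerivAt ℝ nsq (2 * (star ξ ⬝ᵥ η).re) ξ η := by
  have h := hasDerivAt_quadratic (nsq ξ) (2 * (star ξ ⬝ᵥ η).re) (nsq η)
  unfold HasLineDerivAt
  refine h.congr_of_eventuallyEq (.of_forall fun s => ?_)
  dsimp only
  rw [nsq_add, dotProduct_smul, Complex.smul_re, ← Complex.coe_smul s η, nsq_smul,
    Complex.normSq_ofReal]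
  simp only [smul_eq_mul]
  ring

theorem hasLineDerivAt_normSq_dotProduct {m : ℕ} (w ξ η : Coord m) :
    HasLineDerivAt ℝ (fun ξ => Complex.normSq (star w ⬝ᵥ ξ))
      (2 * (starRingEnd ℂ (star w ⬝ᵥ ξ) * (star w ⬝ᵥ η)).re) ξ η := by
  have h := hasDerivAt_quadratic (Complex.normSq (star w ⬝ᵥ ξ))
    (2 * (starRingEnd ℂ (star w ⬝ᵥ ξ) * (star w ⬝ᵥ η)).re) (Complex.normSq (star w ⬝ᵥ η))
  unfold HasLineDerivAt
  refine h.congr_of_eventuallyEq (.of_forall fun s => ?_)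
  dsimp only
  rw [dotProduct_add, dotProduct_smul]
  simp [Complex.normSq_apply]
  ring

theorem hasLineDerivAt_overlap {m : ℕ} {w ξ : Coord m} (hw : w ≠ 0) (hξ : ξ ≠ 0) (η : Coord m) :
    HasLineDerivAt ℝ (overlap w)
      (2 * (starRingEnd ℂ (star w ⬝ᵥ ξ) * (star w ⬝ᵥ η)).re / (nsq w * nsq ξ) -
        Complex.normSq (star w ⬝ᵥ ξ) * (2 * (star ξ ⬝ᵥ η).re) / (nsq w * nsq ξ ^ 2)) ξ η := by
  have h0 := (nsq_pos hw).ne'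
  have h1 := (nsq_pos hξ).ne'
  have h := HasDerivAt.div (hasLineDerivAt_normSq_dotProduct w ξ η)
    ((hasLineDerivAt_nsq ξ η).const_mul (nsq w)) (by simp [h0, h1])
  refine HasDerivAt.congr_deriv h ?_
  simp only [zero_smul, add_zero]
  field_simp

theorem fderiv_overlap {m : ℕ} {w ξ : Coord m} (hw : w ≠ 0) (hξ : ξ ≠ 0) (η : Coord m) :
    fderiv ℝ (overlap w) ξ η =
      2 * (starRingEnd ℂ (star w ⬝ᵥ ξ) * (star w ⬝ᵥ η)).re / (nsq w * nsq ξ) -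
        Complex.normSq (star w ⬝ᵥ ξ) * (2 * (star ξ ⬝ᵥ η).re) / (nsq w * nsq ξ ^ 2) := by
  have h : DifferentiableAt ℝ (overlap w) ξ :=
    (contDiffAt_overlap (r := 1) hw hξ).differentiableAt one_ne_zero
  rw [← h.lineDeriv_eq_fderiv]
  exact (hasLineDerivAt_overlap hw hξ η).lineDeriv

/-- The Gram determinant `|ξ|² |η|² - |⟨ξ, η⟩|²`. Divided by `|ξ|⁴`, it is the squared length of the
tangent vector of `ℂℙⁿ` at `[ξ]` that `η` represents. -/
noncomputable def gram {m : ℕ} (ξ η : Coord m) : ℝ :=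
  nsq ξ * nsq η - Complex.normSq (star ξ ⬝ᵥ η)

theorem gram_nonneg {m : ℕ} (ξ η : Coord m) : 0 ≤ gram ξ η :=
  sub_nonneg.2 (normSq_star_dotProduct_le ξ η)

theorem gram_smul_left {m : ℕ} (c : ℂ) (ξ η : Coord m) :
    gram (c • ξ) η = Complex.normSq c * gram ξ η := by
  simp only [gram, nsq_smul, star_smul, smul_dotProduct, smul_eq_mul, Complex.normSq_mul]
  rw [show Complex.normSq (star c) = Complex.normSq c from Complex.normSq_conj c]
  ring

theorem gram_smul_right {m : ℕ} (c : ℂ) (ξ η : Coord m) :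
    gram ξ (c • η) = Complex.normSq c * gram ξ η := by
  simp only [gram, nsq_smul, dotProduct_smul, smul_eq_mul, Complex.normSq_mul]
  ring

/-- Vectors proportional to `ξ` represent the zero tangent vector at `[ξ]`. -/
theorem gram_add_smul_right {m : ℕ} (c : ℂ) (ξ η : Coord m) :
    gram ξ (η + c • ξ) = gram ξ η := by
  simp only [gram, nsq_add, nsq_smul, dotProduct_smul, dotProduct_add, star_dotProduct_self,
    smul_eq_mul]
  rw [← conj_star_dotProduct ξ η]
  simp [Complex.normSq_apply]
  ring

theorem fubiniStudyForm_self {n : ℕ} (i : Fin (n + 1)) (z v : Coord n) :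
    fubiniStudyForm z v v =
      gram (affineVec i z).ofLp (i.insertNth (0 : ℂ) v : Fin (n + 1) → ℂ) /
        nsq (affineVec i z).ofLp ^ 2 := by
  have h1 : nsq (i.insertNth (0 : ℂ) v : Fin (n + 1) → ℂ) = nsq v := by
    simp [nsq, Fin.sum_univ_succAbove _ i]
  have h2 : star (affineVec i z).ofLp ⬝ᵥ (i.insertNth (0 : ℂ) v : Fin (n + 1) → ℂ) =
      star z ⬝ᵥ v := by
    simp [dotProduct, Fin.sum_univ_succAbove _ i, affineVec]
  rw [gram, h1, h2, nsq_affineVec, fubiniStudyForm]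
  simp only [star_dotProduct_self]
  rw [← Complex.ofReal_one, ← Complex.ofReal_add, ← Complex.ofReal_pow, Complex.div_ofReal_re,
    ← conj_star_dotProduct z v, ← Complex.normSq_eq_conj_mul_self, ← Complex.ofReal_mul,
    ← Complex.ofReal_sub, Complex.ofReal_re]

/-- The Cauchy–Schwarz inequality for the components of `w` and `η` orthogonal to `ξ`. -/
theorem normSq_le_gram_mul_gram {m : ℕ} (w ξ η : Coord m) (hξ : ξ ≠ 0) :
    Complex.normSq ((nsq ξ : ℂ) * (star w ⬝ᵥ η) - (star w ⬝ᵥ ξ) * (star ξ ⬝ᵥ η)) ≤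
      gram ξ w * gram ξ η := by
  have h0 := nsq_pos hξ
  have key : ∀ v : Coord m, nsq ((nsq ξ : ℂ) • v + (-(star ξ ⬝ᵥ v)) • ξ) = nsq ξ * gram ξ v := by
    intro v
    simp only [gram, nsq_add, nsq_smul, dotProduct_smul, star_smul, smul_dotProduct, smul_eq_mul,
      Complex.normSq_neg, Complex.normSq_ofReal]
    rw [← conj_star_dotProduct ξ v]
    simp [Complex.normSq_apply]
    ring
  have h := normSq_star_dotProduct_le ((nsq ξ : ℂ) • w + (-(star ξ ⬝ᵥ w)) • ξ)
    ((nsq ξ : ℂ) • η + (-(star ξ ⬝ᵥ η)) • ξ)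
  rw [key, key] at h
  have e : star ((nsq ξ : ℂ) • w + (-(star ξ ⬝ᵥ w)) • ξ) ⬝ᵥ
      ((nsq ξ : ℂ) • η + (-(star ξ ⬝ᵥ η)) • ξ) =
      (nsq ξ : ℂ) * ((nsq ξ : ℂ) * (star w ⬝ᵥ η) - (star w ⬝ᵥ ξ) * (star ξ ⬝ᵥ η)) := by
    simp only [star_add, star_smul, dotProduct_add, add_dotProduct, dotProduct_smul,
      smul_dotProduct, smul_eq_mul, star_dotProduct_self]
    rw [show star (-(star ξ ⬝ᵥ w)) = -(star w ⬝ᵥ ξ) by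
      rw [star_neg, ← conj_star_dotProduct ξ w]; rfl]
    rw [show star (nsq ξ : ℂ) = (nsq ξ : ℂ) from Complex.conj_ofReal _]
    ring
  rw [e, Complex.normSq_mul, Complex.normSq_ofReal] at h
  have h2 : 0 < nsq ξ * nsq ξ := mul_pos h0 h0
  refine le_of_mul_le_mul_left (h.trans (le_of_eq ?_)) h2
  ring

/-- The gradient of `cos² r` has length at most `2 cos r sin r`. -/
theorem sq_fderiv_overlap_le {m : ℕ} {w ξ : Coord m} (hw : w ≠ 0) (hξ : ξ ≠ 0) (η : Coord m) :
    (fderiv ℝ (overlap w) ξ η) ^ 2 ≤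
      4 * (overlap w ξ * (1 - overlap w ξ)) * (gram ξ η / nsq ξ ^ 2) := by
  have hM := nsq_pos hw
  have hN := nsq_pos hξ
  have e : fderiv ℝ (overlap w) ξ η =
      2 * (starRingEnd ℂ (star w ⬝ᵥ ξ) *
        ((nsq ξ : ℂ) * (star w ⬝ᵥ η) - (star w ⬝ᵥ ξ) * (star ξ ⬝ᵥ η))).re /
        (nsq w * nsq ξ ^ 2) := by
    rw [fderiv_overlap hw hξ]
    have : (starRingEnd ℂ (star w ⬝ᵥ ξ) *
        ((nsq ξ : ℂ) * (star w ⬝ᵥ η) - (star w ⬝ᵥ ξ) * (star ξ ⬝ᵥ η))).re =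
        nsq ξ * (starRingEnd ℂ (star w ⬝ᵥ ξ) * (star w ⬝ᵥ η)).re -
          Complex.normSq (star w ⬝ᵥ ξ) * (star ξ ⬝ᵥ η).re := by
      simp [Complex.normSq_apply]
      ring
    rw [this]
    field_simp
  have h1 := normSq_le_gram_mul_gram w ξ η hξ
  set c := (nsq ξ : ℂ) * (star w ⬝ᵥ η) - (star w ⬝ᵥ ξ) * (star ξ ⬝ᵥ η)
  have h2 : (starRingEnd ℂ (star w ⬝ᵥ ξ) * c).re ^ 2 ≤
      Complex.normSq (star w ⬝ᵥ ξ) * Complex.normSq c := by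
    have := Complex.re_sq_le_normSq (starRingEnd ℂ (star w ⬝ᵥ ξ) * c)
    rw [Complex.normSq_mul, Complex.normSq_conj] at this
    rw [sq]
    exact this
  have h3 : gram ξ w = nsq ξ * nsq w - Complex.normSq (star w ⬝ᵥ ξ) := by
    rw [gram, ← conj_star_dotProduct w ξ, Complex.normSq_conj]
  have h4 : (starRingEnd ℂ (star w ⬝ᵥ ξ) * c).re ^ 2 ≤
      Complex.normSq (star w ⬝ᵥ ξ) * (gram ξ w * gram ξ η) :=
    h2.trans (mul_le_mul_of_nonneg_left h1 (Complex.normSq_nonneg _))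
  rw [e, overlap, div_pow, div_le_iff₀ (by positivity), mul_pow]
  refine (mul_le_mul_of_nonneg_left h4 (by positivity)).trans (le_of_eq ?_)
  rw [h3]
  field_simp
  ring

theorem sq_fderiv_cosSq_le {n : ℕ} (p : CP n) (i : Fin (n + 1)) (z v : Coord n) :
    (fderiv ℝ (cosSq p ∘ affinePoint i) z v) ^ 2 ≤
      4 * (cosSq p (affinePoint i z) * (1 - cosSq p (affinePoint i z))) *
        fubiniStudyForm z v v := by
  have h1 : HasFDerivAt (fun z : Coord n => (affineVec i z).ofLp)
      (fderiv ℝ (fun z : Coord n => (affineVec i z).ofLp) z) z :=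
    ((contDiff_affineVec (r := 1) i).differentiable one_ne_zero z).hasFDerivAt
  have h2 : fderiv ℝ (fun z : Coord n => (affineVec i z).ofLp) z v =
      (i.insertNth (0 : ℂ) v : Fin (n + 1) → ℂ) := by
    have hd : DifferentiableAt ℝ (fun z : Coord n => (affineVec i z).ofLp) z :=
      (contDiff_affineVec (r := 1) i).differentiable one_ne_zero z
    rw [← hd.lineDeriv_eq_fderiv]
    refine HasLineDerivAt.lineDeriv ?_
    unfold HasLineDerivAt
    rw [hasDerivAt_pi]
    intro k
    refine Fin.succAboveCases i ?_ (fun k => ?_) k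
    · simp only [affineVec_ofLp_self, Fin.insertNth_apply_same]
      exact hasDerivAt_const _ _
    · simp only [affineVec_ofLp_succAbove, Fin.insertNth_apply_succAbove]
      have := ((hasDerivAt_id (0 : ℝ)).smul_const (v k)).const_add (z k)
      simpa using this
  have h3 : DifferentiableAt ℝ (overlap p.rep.ofLp) (affineVec i z).ofLp :=
    (contDiffAt_overlap (r := 1) (rep_ofLp_ne_zero p)
      (affineVec_ofLp_ne_zero i z)).differentiableAt one_ne_zero
  have e : cosSq p (affinePoint i z) = overlap p.rep.ofLp (affineVec i z).ofLp :=
    congrFun (cosSq_comp_affinePoint p i) z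
  rw [e, cosSq_comp_affinePoint, (h3.hasFDerivAt.comp z h1).fderiv,
    ContinuousLinearMap.comp_apply, h2, fubiniStudyForm_self i]
  exact sq_fderiv_overlap_le (rep_ofLp_ne_zero p) (affineVec_ofLp_ne_zero i z) _

/-! ### The geodesic distance -/

theorem norm_tangentSpace_sq {n : ℕ} {p : CP n} (v : TangentSpace 𝓘(ℝ, Coord n) p) :
    ‖v‖ ^ 2 = fubiniStudyForm (affineCoord (chartIndex p) p) v v := by
  rw [← real_inner_self_eq_norm_sq]
  rfl

theorem mfderiv_real_apply {n : ℕ} {φ : CP n → ℝ} (h : ContMDiff 𝓘(ℝ, Coord n) 𝓘(ℝ, ℝ) 1 φ)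
    (p : CP n) (v : TangentSpace 𝓘(ℝ, Coord n) p) :
    mfderiv 𝓘(ℝ, Coord n) 𝓘(ℝ, ℝ) φ p v =
      fderiv ℝ (φ ∘ affinePoint (chartIndex p)) (affineCoord (chartIndex p) p) v := by
  have h1 : MDifferentiableAt 𝓘(ℝ, Coord n) 𝓘(ℝ, ℝ) φ p := (h.mdifferentiable one_ne_zero) p
  rw [h1.mfderiv]
  simp only [modelWithCornersSelf_coe, Set.range_id, fderivWithin_univ]
  rfl

/-- A function whose gradient has length at most `1` varies by at most the geodesic distance. -/
theorem enorm_sub_le_geodesicDist {n : ℕ} {F : CP n → ℝ}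
    (h : ContMDiff 𝓘(ℝ, Coord n) 𝓘(ℝ, ℝ) 1 F)
    (hF : ∀ i z v, (fderiv ℝ (F ∘ affinePoint i) z v) ^ 2 ≤ fubiniStudyForm z v v) (p q : CP n) :
    ‖F q - F p‖ₑ ≤ geodesicDist p q := by
  refine le_of_forall_gt fun r hr => ?_
  obtain ⟨γ, h0, h1, hγ, hlt⟩ := exists_lt_of_riemannianEDist_lt hr
  refine lt_of_le_of_lt ?_ hlt
  have hc : ContDiffOn ℝ 1 (F ∘ γ) (Set.Icc 0 1) :=
    contMDiffOn_iff_contDiffOn.1 (h.comp_contMDiffOn hγ)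
  have h2 := enorm_sub_le_lintegral_deriv_of_contDiffOn_Icc hc zero_le_one
  simp only [Function.comp_apply, h0, h1] at h2
  refine h2.trans ?_
  rw [pathELength_eq_lintegral_mfderiv_Icc, ← restrict_Ioo_eq_restrict_Icc]
  refine setLIntegral_mono' measurableSet_Ioo fun t ht => ?_
  have hd : MDifferentiableAt 𝓘(ℝ, ℝ) 𝓘(ℝ, Coord n) γ t :=
    ((hγ.mdifferentiableOn one_ne_zero) t ⟨ht.1.le, ht.2.le⟩).mdifferentiableAt
      (Icc_mem_nhds ht.1 ht.2)
  have e : deriv (F ∘ γ) t = mfderiv 𝓘(ℝ, Coord n) 𝓘(ℝ, ℝ) F (γ t)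
      (mfderiv 𝓘(ℝ, ℝ) 𝓘(ℝ, Coord n) γ t 1) := by
    rw [← fderiv_apply_one_eq_deriv, ← mfderiv_eq_fderiv,
      mfderiv_comp t ((h.mdifferentiable one_ne_zero) (γ t)) hd]
    rfl
  rw [e, mfderiv_real_apply h]
  have h3 := hF (chartIndex (γ t)) (affineCoord (chartIndex (γ t)) (γ t))
    (mfderiv 𝓘(ℝ, ℝ) 𝓘(ℝ, Coord n) γ t 1)
  rw [← norm_tangentSpace_sq] at h3
  rw [← ofReal_norm, ← ofReal_norm, Real.norm_eq_abs]
  exact ENNReal.ofReal_le_ofReal (abs_le_of_sq_le_sq h3 (norm_nonneg _))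

theorem fsDist_nonneg {n : ℕ} (p q : CP n) : 0 ≤ fsDist p q := by
  rw [fsDist_eq]
  exact Real.arccos_nonneg _

theorem two_mul_fsDist {n : ℕ} (p q : CP n) :
    Real.arccos (2 * cosSq p q - 1) = 2 * fsDist p q := by
  have h0 := fsDist_nonneg p q
  have h1 : fsDist p q ≤ Real.pi / 2 := by
    rw [fsDist_eq]
    exact Real.arccos_le_pi_div_two.2 (Real.sqrt_nonneg _)
  have h2 : Real.cos (fsDist p q) ^ 2 = cosSq p q := by
    rw [fsDist_eq, Real.cos_arccos, Real.sq_sqrt (cosSq_nonneg p q)]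
    · linarith [Real.sqrt_nonneg (cosSq p q)]
    · exact Real.sqrt_le_one.2 (cosSq_le_one p q)
  rw [← h2, ← Real.cos_two_mul, Real.arccos_cos] <;> linarith

/-- The function `arccos (c (2 cos² r - 1)) / 2` of the distance `r` to `p`, which is smooth for
`0 ≤ c < 1`. It tends to `r` as `c` tends to `1`. -/
noncomputable def smoothedDist {n : ℕ} (c : ℝ) (p q : CP n) : ℝ :=
  Real.arccos (c * (2 * cosSq p q - 1)) / 2

theorem mul_two_cosSq_sub_one_mem {n : ℕ} {c : ℝ} (hc : 0 ≤ c) (hc1 : c < 1) (p q : CP n) :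
    -1 < c * (2 * cosSq p q - 1) ∧ c * (2 * cosSq p q - 1) < 1 := by
  have h1 := cosSq_nonneg p q
  have h2 := cosSq_le_one p q
  constructor <;> nlinarith

theorem contMDiff_smoothedDist {n : ℕ} {c : ℝ} (hc : 0 ≤ c) (hc1 : c < 1) (p : CP n) :
    ContMDiff 𝓘(ℝ, Coord n) 𝓘(ℝ, ℝ) 1 (smoothedDist c p) := by
  intro q
  obtain ⟨h1, h2⟩ := mul_two_cosSq_sub_one_mem hc hc1 p q
  have h3 : ContDiffAt ℝ 1 (fun t : ℝ => Real.arccos (c * (2 * t - 1)) / 2) (cosSq p q) := by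
    refine ContDiffAt.div_const ?_ 2
    exact ContDiffAt.comp (g := Real.arccos) (cosSq p q) (Real.contDiffAt_arccos h1.ne' h2.ne)
      (by fun_prop)
  exact (contMDiffAt_iff_contDiffAt.2 h3).comp q (contMDiff_cosSq (r := 1) p q)

theorem sq_fderiv_smoothedDist_le {n : ℕ} {c : ℝ} (hc : 0 ≤ c) (hc1 : c < 1) (p : CP n)
    (i : Fin (n + 1)) (z v : Coord n) :
    (fderiv ℝ (smoothedDist c p ∘ affinePoint i) z v) ^ 2 ≤ fubiniStudyForm z v v := by
  obtain ⟨h1, h2⟩ := mul_two_cosSq_sub_one_mem hc hc1 p (affinePoint i z)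
  have hb := sq_fderiv_cosSq_le p i z v
  have hd : DifferentiableAt ℝ (cosSq p ∘ affinePoint i) z :=
    (contDiff_comp_affinePoint (contMDiff_cosSq (r := 1) p) i).differentiable one_ne_zero z
  have ht0 := cosSq_nonneg p (affinePoint i z)
  have ht1 := cosSq_le_one p (affinePoint i z)
  set t := cosSq p (affinePoint i z) with ht
  have h3 : HasDerivAt (fun s : ℝ => Real.arccos (c * (2 * s - 1)) / 2)
      (-(1 / √(1 - (c * (2 * t - 1)) ^ 2)) * (c * 2) / 2) t := by
    have e1 : HasDerivAt (fun s : ℝ => c * (2 * s - 1)) (c * 2) t := by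
      simpa using (((hasDerivAt_id t).const_mul 2).sub_const 1).const_mul c
    exact ((Real.hasDerivAt_arccos h1.ne' h2.ne).comp t e1).div_const 2
  have h4 : HasFDerivAt (smoothedDist c p ∘ affinePoint i) _ z :=
    h3.comp_hasFDerivAt z hd.hasFDerivAt
  rw [h4.fderiv]
  set D := fderiv ℝ (cosSq p ∘ affinePoint i) z v
  have hpos : 0 < 1 - (c * (2 * t - 1)) ^ 2 := by nlinarith
  have e : (((-(1 / √(1 - (c * (2 * t - 1)) ^ 2)) * (c * 2) / 2) •
      fderiv ℝ (cosSq p ∘ affinePoint i) z) v) ^ 2 =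
      c ^ 2 * D ^ 2 / (1 - (c * (2 * t - 1)) ^ 2) := by
    have e2 : (1 / √(1 - (c * (2 * t - 1)) ^ 2)) ^ 2 = 1 / (1 - (c * (2 * t - 1)) ^ 2) := by
      rw [div_pow, one_pow, Real.sq_sqrt hpos.le]
    change (_ * D) ^ 2 = _
    rw [div_eq_mul_one_div (c ^ 2 * D ^ 2), ← e2]
    ring
  rw [e, div_le_iff₀ hpos]
  have hF : 0 ≤ fubiniStudyForm z v v := by
    rw [fubiniStudyForm_self i]
    exact div_nonneg (gram_nonneg _ _) (sq_nonneg _)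
  -- Equality would hold for `c = 1`, since `(2 t - 1)² + 4 t (1 - t) = 1`.
  have h5 : c ^ 2 * (4 * (t * (1 - t))) ≤ 1 - (c * (2 * t - 1)) ^ 2 := by nlinarith
  calc c ^ 2 * D ^ 2 ≤ c ^ 2 * (4 * (t * (1 - t)) * fubiniStudyForm z v v) := by gcongr
    _ = fubiniStudyForm z v v * (c ^ 2 * (4 * (t * (1 - t)))) := by ring
    _ ≤ _ := by gcongr

theorem le_geodesicDist {n : ℕ} (p q : CP n) : ENNReal.ofReal (fsDist p q) ≤ geodesicDist p q := by
  have h1 : Tendsto (fun c : ℝ => ‖smoothedDist c p q - smoothedDist c p p‖ₑ) (𝓝[<] 1)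
      (𝓝 ‖smoothedDist 1 p q - smoothedDist 1 p p‖ₑ) := by
    refine Tendsto.mono_left (Continuous.tendsto ?_ 1) nhdsWithin_le_nhds
    refine Continuous.enorm (Continuous.sub ?_ ?_) <;>
    · unfold smoothedDist
      fun_prop
  have h2 : ‖smoothedDist 1 p q - smoothedDist 1 p p‖ₑ = ENNReal.ofReal (fsDist p q) := by
    have e : ∀ q, smoothedDist 1 p q = fsDist p q := by
      intro q
      rw [smoothedDist, one_mul, two_mul_fsDist]
      ring
    have e0 : fsDist p p = 0 := by simp [fsDist_eq, cosSq_self]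
    rw [e, e, e0, sub_zero, Real.enorm_of_nonneg (fsDist_nonneg p q)]
  rw [← h2]
  refine le_of_tendsto h1 ?_
  filter_upwards [Ioo_mem_nhdsLT (show (0 : ℝ) < 1 from one_pos)] with c hc
  exact enorm_sub_le_geodesicDist (contMDiff_smoothedDist hc.1.le hc.2 p)
    (sq_fderiv_smoothedDist_le hc.1.le hc.2 p) p q

theorem contMDiffAt_toCP {n : ℕ} {ξ : Coord (n + 1)} (hξ : ξ ≠ 0) :
    ContMDiffAt 𝓘(ℝ, Coord (n + 1)) 𝓘(ℝ, Coord n) 1 toCP ξ := by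
  obtain ⟨i, hi⟩ := exists_apply_ne_zero hξ
  have h1 := ((contMDiff_affinePoint i).of_le (m := 1) (by exact_mod_cast le_top)).contMDiffAt.comp
    ξ (contMDiffAt_iff_contDiffAt.2 (contDiffAt_affine_quotient (r := 1) hi))
  refine h1.congr_of_eventuallyEq ?_
  have : ∀ᶠ η : Coord (n + 1) in 𝓝 ξ, η i ≠ 0 :=
    (continuous_apply i).continuousAt.eventually_ne hi
  filter_upwards [this] with η hη
  simp [toCP_eq_affinePoint i hη]

/-- The speed of the curve `[ξ(t)]`. -/
theorem norm_mfderiv_toCP_sq {n : ℕ} {ξ : ℝ → Coord (n + 1)} {η : Coord (n + 1)} {t : ℝ}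
    (h0 : ξ t ≠ 0) (h : HasDerivAt ξ η t) :
    ‖mfderiv 𝓘(ℝ, ℝ) 𝓘(ℝ, Coord n) (fun s => toCP (ξ s)) t (1 : ℝ)‖ ^ 2 =
      gram (ξ t) η / nsq (ξ t) ^ 2 := by
  rw [norm_tangentSpace_sq]
  set i := chartIndex (toCP (ξ t)) with hi
  have hit : ξ t i ≠ 0 :=
    (toCP_mem_affineDomain i h0).1 (mem_affineDomain_chartIndex (toCP (ξ t)))
  have hd : MDifferentiableAt 𝓘(ℝ, ℝ) 𝓘(ℝ, Coord n) (fun s => toCP (ξ s)) t :=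
    ((contMDiffAt_toCP h0).mdifferentiableAt one_ne_zero).comp t
      (mdifferentiableAt_iff_differentiableAt.2 h.differentiableAt)
  have hev : ∀ᶠ s in 𝓝 t, ξ s i ≠ 0 :=
    ((hasDerivAt_pi.1 h i).continuousAt).eventually_ne hit
  set v : Coord n := fun k => (η (i.succAbove k) * ξ t i - ξ t (i.succAbove k) * η i) / ξ t i ^ 2
    with hv
  have hz : HasDerivAt (fun s => affineCoord i (toCP (ξ s))) v t := by
    have : HasDerivAt (fun s (k : Fin n) => ξ s (i.succAbove k) / ξ s i) v t := by
      rw [hasDerivAt_pi]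
      intro k
      exact (hasDerivAt_pi.1 h (i.succAbove k)).div (hasDerivAt_pi.1 h i) hit
    refine this.congr_of_eventuallyEq ?_
    filter_upwards [hev] with s hs
    exact affineCoord_toCP i (ne_zero_of_apply_ne_zero hs)
  have e : (mfderiv 𝓘(ℝ, ℝ) 𝓘(ℝ, Coord n) (fun s => toCP (ξ s)) t (1 : ℝ) : Coord n) = v := by
    rw [hd.mfderiv]
    simp only [modelWithCornersSelf_coe, Set.range_id, fderivWithin_univ]
    exact hz.deriv
  rw [e, affineCoord_toCP i h0, fubiniStudyForm_self i]
  have e1 : (affineVec i fun k => ξ t (i.succAbove k) / ξ t i).ofLp = (ξ t i)⁻¹ • ξ t := by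
    funext k
    refine Fin.succAboveCases i ?_ (fun k => ?_) k
    · simp [affineVec_ofLp_self, hit]
    · simp [affineVec_ofLp_succAbove, div_eq_inv_mul]
  -- The derivative of the affine coordinates represents the same tangent vector as `η`: up to the
  -- scaling of the base point, they differ by a multiple of it.
  have e2 : (i.insertNth (0 : ℂ) v : Fin (n + 1) → ℂ) =
      (ξ t i)⁻¹ • η + (-(η i / ξ t i)) • ((ξ t i)⁻¹ • ξ t) := by
    funext k
    refine Fin.succAboveCases i ?_ (fun k => ?_) k
    · simp only [Fin.insertNth_apply_same, Pi.add_apply, Pi.smul_apply, smul_eq_mul]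
      field_simp
      ring
    · simp only [Fin.insertNth_apply_succAbove, Pi.add_apply, Pi.smul_apply, smul_eq_mul, hv]
      field_simp
      ring
  rw [e1, e2, gram_add_smul_right, gram_smul_left, gram_smul_right, nsq_smul]
  have h1 : Complex.normSq (ξ t i)⁻¹ ≠ 0 := by simpa using hit
  rw [mul_pow, ← mul_assoc, ← sq, mul_div_mul_left _ _ (pow_ne_zero 2 h1)]

/-- Representatives of two points that are adapted to the geodesic between them. -/
theorem exists_orthonormal_representatives {n : ℕ} {p q : CP n} (h : p ≠ q) :
    ∃ u v : Coord (n + 1), nsq u = 1 ∧ nsq v = 1 ∧ star u ⬝ᵥ v = 0 ∧ toCP u = p ∧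
      toCP (Real.cos (fsDist p q) • u + Real.sin (fsDist p q) • v) = q := by
  obtain ⟨a, ha, hu⟩ := exists_smul_nsq_eq_one (rep_ofLp_ne_zero p)
  obtain ⟨b, hb, hw⟩ := exists_smul_nsq_eq_one (rep_ofLp_ne_zero q)
  set u := a • p.rep.ofLp with hu'
  set w := b • q.rep.ofLp with hw'
  have hup : toCP u = p := by rw [hu', toCP_smul a ha _ (rep_ofLp_ne_zero p), toCP_rep]
  have hwq : toCP w = q := by rw [hw', toCP_smul b hb _ (rep_ofLp_ne_zero q), toCP_rep]
  have hw0 : w ≠ 0 := smul_ne_zero hb (rep_ofLp_ne_zero q)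
  have hu0 : u ≠ 0 := smul_ne_zero ha (rep_ofLp_ne_zero p)
  clear_value u w
  set c := star u ⬝ᵥ w with hc
  -- The phase `e` makes the inner product of the two unit vectors real and nonnegative.
  obtain ⟨e, he, hec⟩ : ∃ e : ℂ, ‖e‖ = 1 ∧ e * c = (‖c‖ : ℂ) := by
    by_cases h0 : c = 0
    · exact ⟨1, by simp, by simp [h0]⟩
    · have : (‖c‖ : ℂ) ≠ 0 := by simpa using h0
      refine ⟨(‖c‖ : ℂ) / c, ?_, by field_simp⟩
      rw [norm_div]
      simp [h0]
  have he0 : e ≠ 0 := by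
    rintro rfl
    simp at he
  have hcs : ‖c‖ ^ 2 = cosSq p q := by
    rw [← hup, ← hwq, cosSq_toCP hu0 hw0, overlap, hu, hw, mul_one, div_one,
      Complex.normSq_eq_norm_sq]
  have hcos : Real.cos (fsDist p q) = ‖c‖ := by
    rw [fsDist_eq, ← hcs, Real.sqrt_sq (norm_nonneg _), Real.cos_arccos]
    · linarith [norm_nonneg c]
    · refine le_of_sq_le_sq ?_ zero_le_one
      rw [hcs, one_pow]
      exact cosSq_le_one p q
  have hsin2 : Real.sin (fsDist p q) ^ 2 = 1 - ‖c‖ ^ 2 := by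
    rw [Real.sin_sq, hcos]
  have hsin : Real.sin (fsDist p q) ≠ 0 := by
    intro h1
    rw [h1, hcs] at hsin2
    have := cosSq_lt_one h
    linarith
  set S := Real.sin (fsDist p q)
  refine ⟨u, (S⁻¹ : ℝ) • (e • w - ‖c‖ • u), hu, ?_, ?_, hup, ?_⟩
  · have h1 : nsq (e • w - ‖c‖ • u) = S ^ 2 := by
      rw [sub_eq_add_neg, ← neg_smul, ← Complex.coe_smul, nsq_add, nsq_smul, nsq_smul, hw, hu,
        dotProduct_smul, star_smul, smul_dotProduct, hsin2, Complex.normSq_eq_norm_sq, he,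
        Complex.normSq_ofReal]
      rw [← conj_star_dotProduct u w, ← hc]
      have : star e • (starRingEnd ℂ c) = (‖c‖ : ℂ) := by
        have := congrArg (starRingEnd ℂ) hec
        rwa [map_mul, Complex.conj_ofReal] at this
      rw [this, smul_eq_mul, ← Complex.ofReal_mul, Complex.ofReal_re]
      ring
    rw [← Complex.coe_smul, nsq_smul, h1, Complex.normSq_ofReal]
    field_simp
  · rw [dotProduct_smul, dotProduct_sub, dotProduct_smul, dotProduct_smul, star_dotProduct_self, hu,
      ← hc, smul_eq_mul, hec]
    simp
  · rw [smul_smul, mul_inv_cancel₀ hsin, one_smul, hcos, add_sub_cancel, toCP_smul e he0 w hw0, hwq]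

theorem geodesicDist_le {n : ℕ} (p q : CP n) : geodesicDist p q ≤ ENNReal.ofReal (fsDist p q) := by
  rcases eq_or_ne p q with rfl | h
  · rw [geodesicDist, riemannianEDist_self]
    exact zero_le
  obtain ⟨u, v, hu, hv, huv, hp, hq⟩ := exists_orthonormal_representatives h
  have hvu : star v ⬝ᵥ u = 0 := by rw [← conj_star_dotProduct, huv, map_zero]
  -- The arc of a great circle orthogonal to the Hopf fibres projects to a curve of unit speed.
  set ξ : ℝ → Coord (n + 1) := fun s => Real.cos s • u + Real.sin s • v with hξ
  have hdot : ∀ a b c d : ℝ, star (a • u + b • v) ⬝ᵥ (c • u + d • v) =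
      ((a * c + b * d : ℝ) : ℂ) := by
    intro a b c d
    simp only [star_add, star_smul, dotProduct_add, add_dotProduct, dotProduct_smul,
      smul_dotProduct, star_dotProduct_self, huv, hvu, hu, hv]
    simp [mul_comm]
  have hnsq : ∀ a b : ℝ, nsq (a • u + b • v) = a ^ 2 + b ^ 2 := by
    intro a b
    have := hdot a b a b
    rw [star_dotProduct_self] at this
    rw [Complex.ofReal_injective this]
    ring
  have hN : ∀ s, nsq (ξ s) = 1 := fun s => by
    rw [hξ, hnsq, Real.cos_sq_add_sin_sq]
  have h0 : ∀ s, ξ s ≠ 0 := by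
    intro s h1
    have := hN s
    rw [h1] at this
    simp at this
  have hder : ∀ s, HasDerivAt ξ ((-Real.sin s) • u + Real.cos s • v) s := fun s =>
    ((Real.hasDerivAt_cos s).smul_const u).add ((Real.hasDerivAt_sin s).smul_const v)
  have hsm : ContDiff ℝ 1 ξ :=
    (Real.contDiff_cos.smul contDiff_const).add (Real.contDiff_sin.smul contDiff_const)
  have hγ : ContMDiff 𝓘(ℝ, ℝ) 𝓘(ℝ, Coord n) 1 (fun s => toCP (ξ s)) := fun s =>
    (contMDiffAt_toCP (h0 s)).comp s (contMDiff_iff_contDiff.2 hsm).contMDiffAt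
  have hspeed : ∀ s, ‖mfderiv 𝓘(ℝ, ℝ) 𝓘(ℝ, Coord n) (fun s => toCP (ξ s)) s (1 : ℝ)‖ = 1 := by
    intro s
    have h1 := norm_mfderiv_toCP_sq (h0 s) (hder s)
    rw [gram, hN, hnsq, hdot] at h1
    have h2 : Real.cos s * -Real.sin s + Real.sin s * Real.cos s = 0 := by ring
    rw [h2, neg_sq, Real.sin_sq_add_cos_sq] at h1
    have h3 : (0 : ℝ) ≤ ‖mfderiv 𝓘(ℝ, ℝ) 𝓘(ℝ, Coord n) (fun s => toCP (ξ s)) s (1 : ℝ)‖ :=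
      norm_nonneg _
    rw [← pow_left_inj₀ h3 zero_le_one two_ne_zero, h1]
    simp
  have h1 : geodesicDist p q ≤
      pathELength 𝓘(ℝ, Coord n) (fun s => toCP (ξ s)) 0 (fsDist p q) := by
    refine riemannianEDist_le_pathELength hγ.contMDiffOn ?_ hq (fsDist_nonneg p q)
    simp [hξ, hp]
  refine h1.trans_eq ?_
  rw [pathELength_eq_lintegral_mfderiv_Icc]
  have h2 : ∀ s, ‖mfderiv 𝓘(ℝ, ℝ) 𝓘(ℝ, Coord n) (fun s => toCP (ξ s)) s (1 : ℝ)‖ₑ = 1 := by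
    intro s
    rw [← ofReal_norm, hspeed, ENNReal.ofReal_one]
  refine (lintegral_congr h2).trans ?_
  simp

theorem geodesicDist_eq {n : ℕ} (p q : CP n) : geodesicDist p q = ENNReal.ofReal (fsDist p q) :=
  (geodesicDist_le p q).antisymm (le_geodesicDist p q)

/-! ### The Laplace–Beltrami operator and the volume density in an affine chart -/

/-- The real coordinates of a vector of `ℂᵐ` in the basis `coordDir`. -/
def realCoord {m : ℕ} (z : Coord m) : Fin m ⊕ Fin m → ℝ :=
  Sum.elim (fun k => (z k).re) (fun k => (z k).im)

theorem sum_realCoord_smul_coordDir {m : ℕ} (z : Coord m) :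
    ∑ a, realCoord z a • coordDir a = z := by
  simp only [Fintype.sum_sum_type, realCoord, coordDir, Sum.elim_inl, Sum.elim_inr]
  funext k
  simp [Finset.sum_apply, Pi.single_apply]

theorem realCoord_add_smul {m : ℕ} (z w : Coord m) (s : ℝ) (a : Fin m ⊕ Fin m) :
    realCoord (z + s • w) a = realCoord z a + s * realCoord w a := by
  rcases a with k | k <;> simp [realCoord]

theorem realCoord_coordDir {m : ℕ} (a b : Fin m ⊕ Fin m) :
    realCoord (coordDir b) a = (1 : Matrix (Fin m ⊕ Fin m) (Fin m ⊕ Fin m) ℝ) a b := by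
  rcases a with k | k <;> rcases b with l | l <;>
    simp [realCoord, coordDir, Matrix.one_apply, Pi.single_apply, apply_ite Complex.re,
      apply_ite Complex.im]

theorem sum_realCoord_sq {m : ℕ} (z : Coord m) : ∑ a, realCoord z a * realCoord z a = nsq z := by
  simp [realCoord, nsq, Complex.normSq_apply, Finset.sum_add_distrib]

theorem sum_realCoord_mul_I_smul {m : ℕ} (z : Coord m) :
    ∑ a, realCoord z a * realCoord (Complex.I • z) a = 0 := by
  simp only [realCoord, Fintype.sum_sum_type, Sum.elim_inl, Sum.elim_inr, ← Finset.sum_add_distrib]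
  refine Finset.sum_eq_zero fun k _ => ?_
  simp
  ring

theorem realCoord_I_smul_coordDir_self {m : ℕ} (b : Fin m ⊕ Fin m) :
    realCoord (Complex.I • coordDir b) b = 0 := by
  rcases b with l | l <;> simp [realCoord, coordDir]

theorem sum_realCoord_I_smul_coordDir {m : ℕ} (z : Coord m) (a : Fin m ⊕ Fin m) :
    ∑ b, realCoord (Complex.I • coordDir b) a * realCoord (Complex.I • z) b = -realCoord z a := by
  rcases a with k | k <;>
    simp [realCoord, coordDir, Pi.single_apply, apply_ite Complex.re, apply_ite Complex.im]

theorem star_dotProduct_coordDir {m : ℕ} (z : Coord m) (a : Fin m ⊕ Fin m) :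
    star z ⬝ᵥ coordDir a = ⟨realCoord z a, realCoord (Complex.I • z) a⟩ := by
  rcases a with k | k <;> apply Complex.ext <;> simp [realCoord, coordDir]

theorem metricMatrix_apply {n : ℕ} (z : Coord n) (a b : Fin n ⊕ Fin n) :
    metricMatrix z a b = ((1 + nsq z) * (1 : Matrix (Fin n ⊕ Fin n) (Fin n ⊕ Fin n) ℝ) a b -
      (realCoord z a * realCoord z b + realCoord (Complex.I • z) a * realCoord (Complex.I • z) b)) /
        (1 + nsq z) ^ 2 := by
  change fubiniStudyForm z (coordDir a) (coordDir b) = _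
  rw [fubiniStudyForm, star_dotProduct_self, ← Complex.ofReal_one, ← Complex.ofReal_add,
    ← Complex.ofReal_pow, Complex.div_ofReal_re, ← conj_star_dotProduct z (coordDir a),
    star_dotProduct_coordDir, star_dotProduct_coordDir, star_dotProduct_coordDir,
    realCoord_coordDir, Matrix.one_apply, Matrix.one_apply]
  congr 1
  simp [eq_comm]

/-- The `2n × 2` matrix whose columns are the real coordinates of `z` and of `i z`. -/
def complexLineMatrix {n : ℕ} (z : Coord n) : Matrix (Fin n ⊕ Fin n) (Fin 2) ℝ :=
  Matrix.of fun a j => ![realCoord z a, realCoord (Complex.I • z) a] j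

theorem complexLineMatrix_mul_transpose_apply {n : ℕ} (z : Coord n) (a b : Fin n ⊕ Fin n) :
    (complexLineMatrix z * (complexLineMatrix z).transpose) a b =
      realCoord z a * realCoord z b +
        realCoord (Complex.I • z) a * realCoord (Complex.I • z) b := by
  simp [Matrix.mul_apply, complexLineMatrix, Fin.sum_univ_two]

theorem nsq_I_smul {n : ℕ} (z : Coord n) : nsq (Complex.I • z) = nsq z := by
  simp [nsq_smul]

theorem transpose_mul_complexLineMatrix {n : ℕ} (z : Coord n) :
    (complexLineMatrix z).transpose * complexLineMatrix z = nsq z • 1 := by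
  have h := sum_realCoord_mul_I_smul z
  ext i j
  fin_cases i <;> fin_cases j
  · simpa [Matrix.mul_apply, complexLineMatrix] using sum_realCoord_sq z
  · simpa [Matrix.mul_apply, complexLineMatrix] using h
  · simpa [Matrix.mul_apply, complexLineMatrix, mul_comm] using h
  · simpa [Matrix.mul_apply, complexLineMatrix, nsq_I_smul] using sum_realCoord_sq (Complex.I • z)

theorem one_add_nsq_pos {n : ℕ} (z : Coord n) : 0 < 1 + nsq z := one_add_sum_normSq_pos z

theorem metricMatrix_eq {n : ℕ} (z : Coord n) :
    metricMatrix z = (1 + nsq z)⁻¹ •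
      (1 - (1 + nsq z)⁻¹ • (complexLineMatrix z * (complexLineMatrix z).transpose)) := by
  have h := (one_add_nsq_pos z).ne'
  ext a b
  rw [metricMatrix_apply, Matrix.smul_apply, Matrix.sub_apply, Matrix.smul_apply,
    complexLineMatrix_mul_transpose_apply, smul_eq_mul, smul_eq_mul]
  field_simp

theorem det_metricMatrix {n : ℕ} (z : Coord n) :
    (metricMatrix z).det = ((1 + nsq z)⁻¹ ^ (n + 1)) ^ 2 := by
  have h := (one_add_nsq_pos z).ne'
  have h1 : (1 - (1 + nsq z)⁻¹ • (complexLineMatrix z * (complexLineMatrix z).transpose)).det =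
      (1 + nsq z)⁻¹ ^ 2 := by
    -- By the Weinstein–Aronszajn identity this is a `2 × 2` determinant.
    rw [sub_eq_add_neg, ← neg_smul, ← Matrix.smul_mul, Matrix.det_one_add_mul_comm,
      Matrix.mul_smul, transpose_mul_complexLineMatrix, smul_smul,
      show (1 : Matrix (Fin 2) (Fin 2) ℝ) + (-(1 + nsq z)⁻¹ * nsq z) • 1 = (1 + nsq z)⁻¹ • 1 by
        conv_lhs => rw [← one_smul ℝ (1 : Matrix (Fin 2) (Fin 2) ℝ), smul_smul, ← add_smul]
        congr 1
        field_simp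
        ring, Matrix.det_smul]
    simp
  rw [metricMatrix_eq, Matrix.det_smul, h1, Fintype.card_sum, Fintype.card_fin]
  ring

theorem volDensity_eq {n : ℕ} (z : Coord n) : volDensity z = (1 + nsq z)⁻¹ ^ (n + 1) := by
  have h := one_add_nsq_pos z
  rw [volDensity, det_metricMatrix, abs_of_nonneg (by positivity), Real.sqrt_sq (by positivity)]

theorem inv_metricMatrix {n : ℕ} (z : Coord n) :
    (metricMatrix z)⁻¹ =
      (1 + nsq z) • (1 + complexLineMatrix z * (complexLineMatrix z).transpose) := by
  have h := (one_add_nsq_pos z).ne'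
  refine Matrix.inv_eq_right_inv ?_
  rw [metricMatrix_eq, Matrix.smul_mul, Matrix.mul_smul, smul_smul, inv_mul_cancel₀ h, one_smul,
    sub_mul, one_mul, mul_add, mul_one, Matrix.smul_mul,
    show complexLineMatrix z * (complexLineMatrix z).transpose *
      (complexLineMatrix z * (complexLineMatrix z).transpose) =
      nsq z • (complexLineMatrix z * (complexLineMatrix z).transpose) by
        rw [Matrix.mul_assoc, ← Matrix.mul_assoc (complexLineMatrix z).transpose,
          transpose_mul_complexLineMatrix, Matrix.smul_mul, Matrix.one_mul, Matrix.mul_smul]]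
  rw [smul_smul, ← add_smul, show (1 + nsq z)⁻¹ + (1 + nsq z)⁻¹ * nsq z = 1 by field_simp, one_smul]
  abel

/-- The symbol `g^{ab} √|det g|` of the Laplace–Beltrami operator in an affine chart. -/
noncomputable def laplaceSymbol {n : ℕ} (a b : Fin n ⊕ Fin n) (z : Coord n) : ℝ :=
  (1 + nsq z)⁻¹ ^ n * ((1 : Matrix (Fin n ⊕ Fin n) (Fin n ⊕ Fin n) ℝ) a b +
    (realCoord z a * realCoord z b + realCoord (Complex.I • z) a * realCoord (Complex.I • z) b))

theorem inv_metricMatrix_mul_volDensity {n : ℕ} (z : Coord n) (a b : Fin n ⊕ Fin n) :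
    (metricMatrix z)⁻¹ a b * volDensity z = laplaceSymbol a b z := by
  have h := (one_add_nsq_pos z).ne'
  rw [inv_metricMatrix, volDensity_eq, laplaceSymbol, Matrix.smul_apply, Matrix.add_apply,
    complexLineMatrix_mul_transpose_apply, pow_succ, smul_eq_mul]
  field_simp

theorem contDiff_realCoord {m : ℕ} {r : ℕ∞} (a : Fin m ⊕ Fin m) :
    ContDiff ℝ r (fun z : Coord m => realCoord z a) := by
  rcases a with k | k
  · exact Complex.reCLM.contDiff.comp (contDiff_apply ℝ ℂ k)
  · exact Complex.imCLM.contDiff.comp (contDiff_apply ℝ ℂ k)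

theorem contDiff_laplaceSymbol {n : ℕ} {r : ℕ∞} (a b : Fin n ⊕ Fin n) :
    ContDiff ℝ r (laplaceSymbol (n := n) a b) := by
  unfold laplaceSymbol
  have h1 := contDiff_realCoord (m := n) (r := r)
  have h2 : ∀ a, ContDiff ℝ r (fun z : Coord n => realCoord (Complex.I • z) a) := fun a =>
    (h1 a).comp (contDiff_const_smul Complex.I)
  refine ContDiff.mul ?_ (contDiff_const.add (((h1 a).mul (h1 b)).add ((h2 a).mul (h2 b))))
  exact ((contDiff_const.add contDiff_nsq).inv fun z => (one_add_nsq_pos z).ne').pow n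

theorem hasLineDerivAt_realCoord {m : ℕ} (a : Fin m ⊕ Fin m) (z w : Coord m) :
    HasLineDerivAt ℝ (fun z : Coord m => realCoord z a) (realCoord w a) z w := by
  have h := ((hasDerivAt_id (0 : ℝ)).mul_const (realCoord w a)).const_add (realCoord z a)
  refine (h.congr_deriv (by simp)).congr_of_eventuallyEq (.of_forall fun s => ?_)
  exact realCoord_add_smul z w s a

theorem hasLineDerivAt_realCoord_I_smul {m : ℕ} (a : Fin m ⊕ Fin m) (z w : Coord m) :
    HasLineDerivAt ℝ (fun z : Coord m => realCoord (Complex.I • z) a)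
      (realCoord (Complex.I • w) a) z w := by
  have h := hasLineDerivAt_realCoord a (Complex.I • z) (Complex.I • w)
  refine HasDerivAt.congr_of_eventuallyEq h (.of_forall fun s => ?_)
  dsimp only
  rw [smul_add, smul_comm Complex.I s w]

theorem star_dotProduct_coordDir_re {m : ℕ} (z : Coord m) (a : Fin m ⊕ Fin m) :
    (star z ⬝ᵥ coordDir a).re = realCoord z a := by
  rw [star_dotProduct_coordDir]

theorem fderiv_laplaceSymbol {n : ℕ} (a b : Fin n ⊕ Fin n) (z : Coord n) :
    fderiv ℝ (laplaceSymbol a b) z (coordDir b) =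
      -(2 * n) * (1 + nsq z)⁻¹ ^ (n + 1) * (realCoord z b *
        ((1 : Matrix (Fin n ⊕ Fin n) (Fin n ⊕ Fin n) ℝ) a b + (realCoord z a * realCoord z b +
          realCoord (Complex.I • z) a * realCoord (Complex.I • z) b))) +
      (1 + nsq z)⁻¹ ^ n * ((1 : Matrix (Fin n ⊕ Fin n) (Fin n ⊕ Fin n) ℝ) a b * realCoord z b +
        realCoord z a + realCoord (Complex.I • coordDir b) a * realCoord (Complex.I • z) b) := by
  have hd : DifferentiableAt ℝ (laplaceSymbol a b) z :=
    (contDiff_laplaceSymbol (r := 1) a b).differentiable one_ne_zero z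
  have hS := (one_add_nsq_pos z).ne'
  have h1 := hasLineDerivAt_nsq z (coordDir b)
  rw [star_dotProduct_coordDir_re] at h1
  have h2 : HasDerivAt (fun s : ℝ => (1 + nsq (z + s • coordDir b))⁻¹ ^ n)
      (-(2 * n) * (1 + nsq z)⁻¹ ^ (n + 1) * realCoord z b) 0 := by
    refine (((HasDerivAt.const_add (1 : ℝ) h1).fun_inv (by simpa using hS)).fun_pow
      n).congr_deriv ?_
    simp only [zero_smul, add_zero]
    rcases n with _ | n
    · simp
    · rw [Nat.add_sub_cancel]
      push_cast
      rw [div_eq_mul_inv, ← inv_pow]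
      ring
  have h3 := HasDerivAt.fun_mul (hasLineDerivAt_realCoord a z (coordDir b))
    (hasLineDerivAt_realCoord b z (coordDir b))
  have h4 := HasDerivAt.fun_mul (hasLineDerivAt_realCoord_I_smul a z (coordDir b))
    (hasLineDerivAt_realCoord_I_smul b z (coordDir b))
  have h5 := h2.fun_mul ((h3.fun_add h4).const_add
    ((1 : Matrix (Fin n ⊕ Fin n) (Fin n ⊕ Fin n) ℝ) a b))
  rw [← hd.lineDeriv_eq_fderiv]
  refine HasLineDerivAt.lineDeriv (HasDerivAt.congr_deriv h5 ?_)
  simp only [zero_smul, add_zero, realCoord_I_smul_coordDir_self, realCoord_coordDir,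
    Matrix.one_apply_eq]
  ring

/-- The affine coordinates are harmonic, as on every Kähler manifold. -/
theorem sum_fderiv_laplaceSymbol {n : ℕ} (a : Fin n ⊕ Fin n) (z : Coord n) :
    ∑ b, fderiv ℝ (laplaceSymbol a b) z (coordDir b) = 0 := by
  have hS := (one_add_nsq_pos z).ne'
  simp only [fderiv_laplaceSymbol]
  rw [Finset.sum_add_distrib, ← Finset.mul_sum, ← Finset.mul_sum]
  have e1 : ∑ b, realCoord z b * ((1 : Matrix (Fin n ⊕ Fin n) (Fin n ⊕ Fin n) ℝ) a b +
      (realCoord z a * realCoord z b +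
        realCoord (Complex.I • z) a * realCoord (Complex.I • z) b)) =
      (1 + nsq z) * realCoord z a := by
    have : ∀ b, realCoord z b * ((1 : Matrix (Fin n ⊕ Fin n) (Fin n ⊕ Fin n) ℝ) a b +
      (realCoord z a * realCoord z b +
        realCoord (Complex.I • z) a * realCoord (Complex.I • z) b)) =
        (1 : Matrix (Fin n ⊕ Fin n) (Fin n ⊕ Fin n) ℝ) a b * realCoord z b +
        realCoord z a * (realCoord z b * realCoord z b) +
        realCoord (Complex.I • z) a * (realCoord z b * realCoord (Complex.I • z) b) := by
      intro b
      ring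
    simp only [this, Finset.sum_add_distrib, ← Finset.mul_sum, sum_realCoord_sq,
      sum_realCoord_mul_I_smul]
    simp [Matrix.one_apply]
    ring
  have e2 : ∑ b, ((1 : Matrix (Fin n ⊕ Fin n) (Fin n ⊕ Fin n) ℝ) a b * realCoord z b +
        realCoord z a + realCoord (Complex.I • coordDir b) a * realCoord (Complex.I • z) b) =
      2 * n * realCoord z a := by
    rw [Finset.sum_add_distrib, Finset.sum_add_distrib, sum_realCoord_I_smul_coordDir]
    simp only [Matrix.one_apply, ite_mul, one_mul, zero_mul, Finset.sum_ite_eq, Finset.mem_univ,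
      if_true, Finset.sum_const, Finset.card_univ, Fintype.card_sum, Fintype.card_fin, nsmul_eq_mul]
    push_cast
    ring
  have e3 : (1 + nsq z)⁻¹ ^ (n + 1) * (1 + nsq z) = (1 + nsq z)⁻¹ ^ n := by
    rw [pow_succ, mul_assoc, inv_mul_cancel₀ hS, mul_one]
  rw [e1, e2]
  linear_combination (-(2 * n) * realCoord z a) * e3

theorem fderiv_fderiv_apply {m : ℕ} {f : Coord m → ℝ} {z : Coord m} (hf : ContDiffAt ℝ 2 f z)
    (v w : Coord m) :
    fderiv ℝ (fun y => fderiv ℝ f y w) z v = fderiv ℝ (fderiv ℝ f) z v w := by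
  have h : DifferentiableAt ℝ (fderiv ℝ f) z :=
    (hf.fderiv_right (m := 1) le_rfl).differentiableAt one_ne_zero
  have := (h.hasFDerivAt.clm_apply (hasFDerivAt_const w z)).fderiv
  rw [this]
  simp

theorem sum_sum_realCoord_mul {m : ℕ} (B : Coord m →L[ℝ] Coord m →L[ℝ] ℝ) (z w : Coord m) :
    ∑ a, ∑ b, realCoord z a * realCoord w b * B (coordDir b) (coordDir a) = B w z := by
  conv_rhs => rw [← sum_realCoord_smul_coordDir z, ← sum_realCoord_smul_coordDir w]
  simp only [map_sum, sum_apply, map_smul, smul_apply, smul_eq_mul,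
    Finset.mul_sum]
  refine Finset.sum_congr rfl fun a _ => Finset.sum_congr rfl fun b _ => ?_
  ring

/-- The Laplace–Beltrami operator in an affine chart, in terms of second derivatives. -/
theorem coordLaplacian_eq {n : ℕ} {f : Coord n → ℝ} {z : Coord n} (hf : ContDiffAt ℝ 2 f z) :
    coordLaplacian f z = -((1 + nsq z) * (∑ a, fderiv ℝ (fderiv ℝ f) z (coordDir a) (coordDir a) +
      fderiv ℝ (fderiv ℝ f) z z z +
      fderiv ℝ (fderiv ℝ f) z (Complex.I • z) (Complex.I • z))) := by
  have hS := (one_add_nsq_pos z).ne'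
  have hd : DifferentiableAt ℝ (fderiv ℝ f) z :=
    (hf.fderiv_right (m := 1) le_rfl).differentiableAt one_ne_zero
  have h1 : ∀ a b, fderiv ℝ (fun y => (metricMatrix y)⁻¹ a b * volDensity y *
      fderiv ℝ f y (coordDir a)) z (coordDir b) =
      fderiv ℝ f z (coordDir a) * fderiv ℝ (laplaceSymbol a b) z (coordDir b) +
      laplaceSymbol a b z * fderiv ℝ (fderiv ℝ f) z (coordDir b) (coordDir a) := by
    intro a b
    have e1 : DifferentiableAt ℝ (laplaceSymbol a b) z :=
      (contDiff_laplaceSymbol (r := 1) a b).differentiable one_ne_zero z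
    have e2 : DifferentiableAt ℝ (fun y => fderiv ℝ f y (coordDir a)) z :=
      hd.clm_apply (differentiableAt_const _)
    simp only [inv_metricMatrix_mul_volDensity]
    rw [fderiv_fun_mul e1 e2, ← fderiv_fderiv_apply hf]
    simp only [add_apply, smul_apply, smul_eq_mul]
    ring
  rw [coordLaplacian]
  simp only [h1, Finset.sum_add_distrib, ← Finset.mul_sum, sum_fderiv_laplaceSymbol, mul_zero,
    zero_add]
  have h2 : ∑ a, ∑ b, laplaceSymbol a b z *
      fderiv ℝ (fderiv ℝ f) z (coordDir b) (coordDir a) = (1 + nsq z)⁻¹ ^ n *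
      (∑ a, fderiv ℝ (fderiv ℝ f) z (coordDir a) (coordDir a) + fderiv ℝ (fderiv ℝ f) z z z +
        fderiv ℝ (fderiv ℝ f) z (Complex.I • z) (Complex.I • z)) := by
    rw [← sum_sum_realCoord_mul _ z z, ← sum_sum_realCoord_mul _ (Complex.I • z) (Complex.I • z)]
    simp only [laplaceSymbol, mul_assoc, ← Finset.mul_sum]
    congr 1
    simp only [add_mul, Finset.sum_add_distrib, mul_assoc, Finset.mul_sum]
    simp only [Matrix.one_apply, ite_mul, one_mul, zero_mul, Finset.sum_ite_eq, Finset.mem_univ,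
      if_true]
    ring
  rw [h2, volDensity_eq, pow_succ]
  field_simp

/-! ### The Laplace–Beltrami operator in homogeneous coordinates -/

/-- The Euclidean Laplacian `∑ (∂²/∂xₖ² + ∂²/∂yₖ²)` of `ℂᵐ`. -/
noncomputable def flatLap {m : ℕ} (F : Coord m → ℝ) (ξ : Coord m) : ℝ :=
  ∑ a, fderiv ℝ (fderiv ℝ F) ξ (coordDir a) (coordDir a)

theorem coordDir_inr {m : ℕ} (k : Fin m) :
    (coordDir (Sum.inr k) : Coord m) = Complex.I • Pi.single k (1 : ℂ) := by
  simp [coordDir, ← Pi.single_smul]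

theorem sum_coordDir {m : ℕ} (H : Coord m →L[ℝ] Coord m →L[ℝ] ℝ) :
    ∑ a, H (coordDir a) (coordDir a) = ∑ k : Fin m, (H (Pi.single k 1) (Pi.single k 1) +
      H (Complex.I • Pi.single k 1) (Complex.I • Pi.single k 1)) := by
  simp only [Fintype.sum_sum_type, coordDir_inr, Finset.sum_add_distrib]
  rfl

/-- The trace of a real quadratic form on a complex line. -/
theorem bilin_smul_add_smul {m : ℕ} (H : Coord m →L[ℝ] Coord m →L[ℝ] ℝ) (c : ℂ) (v : Coord m) :
    H (c • v) (c • v) + H (c • Complex.I • v) (c • Complex.I • v) =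
      Complex.normSq c * (H v v + H (Complex.I • v) (Complex.I • v)) := by
  have h1 : ∀ u : Coord m, c • u = c.re • u + c.im • (Complex.I • u) := by
    intro u
    conv_lhs => rw [← Complex.re_add_im c]
    rw [add_smul, mul_smul, Complex.coe_smul, Complex.coe_smul]
  have h2 : Complex.I • Complex.I • v = -v := by
    rw [smul_smul, Complex.I_mul_I, neg_one_smul]
  rw [h1 v, h1 (Complex.I • v), h2]
  simp only [map_add, map_smul, map_neg, add_apply, smul_apply, neg_apply, smul_eq_mul,
    Complex.normSq_apply, smul_neg]
  ring

theorem fderiv_comp_toCP_smul_self {n : ℕ} (φ : CP n → ℝ) {ξ : Coord (n + 1)}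
    (hd : DifferentiableAt ℝ (φ ∘ toCP) ξ) (hξ : ξ ≠ 0) (c : ℂ) :
    fderiv ℝ (φ ∘ toCP) ξ (c • ξ) = 0 := by
  rw [← hd.lineDeriv_eq_fderiv]
  refine HasLineDerivAt.lineDeriv ?_
  refine (hasDerivAt_const (0 : ℝ) ((φ ∘ toCP) ξ)).congr_of_eventuallyEq ?_
  have h1 : ∀ᶠ s : ℝ in 𝓝 0, (1 + s * c : ℂ) ≠ 0 := by
    refine ContinuousAt.eventually_ne (by fun_prop) ?_
    simp
  filter_upwards [h1] with s hs
  have h2 : ξ + s • c • ξ = (1 + s * c : ℂ) • ξ := by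
    rw [add_smul, one_smul, mul_smul, Complex.coe_smul]
  rw [h2, Function.comp_apply, toCP_smul _ hs _ hξ, Function.comp_apply]

theorem eventually_ne_zero {m : ℕ} {ξ : Coord m} (hξ : ξ ≠ 0) : ∀ᶠ y in 𝓝 ξ, y ≠ 0 :=
  isOpen_ne.mem_nhds hξ

theorem fderiv_fderiv_comp_toCP_smul_self {n : ℕ} {φ : CP n → ℝ}
    (h : ContMDiff 𝓘(ℝ, Coord n) 𝓘(ℝ, ℝ) 2 φ) {ξ : Coord (n + 1)} (hξ : ξ ≠ 0) (c : ℂ)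
    (v : Coord (n + 1)) :
    fderiv ℝ (fderiv ℝ (φ ∘ toCP)) ξ v (c • ξ) = -fderiv ℝ (φ ∘ toCP) ξ (c • v) := by
  have hC : ∀ y : Coord (n + 1), y ≠ 0 → ContDiffAt ℝ 2 (φ ∘ toCP) y := fun y hy =>
    contDiffAt_comp_toCP (r := 2) h hy
  have h1 : DifferentiableAt ℝ (fderiv ℝ (φ ∘ toCP)) ξ :=
    ((hC ξ hξ).fderiv_right (m := 1) le_rfl).differentiableAt one_ne_zero
  let C : Coord (n + 1) →L[ℝ] Coord (n + 1) :=
    (c • ContinuousLinearMap.id ℂ (Coord (n + 1))).restrictScalars ℝ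
  have h2 : HasFDerivAt (fun y => fderiv ℝ (φ ∘ toCP) y (C y)) (0 : Coord (n + 1) →L[ℝ] ℝ) ξ := by
    refine (hasFDerivAt_const (0 : ℝ) ξ).congr_of_eventuallyEq ?_
    filter_upwards [eventually_ne_zero hξ] with y hy
    exact fderiv_comp_toCP_smul_self φ ((hC y hy).differentiableAt two_ne_zero) hy c
  have h3 := h1.hasFDerivAt.clm_apply C.hasFDerivAt
  have h4 := congrArg (fun L : Coord (n + 1) →L[ℝ] ℝ => L v) (h3.unique h2)
  have h5 : fderiv ℝ (φ ∘ toCP) ξ (C v) + fderiv ℝ (fderiv ℝ (φ ∘ toCP)) ξ v (C ξ) = 0 := by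
    simpa using h4
  exact (eq_neg_of_add_eq_zero_right h5)

theorem fderiv_fderiv_comp_affine {m l : ℕ} {F : Coord m → ℝ} {L : Coord l → Coord m}
    {A : Coord l →L[ℝ] Coord m} (hL : ∀ y, HasFDerivAt L A y)
    (hF : ∀ y, ContDiffAt ℝ 2 F (L y)) (z v w : Coord l) :
    fderiv ℝ (fderiv ℝ (F ∘ L)) z v w = fderiv ℝ (fderiv ℝ F) (L z) (A v) (A w) := by
  have hLC : ContDiff ℝ 2 L := by
    have : L = fun y => L 0 + A y := by
      refine funext fun y => ?_
      have h0 : ∀ y, HasFDerivAt (fun y => L y - A y) (0 : Coord l →L[ℝ] Coord m) y := fun y => by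
        simpa using (hL y).fun_sub A.hasFDerivAt
      have := is_const_of_fderiv_eq_zero (fun y => (h0 y).differentiableAt)
        (fun y => (h0 y).fderiv) y 0
      simp only [map_zero, sub_zero] at this
      rw [← this, sub_add_cancel]
    rw [this]
    exact contDiff_const.add A.contDiff
  rw [← fderiv_fderiv_apply ((hF z).comp z hLC.contDiffAt), ← fderiv_fderiv_apply (hF z)]
  have h1 : (fun y => fderiv ℝ (F ∘ L) y w) = (fun η => fderiv ℝ F η (A w)) ∘ L := by
    funext y
    rw [(((hF y).differentiableAt two_ne_zero).hasFDerivAt.comp y (hL y)).fderiv]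
    rfl
  have h2 : DifferentiableAt ℝ (fun η => fderiv ℝ F η (A w)) (L z) :=
    (((hF z).fderiv_right (m := 1) le_rfl).differentiableAt one_ne_zero).clm_apply
      (differentiableAt_const _)
  rw [h1, (h2.hasFDerivAt.comp z (hL z)).fderiv]
  rfl

/-- The linear map `v ↦ (v, 0)` that inserts a `0` in place `i`. -/
noncomputable def insertZero {n : ℕ} (i : Fin (n + 1)) : Coord n →L[ℝ] Coord (n + 1) :=
  LinearMap.toContinuousLinearMap
    { toFun := fun v => (i.insertNth (0 : ℂ) v : Fin (n + 1) → ℂ)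
      map_add' := fun v w => by
        funext k
        refine Fin.succAboveCases i ?_ (fun k => ?_) k <;> simp
      map_smul' := fun c v => by
        funext k
        refine Fin.succAboveCases i ?_ (fun k => ?_) k <;> simp }

theorem insertZero_apply_self {n : ℕ} (i : Fin (n + 1)) (v : Coord n) : insertZero i v i = 0 := by
  simp [insertZero]

theorem insertZero_apply_succAbove {n : ℕ} (i : Fin (n + 1)) (v : Coord n) (k : Fin n) :
    insertZero i v (i.succAbove k) = v k := by
  simp [insertZero]

theorem insertZero_smul {n : ℕ} (i : Fin (n + 1)) (c : ℂ) (v : Coord n) :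
    insertZero i (c • v) = c • insertZero i v := by
  funext k
  refine Fin.succAboveCases i ?_ (fun k => ?_) k <;>
    simp [insertZero_apply_self, insertZero_apply_succAbove]

theorem insertZero_single {n : ℕ} (i : Fin (n + 1)) (k : Fin n) (c : ℂ) :
    insertZero i (Pi.single k c) = Pi.single (i.succAbove k) c := by
  funext l
  refine Fin.succAboveCases i ?_ (fun l => ?_) l
  · rw [insertZero_apply_self, Pi.single_eq_of_ne (Fin.succAbove_ne i k).symm]
  · simp [insertZero_apply_succAbove, Pi.single_apply]

theorem affineVec_eq_add {n : ℕ} (i : Fin (n + 1)) (z : Coord n) :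
    (affineVec i z).ofLp = Pi.single i 1 + insertZero i z := by
  funext k
  refine Fin.succAboveCases i ?_ (fun k => ?_) k
  · simp [affineVec_ofLp_self, insertZero_apply_self]
  · simp [affineVec_ofLp_succAbove, insertZero_apply_succAbove]

theorem coordLaplacian_comp_affinePoint {n : ℕ} {φ : CP n → ℝ}
    (h : ContMDiff 𝓘(ℝ, Coord n) 𝓘(ℝ, ℝ) 2 φ) (i : Fin (n + 1)) (z : Coord n) {c : ℂ}
    (hc : c ≠ 0) :
    coordLaplacian (φ ∘ affinePoint i) z =
      -(nsq (c • (affineVec i z).ofLp) * flatLap (φ ∘ toCP) (c • (affineVec i z).ofLp)) := by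
  set L : Coord n → Coord (n + 1) := fun y => c • (affineVec i y).ofLp with hLdef
  let A : Coord n →L[ℝ] Coord (n + 1) :=
    ((c • ContinuousLinearMap.id ℂ (Coord (n + 1))).restrictScalars ℝ).comp (insertZero i)
  have hA : ∀ v, A v = c • insertZero i v := fun v => rfl
  have hL0 : ∀ y, L y ≠ 0 := fun y => smul_ne_zero hc (affineVec_ofLp_ne_zero i y)
  have hL : ∀ y, HasFDerivAt L A y := by
    intro y
    have : L = fun y => c • (Pi.single i 1 : Coord (n + 1)) + A y := by
      funext y
      rw [hLdef, hA]
      dsimp only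
      rw [affineVec_eq_add, smul_add]
    rw [this]
    exact A.hasFDerivAt.const_add _
  have hF : ∀ y, ContDiffAt ℝ 2 (φ ∘ toCP) (L y) := fun y =>
    contDiffAt_comp_toCP (r := 2) h (hL0 y)
  have hcomp : φ ∘ affinePoint i = (φ ∘ toCP) ∘ L := by
    funext y
    simp only [Function.comp_apply, hLdef]
    rw [toCP_smul c hc _ (affineVec_ofLp_ne_zero i y), affinePoint_eq_toCP]
  have hAz : A z = L z - c • Pi.single i 1 := by
    rw [hA, hLdef]
    dsimp only
    rw [affineVec_eq_add, smul_add, add_sub_cancel_left]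
  have hsmul : ∀ (d : ℂ) v, A (d • v) = d • A v := by
    intro d v
    rw [hA, hA, insertZero_smul, smul_comm]
  rw [coordLaplacian_eq (contDiff_comp_affinePoint (r := 2) h i).contDiffAt, hcomp]
  change _ = -(nsq (L z) * _)
  simp only [fderiv_fderiv_comp_affine hL hF]
  -- The chart misses one complex direction of `ℂⁿ⁺¹`. Its contribution to the Laplacian is
  -- recovered from the derivatives along `z` and `i z`, as the lift is invariant under scaling.
  have hsym := (hF z).isSymmSndFDerivAt (by simp)
  have hH : ∀ (d : ℂ) v, fderiv ℝ (fderiv ℝ (φ ∘ toCP)) (L z) v (d • L z) =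
      -fderiv ℝ (φ ∘ toCP) (L z) (d • v) :=
    fun d v => fderiv_fderiv_comp_toCP_smul_self h (hL0 z) d v
  have hD : ∀ d : ℂ, fderiv ℝ (φ ∘ toCP) (L z) (d • L z) = 0 := fun d =>
    fderiv_comp_toCP_smul_self φ ((hF z).differentiableAt two_ne_zero) (hL0 z) d
  have hlap : flatLap (φ ∘ toCP) (L z) = ∑ k : Fin (n + 1),
      (fderiv ℝ (fderiv ℝ (φ ∘ toCP)) (L z) (Pi.single k 1) (Pi.single k 1) +
      fderiv ℝ (fderiv ℝ (φ ∘ toCP)) (L z) (Complex.I • Pi.single k 1)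
        (Complex.I • Pi.single k 1)) := sum_coordDir _
  set H := fderiv ℝ (fderiv ℝ (φ ∘ toCP)) (L z)
  set D := fderiv ℝ (φ ∘ toCP) (L z)
  have e1 : ∑ a, H (A (coordDir a)) (A (coordDir a)) = Complex.normSq c * ∑ k : Fin n,
      (H (Pi.single (i.succAbove k) 1) (Pi.single (i.succAbove k) 1) +
        H (Complex.I • Pi.single (i.succAbove k) 1) (Complex.I • Pi.single (i.succAbove k) 1)) := by
    simp only [Fintype.sum_sum_type, coordDir_inr, Finset.mul_sum, ← Finset.sum_add_distrib]
    refine Finset.sum_congr rfl fun k _ => ?_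
    rw [← bilin_smul_add_smul, hsmul, smul_comm c Complex.I]
    have : A (Pi.single k 1) = c • Pi.single (i.succAbove k) 1 := by rw [hA, insertZero_single]
    rw [← this]
    rfl
  have e2 : H (A z) (A z) + H (A (Complex.I • z)) (A (Complex.I • z)) =
      Complex.normSq c * (H (Pi.single i 1) (Pi.single i 1) +
        H (Complex.I • Pi.single i 1) (Complex.I • Pi.single i 1)) := by
    rw [← bilin_smul_add_smul, smul_comm c Complex.I, hsmul, hAz]
    generalize c • (Pi.single i 1 : Coord (n + 1)) = x
    have a1 := hH 1 x
    have a2 := hH 1 (L z)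
    have a3 := hH Complex.I (Complex.I • x)
    have a4 := hH Complex.I (Complex.I • L z)
    have a5 := hD 1
    have hII : ∀ u : Coord (n + 1), Complex.I • Complex.I • u = -u := fun u => by
      rw [smul_smul, Complex.I_mul_I, neg_one_smul]
    have s1 : H (L z) x = H x (L z) := hsym.eq _ _
    have s2 : H (Complex.I • L z) (Complex.I • x) = H (Complex.I • x) (Complex.I • L z) :=
      hsym.eq _ _
    simp only [one_smul, hII, map_neg] at a1 a2 a3 a4 a5
    simp only [smul_sub, map_sub, sub_apply, s1, s2, a1, a2, a3, a4, a5]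
    ring
  have e3 : nsq (L z) = Complex.normSq c * (1 + nsq z) := by
    rw [hLdef]
    dsimp only
    rw [nsq_smul, nsq_affineVec]
  rw [hlap, Fin.sum_univ_succAbove _ i, e3, add_assoc, e2, e1]
  ring

/-- The Laplace–Beltrami operator of `ℂℙⁿ` in homogeneous coordinates: `-|ξ|²` times the Euclidean
Laplacian of the lifted function. -/
theorem laplaceBeltrami_toCP {n : ℕ} {φ : CP n → ℝ}
    (h : ContMDiff 𝓘(ℝ, Coord n) 𝓘(ℝ, ℝ) 2 φ) {ξ : Coord (n + 1)} (hξ : ξ ≠ 0) :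
    laplaceBeltrami φ (toCP ξ) = -(nsq ξ * flatLap (φ ∘ toCP) ξ) := by
  rw [laplaceBeltrami]
  have hi : ξ (chartIndex (toCP ξ)) ≠ 0 :=
    (toCP_mem_affineDomain _ hξ).1 (mem_affineDomain_chartIndex (toCP ξ))
  set i := chartIndex (toCP ξ)
  have e : ξ = ξ i • (affineVec i (affineCoord i (toCP ξ))).ofLp := by
    rw [affineCoord_toCP i hξ]
    funext k
    refine Fin.succAboveCases i ?_ (fun k => ?_) k
    · simp [affineVec_ofLp_self]
    · simp only [Pi.smul_apply, affineVec_ofLp_succAbove, smul_eq_mul]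
      field_simp
  have := coordLaplacian_comp_affinePoint h i (affineCoord i (toCP ξ)) hi
  rwa [← e] at this

theorem continuousOn_flatLap {n : ℕ} {φ : CP n → ℝ}
    (h : ContMDiff 𝓘(ℝ, Coord n) 𝓘(ℝ, ℝ) 2 φ) : ContinuousOn (flatLap (φ ∘ toCP)) {0}ᶜ := by
  intro ξ hξ
  have h1 := (contDiffAt_comp_toCP (r := 2) h hξ).fderiv_right (m := 1) le_rfl
  have h2 := (h1.fderiv_right (m := 0) le_rfl).continuousAt
  refine ContinuousAt.continuousWithinAt ?_
  unfold flatLap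
  refine tendsto_finsetSum _ fun a _ => ?_
  exact (h2.clm_apply continuousAt_const).clm_apply continuousAt_const

/-- The Laplace–Beltrami operator maps functions of class `C²` to continuous functions. -/
theorem continuous_laplaceBeltrami {n : ℕ} {φ : CP n → ℝ}
    (h : ContMDiff 𝓘(ℝ, Coord n) 𝓘(ℝ, ℝ) 2 φ) : Continuous (laplaceBeltrami φ) := by
  rw [(isQuotientMap_mk' n).continuous_iff]
  have e : laplaceBeltrami φ ∘ (Projectivization.mk' ℂ :
      {v : EuclideanSpace ℂ (Fin (n + 1)) // v ≠ 0} → CP n) =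
      fun v => -(nsq v.1.ofLp * flatLap (φ ∘ toCP) v.1.ofLp) := by
    funext v
    have hv : v.1.ofLp ≠ 0 := by simpa using v.2
    rw [← laplaceBeltrami_toCP h hv, toCP_of_ne_zero hv]
    rfl
  rw [e]
  have h1 : Continuous fun v : {v : EuclideanSpace ℂ (Fin (n + 1)) // v ≠ 0} => v.1.ofLp := by
    fun_prop
  refine ((continuous_nsq.comp h1).mul ?_).neg
  refine (continuousOn_flatLap h).comp_continuous h1 fun v => ?_
  simpa using v.2

theorem exists_abs_laplaceBeltrami_le {n : ℕ} {φ : CP n → ℝ}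
    (h : ContMDiff 𝓘(ℝ, Coord n) 𝓘(ℝ, ℝ) 2 φ) : ∃ C, ∀ p, |laplaceBeltrami φ p| ≤ C := by
  obtain ⟨C, hC⟩ := isCompact_univ.exists_bound_of_continuousOn
    (continuous_laplaceBeltrami h).continuousOn
  exact ⟨C, fun p => hC p (Set.mem_univ p)⟩

/-! ### The Laplace–Beltrami operator on powers of the squared cosine -/

theorem flatLap_pow {m : ℕ} {F : Coord m → ℝ} {ξ : Coord m} (hF : ContDiffAt ℝ 2 F ξ) (k : ℕ) :
    flatLap (fun y => F y ^ k) ξ = k * F ξ ^ (k - 1) * flatLap F ξ +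
      k * (k - 1 : ℕ) * F ξ ^ (k - 1 - 1) * ∑ a, (fderiv ℝ F ξ (coordDir a)) ^ 2 := by
  have h1 : ∀ᶠ y in 𝓝 ξ, DifferentiableAt ℝ F y := by
    filter_upwards [hF.eventually (by simp)] with y hy
    exact hy.differentiableAt two_ne_zero
  have hd : DifferentiableAt ℝ (fderiv ℝ F) ξ :=
    (hF.fderiv_right (m := 1) le_rfl).differentiableAt one_ne_zero
  have h0 : DifferentiableAt ℝ F ξ := hF.differentiableAt two_ne_zero
  have key : ∀ e : Coord m, fderiv ℝ (fderiv ℝ (fun y => F y ^ k)) ξ e e =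
      k * F ξ ^ (k - 1) * fderiv ℝ (fderiv ℝ F) ξ e e +
      k * (k - 1 : ℕ) * F ξ ^ (k - 1 - 1) * (fderiv ℝ F ξ e) ^ 2 := by
    intro e
    rw [← fderiv_fderiv_apply (hF.pow k), ← fderiv_fderiv_apply hF]
    have h2 : (fun y => fderiv ℝ (fun y => F y ^ k) y e) =ᶠ[𝓝 ξ]
        fun y => (k * F y ^ (k - 1)) * fderiv ℝ F y e := by
      filter_upwards [h1] with y hy
      rw [fderiv_fun_pow k hy]
      simp
    have h3 : HasFDerivAt (fun y => (k : ℝ) * F y ^ (k - 1)) _ ξ :=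
      (HasFDerivAt.pow h0.hasFDerivAt (k - 1)).const_mul (k : ℝ)
    have h4 : DifferentiableAt ℝ (fun y => fderiv ℝ F y e) ξ :=
      hd.clm_apply (differentiableAt_const _)
    rw [h2.fderiv_eq, (h3.fun_mul h4.hasFDerivAt).fderiv]
    simp only [add_apply, smul_apply, smul_eq_mul, nsmul_eq_mul]
    ring
  simp only [flatLap, key, Finset.sum_add_distrib, ← Finset.mul_sum]

theorem re_star_dotProduct_coordDir {m : ℕ} (c : ℂ) (w : Coord m) (a : Fin m ⊕ Fin m) :
    (starRingEnd ℂ c * (star w ⬝ᵥ coordDir a)).re = realCoord (c • w) a := by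
  rw [← star_dotProduct_coordDir_re, star_smul, smul_dotProduct]
  rfl

theorem sum_realCoord_mul_realCoord {m : ℕ} (z w : Coord m) :
    ∑ a, realCoord z a * realCoord w a = (star z ⬝ᵥ w).re := by
  simp [realCoord, dotProduct, Finset.sum_add_distrib]

theorem fderiv_overlap_coordDir {m : ℕ} {w ξ : Coord m} (hw : w ≠ 0) (hξ : ξ ≠ 0)
    (a : Fin m ⊕ Fin m) :
    fderiv ℝ (overlap w) ξ (coordDir a) =
      2 * realCoord ((star w ⬝ᵥ ξ) • w) a / (nsq w * nsq ξ) -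
        Complex.normSq (star w ⬝ᵥ ξ) * (2 * realCoord ξ a) / (nsq w * nsq ξ ^ 2) := by
  rw [fderiv_overlap hw hξ, re_star_dotProduct_coordDir, star_dotProduct_coordDir_re]

theorem star_smul_dotProduct_self {m : ℕ} (w ξ : Coord m) :
    (star ((star w ⬝ᵥ ξ) • w) ⬝ᵥ ξ).re = Complex.normSq (star w ⬝ᵥ ξ) := by
  rw [star_smul, smul_dotProduct, smul_eq_mul]
  change (starRingEnd ℂ _ * _).re = _
  rw [← Complex.normSq_eq_conj_mul_self, Complex.ofReal_re]

theorem sum_sq_fderiv_overlap {m : ℕ} {w ξ : Coord m} (hw : w ≠ 0) (hξ : ξ ≠ 0) :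
    nsq ξ * ∑ a, (fderiv ℝ (overlap w) ξ (coordDir a)) ^ 2 =
      4 * (overlap w ξ - overlap w ξ ^ 2) := by
  have hM := (nsq_pos hw).ne'
  have hN := (nsq_pos hξ).ne'
  have h1 := sum_realCoord_sq ξ
  have h2 := sum_realCoord_sq ((star w ⬝ᵥ ξ) • w)
  have h3 := sum_realCoord_mul_realCoord ((star w ⬝ᵥ ξ) • w) ξ
  rw [star_smul_dotProduct_self] at h3
  rw [nsq_smul] at h2
  have e : ∀ a, (fderiv ℝ (overlap w) ξ (coordDir a)) ^ 2 =
      4 / (nsq w * nsq ξ) ^ 2 *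
        (realCoord ((star w ⬝ᵥ ξ) • w) a * realCoord ((star w ⬝ᵥ ξ) • w) a) -
      8 * Complex.normSq (star w ⬝ᵥ ξ) / (nsq w ^ 2 * nsq ξ ^ 3) *
        (realCoord ((star w ⬝ᵥ ξ) • w) a * realCoord ξ a) +
      4 * Complex.normSq (star w ⬝ᵥ ξ) ^ 2 / (nsq w ^ 2 * nsq ξ ^ 4) *
        (realCoord ξ a * realCoord ξ a) := by
    intro a
    rw [fderiv_overlap_coordDir hw hξ]
    field_simp
    ring
  simp only [e, Finset.sum_add_distrib, Finset.sum_sub_distrib, ← Finset.mul_sum, h1, h2, h3]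
  rw [overlap]
  field_simp
  ring

theorem fderiv_fderiv_overlap_coordDir {m : ℕ} {w ξ : Coord m} (hw : w ≠ 0) (hξ : ξ ≠ 0)
    (a : Fin m ⊕ Fin m) :
    fderiv ℝ (fderiv ℝ (overlap w)) ξ (coordDir a) (coordDir a) =
      2 * (realCoord w a * realCoord w a +
        realCoord (Complex.I • w) a * realCoord (Complex.I • w) a) / (nsq w * nsq ξ) -
      8 / (nsq w * nsq ξ ^ 2) * (realCoord ((star w ⬝ᵥ ξ) • w) a * realCoord ξ a) -
      2 * Complex.normSq (star w ⬝ᵥ ξ) / (nsq w * nsq ξ ^ 2) +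
      8 * Complex.normSq (star w ⬝ᵥ ξ) / (nsq w * nsq ξ ^ 3) * (realCoord ξ a * realCoord ξ a) := by
  have hM := (nsq_pos hw).ne'
  have hN := (nsq_pos hξ).ne'
  have hC : ContDiffAt ℝ 2 (overlap w) ξ := contDiffAt_overlap (r := 2) hw hξ
  rw [← fderiv_fderiv_apply hC]
  have hd : DifferentiableAt ℝ (fun y => fderiv ℝ (overlap w) y (coordDir a)) ξ :=
    ((hC.fderiv_right (m := 1) le_rfl).differentiableAt one_ne_zero).clm_apply
      (differentiableAt_const _)
  have h1 : HasDerivAt (fun s : ℝ => nsq (ξ + s • coordDir a)) (2 * realCoord ξ a) 0 := by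
    rw [← star_dotProduct_coordDir_re]
    exact hasLineDerivAt_nsq ξ (coordDir a)
  have h2 : HasDerivAt (fun s : ℝ => realCoord (ξ + s • coordDir a) a) 1 0 := by
    have := hasLineDerivAt_realCoord a ξ (coordDir a)
    rwa [realCoord_coordDir, Matrix.one_apply_eq] at this
  have h3 : HasDerivAt (fun s : ℝ => Complex.normSq (star w ⬝ᵥ (ξ + s • coordDir a)))
      (2 * realCoord ((star w ⬝ᵥ ξ) • w) a) 0 := by
    rw [← re_star_dotProduct_coordDir]
    exact hasLineDerivAt_normSq_dotProduct w ξ (coordDir a)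
  have h4 : HasDerivAt (fun s : ℝ => realCoord ((star w ⬝ᵥ (ξ + s • coordDir a)) • w) a)
      (realCoord w a * realCoord w a +
        realCoord (Complex.I • w) a * realCoord (Complex.I • w) a) 0 := by
    have := ((hasDerivAt_id (0 : ℝ)).mul_const (realCoord w a * realCoord w a +
        realCoord (Complex.I • w) a * realCoord (Complex.I • w) a)).const_add
        (realCoord ((star w ⬝ᵥ ξ) • w) a)
    refine (this.congr_deriv (by simp)).congr_of_eventuallyEq (.of_forall fun s => ?_)
    dsimp only
    rw [dotProduct_add, dotProduct_smul, add_smul, smul_assoc, realCoord_add_smul,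
      star_dotProduct_coordDir, id]
    rcases a with k | k <;> simp [realCoord]
  have hN0 : nsq (ξ + (0 : ℝ) • coordDir a) ≠ 0 := by simpa using hN
  have h5 := ((h4.const_mul 2).fun_div (h1.const_mul (nsq w)) (mul_ne_zero hM hN0)).fun_sub
    ((h3.fun_mul (h2.const_mul 2)).fun_div ((h1.fun_pow 2).const_mul (nsq w))
      (mul_ne_zero hM (pow_ne_zero 2 hN0)))
  rw [← hd.lineDeriv_eq_fderiv]
  refine HasLineDerivAt.lineDeriv ?_
  refine (h5.congr_deriv ?_).congr_of_eventuallyEq ?_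
  · simp only [zero_smul, add_zero]
    field_simp
    ring
  · have h6 : ∀ᶠ s : ℝ in 𝓝 0, ξ + s • coordDir a ≠ 0 := by
      refine ContinuousAt.eventually_ne (by fun_prop) ?_
      simpa using hξ
    filter_upwards [h6] with s hs
    exact fderiv_overlap_coordDir hw hs a

theorem flatLap_overlap {m : ℕ} {w ξ : Coord m} (hw : w ≠ 0) (hξ : ξ ≠ 0) :
    nsq ξ * flatLap (overlap w) ξ = 4 - 4 * m * overlap w ξ := by
  have hM := (nsq_pos hw).ne'
  have hN := (nsq_pos hξ).ne'
  have h1 := sum_realCoord_sq ξ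
  have h2 := sum_realCoord_sq w
  have h2' := sum_realCoord_sq (Complex.I • w)
  rw [nsq_I_smul] at h2'
  have h3 := sum_realCoord_mul_realCoord ((star w ⬝ᵥ ξ) • w) ξ
  rw [star_smul_dotProduct_self] at h3
  simp only [flatLap, fderiv_fderiv_overlap_coordDir hw hξ, Finset.sum_add_distrib,
    Finset.sum_sub_distrib, ← Finset.mul_sum, ← Finset.sum_div, h1, h2, h2', h3, Finset.sum_const,
    Finset.card_univ, Fintype.card_sum, Fintype.card_fin, nsmul_eq_mul]
  rw [overlap]
  push_cast
  field_simp
  ring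

theorem contMDiff_cosSq_pow {n : ℕ} {r : ℕ∞} (p : CP n) (k : ℕ) :
    ContMDiff 𝓘(ℝ, Coord n) 𝓘(ℝ, ℝ) r (fun q => cosSq p q ^ k) := by
  refine contMDiff_of_comp_affinePoint fun i => ?_
  exact (contDiff_comp_affinePoint (contMDiff_cosSq (r := r) p) i).pow k

/-- The Laplace–Beltrami operator on powers of `t = cos² r`: the functions `tᵏ` span a space on
which it is triangular. -/
theorem laplaceBeltrami_cosSq_pow {n : ℕ} (p q : CP n) (k : ℕ) :
    laplaceBeltrami (fun q => cosSq p q ^ (k + 1)) q =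
      4 * (k + 1) * (k + 1 + n) * cosSq p q ^ (k + 1) - 4 * (k + 1) ^ 2 * cosSq p q ^ k := by
  have hq := rep_ofLp_ne_zero q
  have hp := rep_ofLp_ne_zero p
  conv_lhs => rw [← toCP_rep q]
  rw [laplaceBeltrami_toCP (contMDiff_cosSq_pow (r := 2) p (k + 1)) hq]
  have e : (fun q => cosSq p q ^ (k + 1)) ∘ toCP =ᶠ[𝓝 q.rep.ofLp]
      fun ξ => overlap p.rep.ofLp ξ ^ (k + 1) := by
    filter_upwards [eventually_ne_zero hq] with ξ hξ
    simp [cosSq_right_toCP p hξ]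
  have e2 : flatLap ((fun q => cosSq p q ^ (k + 1)) ∘ toCP) q.rep.ofLp =
      flatLap (fun ξ => overlap p.rep.ofLp ξ ^ (k + 1)) q.rep.ofLp := by
    rw [flatLap, flatLap, e.fderiv.fderiv_eq]
  have h1 := flatLap_overlap hp hq
  have h2 := sum_sq_fderiv_overlap hp hq
  rw [e2, flatLap_pow (contDiffAt_overlap (r := 2) hp hq)]
  change _ = 4 * ((k : ℝ) + 1) * (k + 1 + n) * overlap p.rep.ofLp q.rep.ofLp ^ (k + 1) -
    4 * (k + 1) ^ 2 * overlap p.rep.ofLp q.rep.ofLp ^ k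
  set u := overlap p.rep.ofLp q.rep.ofLp
  rw [mul_add, mul_left_comm, h1, mul_left_comm, h2]
  rcases k with _ | k
  · simp only [Nat.cast_zero, Nat.zero_add, Nat.sub_self, pow_zero, pow_one, Nat.zero_sub]
    push_cast
    ring
  · simp only [Nat.add_sub_cancel]
    push_cast
    ring

/-! ### Integration by parts in homogeneous coordinates -/

/-- A smooth function on `ℝ` that is positive on `(1, 3)` and vanishes elsewhere. -/
noncomputable def shellBump (t : ℝ) : ℝ :=
  Real.smoothTransition (t - 1) * Real.smoothTransition (3 - t)

theorem contDiff_shellBump {r : ℕ∞} : ContDiff ℝ r shellBump := by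
  unfold shellBump
  exact (Real.smoothTransition.contDiff.comp (contDiff_id.sub contDiff_const)).mul
    (Real.smoothTransition.contDiff.comp (contDiff_const.sub contDiff_id))

theorem shellBump_nonneg (t : ℝ) : 0 ≤ shellBump t :=
  mul_nonneg (Real.smoothTransition.nonneg _) (Real.smoothTransition.nonneg _)

theorem shellBump_pos {t : ℝ} (h1 : 1 < t) (h3 : t < 3) : 0 < shellBump t :=
  mul_pos (Real.smoothTransition.pos_of_pos (by linarith))
    (Real.smoothTransition.pos_of_pos (by linarith))

/-- The closed shell `1 ≤ |ξ|² ≤ 3` around the origin, outside of which `shellBump (|ξ|²)` vanishes.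
Integrals over `ℂℙⁿ` are computed as integrals over `ℂⁿ⁺¹` with a weight supported here, away from
the origin, where lifted functions are singular. -/
def shell (m : ℕ) : Set (Coord m) := {ξ | 1 ≤ nsq ξ ∧ nsq ξ ≤ 3}

theorem isClosed_shell {m : ℕ} : IsClosed (shell m) :=
  (isClosed_le continuous_const continuous_nsq).inter (isClosed_le continuous_nsq continuous_const)

theorem isCompact_shell {m : ℕ} : IsCompact (shell m) := by
  refine Metric.isCompact_of_isClosed_isBounded isClosed_shell ?_
  refine (Metric.isBounded_closedBall (x := 0) (r := 2)).subset fun ξ hξ => ?_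
  rw [mem_closedBall_zero_iff, pi_norm_le_iff_of_nonneg zero_le_two]
  intro k
  have h : Complex.normSq (ξ k) ≤ nsq ξ :=
    Finset.single_le_sum (f := fun k => Complex.normSq (ξ k))
      (fun _ _ => Complex.normSq_nonneg _) (Finset.mem_univ k)
  rw [Complex.normSq_eq_norm_sq] at h
  refine le_of_sq_le_sq ?_ zero_le_two
  linarith [hξ.2]

theorem shell_subset {m : ℕ} : shell m ⊆ {0}ᶜ := by
  rintro ξ hξ rfl
  have := hξ.1
  simp at this
  linarith

theorem shellBump_nsq_eq_zero {m : ℕ} {ξ : Coord m} (h : ξ ∉ shell m) : shellBump (nsq ξ) = 0 := by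
  by_cases h1 : 1 ≤ nsq ξ
  · have h2 : 3 ≤ nsq ξ := by
      by_contra h2
      exact h ⟨h1, (not_le.1 h2).le⟩
    rw [shellBump, Real.smoothTransition.zero_of_nonpos (x := 3 - nsq ξ) (by linarith), mul_zero]
  · rw [shellBump, Real.smoothTransition.zero_of_nonpos (x := nsq ξ - 1) (by linarith), zero_mul]

theorem integrable_of_eq_zero_off_shell {m : ℕ} {f : Coord m → ℝ} (hf : ContinuousOn f {0}ᶜ)
    (h0 : ∀ ξ ∉ shell m, f ξ = 0) : Integrable f := by
  rw [← integrableOn_iff_integrable_of_support_subset (s := shell m)]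
  · exact (hf.mono shell_subset).integrableOn_compact isCompact_shell
  · intro ξ hξ
    by_contra h
    exact hξ (h0 ξ h)

theorem zero_notMem_shell {m : ℕ} : (0 : Coord m) ∉ shell m := fun h => shell_subset h rfl

theorem hasFDerivAt_zero_off_shell {m : ℕ} {f : Coord m → ℝ} (h0 : ∀ ξ ∉ shell m, f ξ = 0)
    {ξ : Coord m} (hξ : ξ ∉ shell m) : HasFDerivAt f (0 : Coord m →L[ℝ] ℝ) ξ := by
  refine (hasFDerivAt_const (0 : ℝ) ξ).congr_of_eventuallyEq ?_
  filter_upwards [isClosed_shell.isOpen_compl.mem_nhds hξ] with y hy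
  exact h0 y hy

theorem continuousOn_fderiv_comp_toCP {n : ℕ} {φ : CP n → ℝ}
    (h : ContMDiff 𝓘(ℝ, Coord n) 𝓘(ℝ, ℝ) 2 φ) (v : Coord (n + 1)) :
    ContinuousOn (fun ξ => fderiv ℝ (φ ∘ toCP) ξ v) {0}ᶜ := by
  intro ξ hξ
  have h1 := ((contDiffAt_comp_toCP (r := 2) h hξ).fderiv_right (m := 1) le_rfl).continuousAt
  exact (h1.clm_apply continuousAt_const).continuousWithinAt

theorem continuousOn_comp_toCP {n : ℕ} {φ : CP n → ℝ} (h : Continuous φ) :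
    ContinuousOn (φ ∘ toCP) {0}ᶜ :=
  h.comp_continuousOn continuousOn_toCP

theorem sum_realCoord_mul_fderiv {m : ℕ} (D : Coord m →L[ℝ] ℝ) (v : Coord m) :
    ∑ a, realCoord v a * D (coordDir a) = D v := by
  conv_rhs => rw [← sum_realCoord_smul_coordDir v]
  simp

theorem continuous_shellBump_nsq {m : ℕ} : Continuous fun ξ : Coord m => shellBump (nsq ξ) :=
  (contDiff_shellBump (r := 0)).continuous.comp continuous_nsq

/-- Green's first identity. The weight `shellBump (|ξ|²)` contributes no boundary term, since it is
constant along the spheres around the origin while lifted functions are constant along rays. -/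
theorem integral_shellBump_mul_flatLap {n : ℕ} {φ ψ : CP n → ℝ}
    (hφ : ContMDiff 𝓘(ℝ, Coord n) 𝓘(ℝ, ℝ) 2 φ) (hψ : ContMDiff 𝓘(ℝ, Coord n) 𝓘(ℝ, ℝ) 2 ψ) :
    ∫ ξ : Coord (n + 1), shellBump (nsq ξ) * ψ (toCP ξ) * flatLap (φ ∘ toCP) ξ =
      -∫ ξ : Coord (n + 1), shellBump (nsq ξ) * ∑ a, fderiv ℝ (ψ ∘ toCP) ξ (coordDir a) *
        fderiv ℝ (φ ∘ toCP) ξ (coordDir a) := by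
  set f : Coord (n + 1) → ℝ := fun ξ => shellBump (nsq ξ) * ψ (toCP ξ) with hf
  have hf0 : ∀ ξ ∉ shell (n + 1), f ξ = 0 := fun ξ hξ => by
    rw [hf]
    dsimp only
    rw [shellBump_nsq_eq_zero hξ, zero_mul]
  have hψd : ∀ ξ : Coord (n + 1), ξ ≠ 0 → DifferentiableAt ℝ (ψ ∘ toCP) ξ := fun ξ hξ =>
    (contDiffAt_comp_toCP (r := 2) hψ hξ).differentiableAt two_ne_zero
  have hφd : ∀ ξ : Coord (n + 1), ξ ≠ 0 → DifferentiableAt ℝ (φ ∘ toCP) ξ := fun ξ hξ =>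
    (contDiffAt_comp_toCP (r := 2) hφ hξ).differentiableAt two_ne_zero
  have hW : ∀ ξ : Coord (n + 1),
      DifferentiableAt ℝ (fun ξ : Coord (n + 1) => shellBump (nsq ξ)) ξ :=
    fun ξ => ((contDiff_shellBump (r := 1)).comp contDiff_nsq).differentiable one_ne_zero ξ
  have hfd : ∀ ξ, DifferentiableAt ℝ f ξ := by
    intro ξ
    rcases eq_or_ne ξ 0 with rfl | h
    · exact (hasFDerivAt_zero_off_shell hf0 zero_notMem_shell).differentiableAt
    · exact (hW ξ).mul (hψd ξ h)
  have hWa : ∀ ξ : Coord (n + 1), ∀ a,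
      fderiv ℝ (fun ξ : Coord (n + 1) => shellBump (nsq ξ)) ξ (coordDir a) =
      deriv shellBump (nsq ξ) * 2 * realCoord ξ a := by
    intro ξ a
    rw [← (hW ξ).lineDeriv_eq_fderiv]
    refine HasLineDerivAt.lineDeriv ?_
    have h1 := hasLineDerivAt_nsq ξ (coordDir a)
    rw [star_dotProduct_coordDir_re] at h1
    have h2 : HasDerivAt shellBump (deriv shellBump (nsq (ξ + (0 : ℝ) • coordDir a)))
        (nsq (ξ + (0 : ℝ) • coordDir a)) :=
      ((contDiff_shellBump (r := 1)).differentiable one_ne_zero _).hasDerivAt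
    refine (HasDerivAt.comp (0 : ℝ) h2 h1).congr_deriv ?_
    simp only [zero_smul, add_zero]
    ring
  have hfa : ∀ ξ : Coord (n + 1), ξ ≠ 0 → ∀ a, fderiv ℝ f ξ (coordDir a) =
      deriv shellBump (nsq ξ) * 2 * realCoord ξ a * ψ (toCP ξ) +
        shellBump (nsq ξ) * fderiv ℝ (ψ ∘ toCP) ξ (coordDir a) := by
    intro ξ hξ a
    have h1 : fderiv ℝ f ξ = _ := ((hW ξ).hasFDerivAt.mul (hψd ξ hξ).hasFDerivAt).fderiv
    rw [h1]
    simp only [add_apply, smul_apply, smul_eq_mul, hWa]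
    change _ + ψ (toCP ξ) * _ = _
    ring
  have hfcont : ∀ a, ContinuousOn (fun ξ => fderiv ℝ f ξ (coordDir a)) {0}ᶜ := by
    intro a
    have h1 : ContinuousOn (fun ξ : Coord (n + 1) =>
        fderiv ℝ (fun ξ : Coord (n + 1) => shellBump (nsq ξ)) ξ (coordDir a) * ψ (toCP ξ) +
        shellBump (nsq ξ) * fderiv ℝ (ψ ∘ toCP) ξ (coordDir a)) {0}ᶜ := by
      refine ContinuousOn.add (ContinuousOn.mul ?_ (continuousOn_comp_toCP hψ.continuous))
        (continuous_shellBump_nsq.continuousOn.mul (continuousOn_fderiv_comp_toCP hψ _))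
      have : ContDiff ℝ 1 (fun ξ : Coord (n + 1) => shellBump (nsq ξ)) :=
        (contDiff_shellBump (r := 1)).comp contDiff_nsq
      exact ((this.continuous_fderiv one_ne_zero).clm_apply continuous_const).continuousOn
    refine h1.congr fun ξ hξ => ?_
    dsimp only
    rw [hfa ξ hξ, hWa]
  have hfa0 : ∀ a, ∀ ξ ∉ shell (n + 1), fderiv ℝ f ξ (coordDir a) = 0 := fun a ξ hξ => by
    rw [(hasFDerivAt_zero_off_shell hf0 hξ).fderiv]
    rfl
  have hfcont0 : ContinuousOn f {0}ᶜ :=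
    continuous_shellBump_nsq.continuousOn.mul (continuousOn_comp_toCP hψ.continuous)
  have h2d : ∀ ξ : Coord (n + 1), ξ ≠ 0 → ∀ a,
      DifferentiableAt ℝ (fun ξ => fderiv ℝ (φ ∘ toCP) ξ (coordDir a)) ξ := fun ξ hξ a =>
    (((contDiffAt_comp_toCP (r := 2) hφ hξ).fderiv_right (m := 1) le_rfl).differentiableAt
      one_ne_zero).clm_apply (differentiableAt_const _)
  have hG : ∀ a, ContinuousOn (fun ξ : Coord (n + 1) =>
      fderiv ℝ (fun ξ => fderiv ℝ (φ ∘ toCP) ξ (coordDir a)) ξ (coordDir a)) {0}ᶜ := by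
    intro a
    have : ContinuousOn (fun ξ : Coord (n + 1) =>
        fderiv ℝ (fderiv ℝ (φ ∘ toCP)) ξ (coordDir a) (coordDir a)) {0}ᶜ := fun ξ hξ =>
      (((((contDiffAt_comp_toCP (r := 2) hφ hξ).fderiv_right (m := 1) le_rfl).fderiv_right
        (m := 0) le_rfl).continuousAt.clm_apply continuousAt_const).clm_apply
        continuousAt_const).continuousWithinAt
    exact this.congr fun ξ hξ => fderiv_fderiv_apply (contDiffAt_comp_toCP (r := 2) hφ hξ) _ _
  have hts : tsupport f ⊆ shell (n + 1) := by
    refine closure_minimal (fun ξ hξ => ?_) isClosed_shell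
    by_contra h
    exact hξ (hf0 ξ h)
  have i1 : ∀ a, Integrable fun ξ => fderiv ℝ f ξ (coordDir a) *
      fderiv ℝ (φ ∘ toCP) ξ (coordDir a) := fun a =>
    integrable_of_eq_zero_off_shell ((hfcont a).mul (continuousOn_fderiv_comp_toCP hφ _))
      fun ξ hξ => by rw [hfa0 a ξ hξ, zero_mul]
  have i2 : ∀ a, Integrable fun ξ => f ξ *
      fderiv ℝ (fun ξ => fderiv ℝ (φ ∘ toCP) ξ (coordDir a)) ξ (coordDir a) := fun a =>
    integrable_of_eq_zero_off_shell (hfcont0.mul (hG a)) fun ξ hξ => by rw [hf0 ξ hξ, zero_mul]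
  have i3 : ∀ a, Integrable fun ξ => f ξ * fderiv ℝ (φ ∘ toCP) ξ (coordDir a) := fun a =>
    integrable_of_eq_zero_off_shell (hfcont0.mul (continuousOn_fderiv_comp_toCP hφ _))
      fun ξ hξ => by rw [hf0 ξ hξ, zero_mul]
  have key : ∀ a, ∫ ξ, f ξ *
      fderiv ℝ (fun ξ => fderiv ℝ (φ ∘ toCP) ξ (coordDir a)) ξ (coordDir a) =
      -∫ ξ, fderiv ℝ f ξ (coordDir a) * fderiv ℝ (φ ∘ toCP) ξ (coordDir a) := fun a =>
    integral_mul_fderiv_eq_neg_fderiv_mul_of_integrable (i1 a) (i2 a) (i3 a)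
      (fun ξ _ => hfd ξ) (fun ξ hξ => h2d ξ (shell_subset (hts hξ)) a)
  have e1 : ∫ ξ, f ξ * flatLap (φ ∘ toCP) ξ = ∑ a, ∫ ξ, f ξ *
      fderiv ℝ (fun ξ => fderiv ℝ (φ ∘ toCP) ξ (coordDir a)) ξ (coordDir a) := by
    rw [← integral_finsetSum _ fun a _ => i2 a]
    refine integral_congr_ae (.of_forall fun ξ => ?_)
    dsimp only
    rcases eq_or_ne ξ 0 with rfl | h
    · simp [hf0 0 zero_notMem_shell]
    · rw [flatLap, Finset.mul_sum]
      refine Finset.sum_congr rfl fun a _ => ?_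
      rw [fderiv_fderiv_apply (contDiffAt_comp_toCP (r := 2) hφ h)]
  rw [e1, Finset.sum_congr rfl fun a _ => key a, Finset.sum_neg_distrib,
    ← integral_finsetSum _ fun a _ => i1 a]
  congr 1
  refine integral_congr_ae (.of_forall fun ξ => ?_)
  dsimp only
  rcases eq_or_ne ξ 0 with rfl | h
  · rw [shellBump_nsq_eq_zero zero_notMem_shell]
    simp [hfa0 _ 0 zero_notMem_shell]
  · have h0 : ∑ a, realCoord ξ a * fderiv ℝ (φ ∘ toCP) ξ (coordDir a) = 0 := by
      rw [sum_realCoord_mul_fderiv]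
      simpa using fderiv_comp_toCP_smul_self φ (hφd ξ h) h 1
    calc ∑ a, fderiv ℝ f ξ (coordDir a) * fderiv ℝ (φ ∘ toCP) ξ (coordDir a)
        = ∑ a, (deriv shellBump (nsq ξ) * 2 * ψ (toCP ξ) *
            (realCoord ξ a * fderiv ℝ (φ ∘ toCP) ξ (coordDir a)) + shellBump (nsq ξ) *
            (fderiv ℝ (ψ ∘ toCP) ξ (coordDir a) * fderiv ℝ (φ ∘ toCP) ξ (coordDir a))) := by
          refine Finset.sum_congr rfl fun a _ => ?_
          rw [hfa ξ h]
          ring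
      _ = _ := by
          rw [Finset.sum_add_distrib, ← Finset.mul_sum, ← Finset.mul_sum, h0, mul_zero, zero_add]

/-- The Laplace–Beltrami operator is symmetric, in homogeneous coordinates. -/
theorem integral_shellBump_mul_laplaceBeltrami {n : ℕ} {φ ψ : CP n → ℝ}
    (hφ : ContMDiff 𝓘(ℝ, Coord n) 𝓘(ℝ, ℝ) 2 φ) (hψ : ContMDiff 𝓘(ℝ, Coord n) 𝓘(ℝ, ℝ) 2 ψ) :
    ∫ ξ : Coord (n + 1), shellBump (nsq ξ) / nsq ξ *
        (ψ (toCP ξ) * laplaceBeltrami φ (toCP ξ)) =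
      ∫ ξ : Coord (n + 1), shellBump (nsq ξ) / nsq ξ *
        (φ (toCP ξ) * laplaceBeltrami ψ (toCP ξ)) := by
  have key : ∀ φ ψ : CP n → ℝ, ContMDiff 𝓘(ℝ, Coord n) 𝓘(ℝ, ℝ) 2 φ →
      ContMDiff 𝓘(ℝ, Coord n) 𝓘(ℝ, ℝ) 2 ψ →
      ∫ ξ : Coord (n + 1), shellBump (nsq ξ) / nsq ξ *
        (ψ (toCP ξ) * laplaceBeltrami φ (toCP ξ)) =
      ∫ ξ : Coord (n + 1), shellBump (nsq ξ) * ∑ a, fderiv ℝ (ψ ∘ toCP) ξ (coordDir a) *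
        fderiv ℝ (φ ∘ toCP) ξ (coordDir a) := by
    intro φ ψ hφ hψ
    rw [← neg_neg (∫ ξ : Coord (n + 1), shellBump (nsq ξ) *
      ∑ a, fderiv ℝ (ψ ∘ toCP) ξ (coordDir a) * fderiv ℝ (φ ∘ toCP) ξ (coordDir a)),
      ← integral_shellBump_mul_flatLap hφ hψ, ← integral_neg]
    refine integral_congr_ae (.of_forall fun ξ => ?_)
    dsimp only
    rcases eq_or_ne ξ 0 with rfl | h
    · rw [shellBump_nsq_eq_zero zero_notMem_shell]
      simp
    · rw [laplaceBeltrami_toCP hφ h]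
      have := (nsq_pos h).ne'
      field_simp
  rw [key φ ψ hφ hψ, key ψ φ hψ hφ]
  simp only [mul_comm]

/-! ### The volume measure in homogeneous coordinates -/

theorem chartIndex_eq_zero_iff {n : ℕ} (p : CP n) : chartIndex p = 0 ↔ p ∈ affineDomain 0 := by
  constructor
  · intro h
    rw [← h]
    exact mem_affineDomain_chartIndex p
  · intro h
    have : chartIndex p ≤ 0 :=
      Finset.min'_le _ (0 : Fin (n + 1)) (Finset.mem_filter.2 ⟨Finset.mem_univ _, h⟩)
    exact Fin.le_zero_iff.1 this

theorem volume_setOf_apply_eq_zero {n : ℕ} (j : Fin n) :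
    (volume : Measure (Coord n)) {z | z j = 0} = 0 := by
  let S : Submodule ℝ (Coord n) := (LinearMap.proj j : Coord n →ₗ[ℝ] ℂ).ker
  have hS : (S : Set (Coord n)) = {z | z j = 0} := by
    ext z
    simp [S]
  rw [← hS]
  refine Measure.addHaar_submodule _ S fun h => ?_
  have h1 : (Pi.single j 1 : Coord n) ∈ S := by
    rw [h]
    trivial
  have h2 : (Pi.single j 1 : Coord n) j = 0 := h1
  simp at h2

theorem measurable_volDensity {n : ℕ} : Measurable (volDensity (n := n)) := by
  have : volDensity (n := n) = fun z => (1 + nsq z)⁻¹ ^ (n + 1) := funext volDensity_eq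
  rw [this]
  exact ((measurable_const.add continuous_nsq.measurable).inv).pow_const _

theorem measurable_affinePoint {n : ℕ} (i : Fin (n + 1)) : Measurable (affinePoint (n := n) i) :=
  (continuous_affinePoint i).measurable

/-- The complement of an affine chart is a null set, so that one chart describes the whole
volume measure. -/
theorem volumeFS_eq_map (n : ℕ) :
    volumeFS n = (((volume : Measure (Coord n)).withDensity
      fun z => ENNReal.ofReal (volDensity z)).map (affinePoint 0)) := by
  have h0 : ∀ i : Fin (n + 1), i ≠ 0 → (((volume : Measure (Coord n)).withDensity
      fun z => ENNReal.ofReal (volDensity z)).map (affinePoint i)).restrict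
        {p | chartIndex p = i} = 0 := by
    intro i hi
    rw [Measure.restrict_eq_zero]
    refine measure_mono_null (t := (affineDomain 0)ᶜ) ?_ ?_
    · intro p hp h
      rw [← chartIndex_eq_zero_iff] at h
      exact hi (hp.symm.trans h)
    · rw [Measure.map_apply (measurable_affinePoint i) (isOpen_affineDomain 0).measurableSet.compl]
      refine withDensity_absolutelyContinuous _ _ ?_
      obtain ⟨j, hj⟩ := Fin.exists_succAbove_eq hi.symm
      refine measure_mono_null ?_ (volume_setOf_apply_eq_zero j)
      intro z hz
      have h1 : ¬ affinePoint i z ∈ affineDomain 0 := hz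
      rw [affinePoint_eq_toCP, toCP_mem_affineDomain 0 (affineVec_ofLp_ne_zero i z), not_not,
        ← hj, affineVec_ofLp_succAbove] at h1
      exact h1
  have h1 : (((volume : Measure (Coord n)).withDensity
      fun z => ENNReal.ofReal (volDensity z)).map (affinePoint 0)).restrict
        {p | chartIndex p = 0} = (((volume : Measure (Coord n)).withDensity
      fun z => ENNReal.ofReal (volDensity z)).map (affinePoint 0)) := by
    refine Measure.restrict_eq_self_of_ae_mem ?_
    have : MeasurableSet {p : CP n | chartIndex p = 0} := by
      simp only [chartIndex_eq_zero_iff]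
      exact (isOpen_affineDomain 0).measurableSet
    refine (ae_map_iff (measurable_affinePoint 0).aemeasurable this).2 (.of_forall fun z => ?_)
    rw [chartIndex_eq_zero_iff, affinePoint_eq_toCP,
      toCP_mem_affineDomain 0 (affineVec_ofLp_ne_zero 0 z), affineVec_ofLp_self]
    exact one_ne_zero
  refine Measure.ext fun s hs => ?_
  rw [volumeFS, Measure.sum_apply _ hs, tsum_fintype, Fintype.sum_eq_single 0, h1]
  intro i hi
  rw [h0 i hi]
  rfl

theorem lintegral_volumeFS {n : ℕ} {F : CP n → ℝ≥0∞} (hF : Measurable F) :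
    ∫⁻ p, F p ∂(volumeFS n) =
      ∫⁻ z : Coord n, ENNReal.ofReal ((1 + nsq z)⁻¹ ^ (n + 1)) * F (affinePoint 0 z) := by
  rw [volumeFS_eq_map, lintegral_map hF (measurable_affinePoint 0)]
  refine (lintegral_withDensity_eq_lintegral_mul _ measurable_volDensity.ennreal_ofReal
    (hF.comp (measurable_affinePoint 0))).trans ?_
  simp only [Pi.mul_apply, volDensity_eq]
  rfl

theorem lintegral_comp_complex_smul {n : ℕ} (c : ℂ) (hc : c ≠ 0) {h : Coord n → ℝ≥0∞}
    (hh : Measurable h) :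
    ∫⁻ z, h z = ENNReal.ofReal (Complex.normSq c ^ n) * ∫⁻ z, h (c • z) := by
  let f : Coord n →ₗ[ℂ] Coord n := c • LinearMap.id
  have hdet : LinearMap.det (f.restrictScalars ℝ) = Complex.normSq c ^ n := by
    rw [LinearMap.det_restrictScalars, Algebra.norm_complex_apply, LinearMap.det_smul]
    simp
  have hpos : 0 < Complex.normSq c ^ n := pow_pos (Complex.normSq_pos.2 hc) n
  have hmap := Measure.map_linearMap_addHaar_eq_smul_addHaar (volume : Measure (Coord n))
    (f := f.restrictScalars ℝ) (by rw [hdet]; exact hpos.ne')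
  rw [hdet] at hmap
  have h1 : ∫⁻ z, h (c • z) = ∫⁻ z, h z ∂(Measure.map (f.restrictScalars ℝ) volume) := by
    rw [lintegral_map hh]
    · rfl
    · exact (LinearMap.continuous_of_finiteDimensional _).measurable
  rw [h1, hmap, lintegral_smul_measure, smul_eq_mul, ← mul_assoc, ← ENNReal.ofReal_mul hpos.le,
    abs_of_pos (inv_pos.2 hpos), mul_inv_cancel₀ hpos.ne', ENNReal.ofReal_one, one_mul]

theorem lintegral_complex_comp_mul {r : ℝ} (hr : 0 < r) {h : ℂ → ℝ≥0∞} (hh : Measurable h) :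
    ∫⁻ η, h η = ENNReal.ofReal (r ^ 2) * ∫⁻ η : ℂ, h (r • η) := by
  have hpos : 0 < r ^ 2 := pow_pos hr 2
  have hmap := Measure.map_addHaar_smul (volume : Measure ℂ) hr.ne'
  rw [Complex.finrank_real_complex] at hmap
  rw [← lintegral_map hh (measurable_const_smul r), hmap, lintegral_smul_measure, smul_eq_mul,
    ← mul_assoc, ← ENNReal.ofReal_mul hpos.le, abs_of_pos (inv_pos.2 hpos),
    mul_inv_cancel₀ hpos.ne', ENNReal.ofReal_one, one_mul]

theorem insertNth_smul_eq {n : ℕ} (c : ℂ) (z : Coord n) :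
    ((0 : Fin (n + 1)).insertNth c (c • z) : Fin (n + 1) → ℂ) = c • (affineVec 0 z).ofLp := by
  funext k
  refine Fin.succAboveCases 0 ?_ (fun k => ?_) k
  · simp [affineVec_ofLp_self]
  · simp only [Fin.insertNth_apply_succAbove, Pi.smul_apply, affineVec_ofLp_succAbove]

/-- The radial factor in the integration formula for homogeneous coordinates. -/
noncomputable def radialMass (n : ℕ) (ρ : ℝ → ℝ≥0∞) : ℝ≥0∞ :=
  ∫⁻ η : ℂ, ENNReal.ofReal (Complex.normSq η ^ n) * ρ (Complex.normSq η)

/-- Integration in homogeneous coordinates against a radial weight: the change of variables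
`ξ = η (1 + |z|²)^(-1/2) (1, z)` separates the point `[ξ]` of `ℂℙⁿ` from the variable `η`. -/
theorem lintegral_comp_toCP {n : ℕ} {ρ : ℝ → ℝ≥0∞} (hρ : Measurable ρ) {F : CP n → ℝ≥0∞}
    (hF : Measurable F) :
    ∫⁻ ξ : Coord (n + 1), ρ (nsq ξ) * F (toCP ξ) =
      radialMass n ρ * ∫⁻ p, F p ∂(volumeFS n) := by
  -- The substitution is made in two steps: `ξ = (c, c z)`, which has the Jacobian `|c|²ⁿ`, and then
  -- `c = (1 + |z|²)^(-1/2) η`.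
  have hmp := (volume_preserving_piFinSuccAbove (fun _ : Fin (n + 1) => ℂ) 0).symm
  have hg : Measurable fun ξ : Coord (n + 1) => ρ (nsq ξ) * F (toCP ξ) :=
    (hρ.comp continuous_nsq.measurable).mul (hF.comp measurable_toCP)
  have hN : Measurable (Complex.normSq : ℂ → ℝ) := Complex.continuous_normSq.measurable
  have hg2 : Measurable fun x : ℂ × Coord n =>
      ρ (nsq ((MeasurableEquiv.piFinSuccAbove (fun _ : Fin (n + 1) => ℂ) 0).symm x)) *
        F (toCP ((MeasurableEquiv.piFinSuccAbove (fun _ : Fin (n + 1) => ℂ) 0).symm x)) :=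
    hg.comp hmp.measurable
  rw [← hmp.lintegral_comp hg, Measure.volume_eq_prod, lintegral_prod _ hg2.aemeasurable]
  have e1 : ∀ᵐ c : ℂ, ∫⁻ ζ : Coord n,
      ρ (nsq ((MeasurableEquiv.piFinSuccAbove (fun _ : Fin (n + 1) => ℂ) 0).symm (c, ζ))) *
        F (toCP ((MeasurableEquiv.piFinSuccAbove (fun _ : Fin (n + 1) => ℂ) 0).symm (c, ζ))) =
      ∫⁻ z : Coord n, ENNReal.ofReal (Complex.normSq c ^ n) *
        ρ (Complex.normSq c * (1 + nsq z)) * F (affinePoint 0 z) := by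
    have hne : ∀ᵐ c : ℂ, c ≠ 0 := by
      rw [ae_iff]
      simp
    filter_upwards [hne] with c hc
    have hm : Measurable fun ζ : Coord n =>
        ρ (nsq ((MeasurableEquiv.piFinSuccAbove (fun _ : Fin (n + 1) => ℂ) 0).symm (c, ζ))) *
        F (toCP ((MeasurableEquiv.piFinSuccAbove (fun _ : Fin (n + 1) => ℂ) 0).symm (c, ζ))) :=
      (hg.comp hmp.measurable).comp (measurable_const.prodMk measurable_id)
    have hm' : Measurable fun z : Coord n =>
        ρ (nsq ((MeasurableEquiv.piFinSuccAbove (fun _ : Fin (n + 1) => ℂ) 0).symm (c, c • z))) *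
        F (toCP ((MeasurableEquiv.piFinSuccAbove (fun _ : Fin (n + 1) => ℂ) 0).symm (c, c • z))) :=
      hm.comp (measurable_const_smul c)
    rw [lintegral_comp_complex_smul c hc hm, ← lintegral_const_mul _ hm']
    refine lintegral_congr fun z => ?_
    have e2 : (MeasurableEquiv.piFinSuccAbove (fun _ : Fin (n + 1) => ℂ) 0).symm (c, c • z) =
        c • (affineVec 0 z).ofLp := insertNth_smul_eq c z
    rw [e2, nsq_smul, nsq_affineVec, toCP_smul c hc _ (affineVec_ofLp_ne_zero 0 z),
      ← affinePoint_eq_toCP, mul_assoc]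
  have hm2 : Measurable fun x : ℂ × Coord n => ENNReal.ofReal (Complex.normSq x.1 ^ n) *
      ρ (Complex.normSq x.1 * (1 + nsq x.2)) * F (affinePoint 0 x.2) := by
    refine Measurable.mul (Measurable.mul ?_ (hρ.comp ?_)) ?_
    · exact ((hN.comp measurable_fst).pow_const n).ennreal_ofReal
    · exact (hN.comp measurable_fst).mul
        (measurable_const.add (continuous_nsq.measurable.comp measurable_snd))
    · exact hF.comp ((measurable_affinePoint 0).comp measurable_snd)
  rw [lintegral_congr_ae e1, lintegral_lintegral_swap hm2.aemeasurable, lintegral_volumeFS hF,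
    ← lintegral_const_mul]
  · refine lintegral_congr fun z => ?_
    have hS := one_add_nsq_pos z
    have hT := Real.sqrt_pos.2 hS
    have hm3 : Measurable fun η : ℂ => ENNReal.ofReal (Complex.normSq η ^ n) *
        ρ (Complex.normSq η) := ((hN.pow_const n).ennreal_ofReal).mul (hρ.comp hN)
    -- The two substitutions leave the factor `(1 + |z|²)^(-n-1)`, which is the volume density.
    rw [lintegral_mul_const, radialMass, lintegral_complex_comp_mul hT hm3, ← mul_assoc]
    · congr 1
      rw [Real.sq_sqrt hS.le, mul_right_comm, ← ENNReal.ofReal_mul hS.le]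
      rw [← lintegral_const_mul]
      · refine lintegral_congr fun η => ?_
        have e3 : Complex.normSq (√(1 + nsq z) • η) = (1 + nsq z) * Complex.normSq η := by
          rw [Complex.real_smul, Complex.normSq_mul, Complex.normSq_ofReal,
            Real.mul_self_sqrt hS.le]
        rw [e3, mul_comm (Complex.normSq η), ← mul_assoc, ← ENNReal.ofReal_mul (by positivity)]
        congr 2
        rw [mul_pow, pow_succ, inv_pow]
        field_simp
      · exact hm3.comp (measurable_const_smul _)
    · refine Measurable.mul ?_ (hρ.comp (hN.mul_const _))
      exact (hN.pow_const n).ennreal_ofReal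
  · refine Measurable.mul ?_ (hF.comp (measurable_affinePoint 0))
    exact (((measurable_const.add continuous_nsq.measurable).inv).pow_const _).ennreal_ofReal

/-! ### The volume of complex projective space -/

theorem gaussian_radialMass (n : ℕ) :
    radialMass n (fun t => ENNReal.ofReal (Real.exp (-t))) =
      ENNReal.ofReal (Real.pi * n.factorial) := by
  have h1 := Complex.integral_rpow_mul_exp_neg_rpow (p := 2) (q := 2 * n) (by norm_num)
    (by linarith [n.cast_nonneg (α := ℝ)])
  have h2 : (2 * Real.pi / 2) * Real.Gamma ((2 * n + 2) / 2) = Real.pi * n.factorial := by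
    rw [show ((2 * n + 2) / 2 : ℝ) = n + 1 by ring, Real.Gamma_nat_eq_factorial]
    ring
  rw [h2] at h1
  have e : ∀ x : ℂ, ‖x‖ ^ (2 * n : ℝ) * Real.exp (-‖x‖ ^ (2 : ℝ)) =
      Complex.normSq x ^ n * Real.exp (-Complex.normSq x) := by
    intro x
    have : (2 * n : ℝ) = ((2 * n : ℕ) : ℝ) := by push_cast; ring
    rw [this, Real.rpow_natCast, pow_mul, Real.rpow_two, Complex.normSq_eq_norm_sq]
  simp only [e] at h1
  have hpos : (0 : ℝ) < Real.pi * n.factorial := by positivity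
  -- The integral is not `0`, so the integrand is integrable.
  have hint : Integrable fun x : ℂ => Complex.normSq x ^ n * Real.exp (-Complex.normSq x) := by
    by_contra h
    rw [integral_undef h] at h1
    exact hpos.ne h1
  rw [← h1, ofReal_integral_eq_lintegral_ofReal hint (.of_forall fun x =>
    mul_nonneg (pow_nonneg (Complex.normSq_nonneg x) n) (Real.exp_pos _).le), radialMass]
  refine lintegral_congr fun x => ?_
  rw [ENNReal.ofReal_mul (pow_nonneg (Complex.normSq_nonneg x) n)]

theorem lintegral_gaussian (m : ℕ) :
    ∫⁻ ξ : Coord m, ENNReal.ofReal (Real.exp (-nsq ξ)) = ENNReal.ofReal (Real.pi ^ m) := by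
  have h1 := Complex.integral_rpow_mul_exp_neg_rpow (p := 2) (q := 0) (by norm_num) (by norm_num)
  have e : ∀ x : ℂ, ‖x‖ ^ (0 : ℝ) * Real.exp (-‖x‖ ^ (2 : ℝ)) =
      Real.exp (-Complex.normSq x) := by
    intro x
    rw [Real.rpow_zero, one_mul, Real.rpow_two, Complex.normSq_eq_norm_sq]
  have h2 : (2 * Real.pi / 2) * Real.Gamma ((0 + 2) / 2) = Real.pi := by
    norm_num [Real.Gamma_one]
  simp only [e, h2] at h1
  have h3 := integral_fintype_prod_volume_eq_pow (ι := Fin m) (𝕜 := ℝ)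
    (fun x : ℂ => Real.exp (-Complex.normSq x))
  rw [h1, Fintype.card_fin] at h3
  have e2 : ∀ ξ : Coord m, ∏ i, Real.exp (-Complex.normSq (ξ i)) = Real.exp (-nsq ξ) := by
    intro ξ
    rw [← Real.exp_sum, nsq, Finset.sum_neg_distrib]
  simp only [e2] at h3
  -- The integral is not `0`, so the integrand is integrable.
  have hint : Integrable fun ξ : Coord m => Real.exp (-nsq ξ) := by
    by_contra h
    rw [integral_undef h] at h3
    exact (pow_pos Real.pi_pos m).ne h3
  rw [← h3, ofReal_integral_eq_lintegral_ofReal hint (.of_forall fun ξ => (Real.exp_pos _).le)]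

theorem measurable_gaussian : Measurable fun t : ℝ => ENNReal.ofReal (Real.exp (-t)) := by
  fun_prop

theorem volumeFS_univ (n : ℕ) :
    volumeFS n Set.univ = ENNReal.ofReal (Real.pi ^ n / n.factorial) := by
  have h := lintegral_comp_toCP (n := n) (F := fun _ => 1) measurable_gaussian measurable_const
  simp only [mul_one, lintegral_const, one_mul] at h
  rw [lintegral_gaussian, gaussian_radialMass] at h
  have hf : (0 : ℝ) < n.factorial := by positivity
  have hpos : 0 < Real.pi * n.factorial := mul_pos Real.pi_pos hf
  have h2 : ENNReal.ofReal (Real.pi ^ (n + 1)) =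
      ENNReal.ofReal (Real.pi * n.factorial) * ENNReal.ofReal (Real.pi ^ n / n.factorial) := by
    rw [← ENNReal.ofReal_mul hpos.le]
    congr 1
    field_simp
    ring
  rw [h2] at h
  exact ((ENNReal.mul_right_inj (by simpa using hpos) ENNReal.ofReal_ne_top).1 h).symm

instance instIsFiniteMeasureVolumeFS (n : ℕ) : IsFiniteMeasure (volumeFS n) :=
  ⟨by rw [volumeFS_univ]; exact ENNReal.ofReal_lt_top⟩

theorem volumeFS_real_univ (n : ℕ) :
    (volumeFS n).real Set.univ = Real.pi ^ n / n.factorial := by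
  rw [Measure.real, volumeFS_univ, ENNReal.toReal_ofReal (by positivity)]

instance instIsOpenPosMeasureVolumeFS (n : ℕ) : (volumeFS n).IsOpenPosMeasure := by
  refine ⟨fun U hU hne h0 => ?_⟩
  have h := lintegral_comp_toCP (n := n) (F := U.indicator 1) measurable_gaussian
    (measurable_one.indicator hU.measurableSet)
  rw [lintegral_indicator_one hU.measurableSet, h0, mul_zero] at h
  have hm : Measurable fun ξ : Coord (n + 1) => ENNReal.ofReal (Real.exp (-nsq ξ)) *
      U.indicator (1 : CP n → ℝ≥0∞) (toCP ξ) :=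
    (measurable_gaussian.comp continuous_nsq.measurable).mul
      ((measurable_one.indicator hU.measurableSet).comp measurable_toCP)
  rw [lintegral_eq_zero_iff hm] at h
  have ho : IsOpen ({0}ᶜ ∩ toCP ⁻¹' U : Set (Coord (n + 1))) :=
    continuousOn_toCP.isOpen_inter_preimage isOpen_compl_singleton hU
  obtain ⟨p, hp⟩ := hne
  have hno : ({0}ᶜ ∩ toCP ⁻¹' U : Set (Coord (n + 1))).Nonempty :=
    ⟨p.rep.ofLp, rep_ofLp_ne_zero p, by rwa [Set.mem_preimage, toCP_rep]⟩
  refine (ho.measure_pos volume hno).ne' (measure_mono_null ?_ h)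
  intro ξ hξ h1
  have h2 : toCP ξ ∈ U := hξ.2
  have h3 : ENNReal.ofReal (Real.exp (-nsq ξ)) * U.indicator (1 : CP n → ℝ≥0∞) (toCP ξ) = 0 := h1
  rw [Set.indicator_of_mem h2] at h3
  simp at h3
  exact absurd h3 (not_le.2 (Real.exp_pos _))

/-- Points are null sets. -/
theorem volumeFS_singleton {n : ℕ} (hn : 1 ≤ n) (p : CP n) : volumeFS n {p} = 0 := by
  rw [volumeFS_eq_map, Measure.map_apply (measurable_affinePoint 0) (measurableSet_singleton p)]
  refine withDensity_absolutelyContinuous _ _ ?_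
  have h : (affinePoint (n := n) 0 ⁻¹' {p}).Subsingleton := by
    intro z hz w hw
    have h1 : affinePoint 0 z = p := hz
    have h2 : affinePoint 0 w = p := hw
    rw [← affineCoord_affinePoint 0 z, ← affineCoord_affinePoint 0 w, h1, h2]
  have : Nonempty (Fin n) := ⟨⟨0, hn⟩⟩
  exact h.measure_zero _

/-! ### Symmetry of the Laplace–Beltrami operator -/

theorem continuous_shellWeight {m : ℕ} :
    Continuous fun ξ : Coord m => shellBump (nsq ξ) / nsq ξ := by
  rw [continuous_iff_continuousAt]
  intro ξ
  rcases eq_or_ne ξ 0 with rfl | h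
  · refine (continuousAt_const (y := (0 : ℝ))).congr ?_
    filter_upwards [isClosed_shell.isOpen_compl.mem_nhds (zero_notMem_shell (m := m))] with y hy
    rw [shellBump_nsq_eq_zero hy, zero_div]
  · exact continuous_shellBump_nsq.continuousAt.div continuous_nsq.continuousAt (nsq_pos h).ne'

/-- Integration in homogeneous coordinates against the weight `shellBump (|ξ|²) / |ξ|²`. -/
theorem exists_integral_shellWeight (n : ℕ) : ∃ c : ℝ, c ≠ 0 ∧ ∀ f : CP n → ℝ, Continuous f →
    ∫ ξ : Coord (n + 1), shellBump (nsq ξ) / nsq ξ * f (toCP ξ) =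
      c * ∫ p, f p ∂(volumeFS n) := by
  set w : ℝ → ℝ := fun t => shellBump t / t with hw
  have hwm : Measurable w :=
    (contDiff_shellBump (r := 0)).continuous.measurable.div measurable_id
  have hw0 : ∀ ξ : Coord (n + 1), 0 ≤ w (nsq ξ) := fun ξ =>
    div_nonneg (shellBump_nonneg _) (nsq_nonneg ξ)
  set ρ : ℝ → ℝ≥0∞ := fun t => ENNReal.ofReal (w t) with hρ
  have hρm : Measurable ρ := hwm.ennreal_ofReal
  have hρn : Measurable fun ξ : Coord (n + 1) => ρ (nsq ξ) :=
    hρm.comp continuous_nsq.measurable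
  have hcont : Continuous fun ξ : Coord (n + 1) => w (nsq ξ) := continuous_shellWeight
  have hint : Integrable fun ξ : Coord (n + 1) => w (nsq ξ) :=
    integrable_of_eq_zero_off_shell hcont.continuousOn fun ξ hξ => by
      rw [hw]
      dsimp only
      rw [shellBump_nsq_eq_zero hξ, zero_div]
  have hmass := lintegral_comp_toCP (n := n) (F := fun _ => 1) hρm measurable_const
  simp only [mul_one, lintegral_const, one_mul] at hmass
  have hvol : volumeFS n Set.univ ≠ 0 := (isOpen_univ.measure_pos (volumeFS n)
    ⟨toCP (Pi.single 0 1), trivial⟩).ne'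
  have hfin : radialMass n ρ ≠ ⊤ := by
    intro h
    rw [h, ENNReal.top_mul hvol] at hmass
    exact hint.lintegral_lt_top.ne hmass
  have hne : radialMass n ρ ≠ 0 := by
    intro h
    rw [h, zero_mul, lintegral_eq_zero_iff hρn] at hmass
    have ho : IsOpen {ξ : Coord (n + 1) | 1 < nsq ξ ∧ nsq ξ < 3} :=
      (isOpen_lt continuous_const continuous_nsq).inter (isOpen_lt continuous_nsq continuous_const)
    have hno : {ξ : Coord (n + 1) | 1 < nsq ξ ∧ nsq ξ < 3}.Nonempty := by
      refine ⟨((√2 : ℝ) : ℂ) • Pi.single 0 1, ?_⟩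
      have : nsq (((√2 : ℝ) : ℂ) • (Pi.single 0 1 : Coord (n + 1))) = 2 := by
        rw [nsq_smul, Complex.normSq_ofReal, Real.mul_self_sqrt zero_le_two]
        simp [nsq, Pi.single_apply, apply_ite Complex.normSq]
      rw [Set.mem_ofPred_eq, this]
      norm_num
    refine (ho.measure_pos volume hno).ne' (measure_mono_null ?_ hmass)
    intro ξ hξ h1
    have h2 : ENNReal.ofReal (w (nsq ξ)) = 0 := h1
    rw [ENNReal.ofReal_eq_zero] at h2
    exact absurd h2 (not_le.2 (div_pos (shellBump_pos hξ.1 hξ.2) (by linarith [hξ.1])))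
  refine ⟨(radialMass n ρ).toReal, ENNReal.toReal_ne_zero.2 ⟨hne, hfin⟩, fun f hf => ?_⟩
  have hmap : (((volume : Measure (Coord (n + 1))).withDensity fun ξ => ρ (nsq ξ)).map toCP) =
      radialMass n ρ • volumeFS n := by
    refine Measure.ext_of_lintegral _ fun F hF => ?_
    rw [lintegral_map hF measurable_toCP, lintegral_smul_measure, smul_eq_mul,
      ← lintegral_comp_toCP hρm hF]
    exact lintegral_withDensity_eq_lintegral_mul _ hρn
      (hF.comp measurable_toCP)
  have h1 : ∫ p, f p ∂(radialMass n ρ • volumeFS n) =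
      (radialMass n ρ).toReal * ∫ p, f p ∂(volumeFS n) := by
    rw [integral_smul_measure, smul_eq_mul]
  rw [← h1, ← hmap, integral_map measurable_toCP.aemeasurable hf.aestronglyMeasurable,
    integral_withDensity_eq_integral_toReal_smul hρn
      (.of_forall fun ξ => ENNReal.ofReal_lt_top)]
  refine integral_congr_ae (.of_forall fun ξ => ?_)
  simp only [hρ, smul_eq_mul, ENNReal.toReal_ofReal (hw0 ξ)]
  rfl

/-- Green's second identity. -/
theorem integral_mul_laplaceBeltrami_comm {n : ℕ} {φ ψ : CP n → ℝ}
    (hφ : ContMDiff 𝓘(ℝ, Coord n) 𝓘(ℝ, ℝ) 2 φ) (hψ : ContMDiff 𝓘(ℝ, Coord n) 𝓘(ℝ, ℝ) 2 ψ) :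
    ∫ p, ψ p * laplaceBeltrami φ p ∂(volumeFS n) =
      ∫ p, φ p * laplaceBeltrami ψ p ∂(volumeFS n) := by
  obtain ⟨c, hc, h⟩ := exists_integral_shellWeight n
  have h1 := h (fun p => ψ p * laplaceBeltrami φ p)
    (hψ.continuous.mul (continuous_laplaceBeltrami hφ))
  have h2 := h (fun p => φ p * laplaceBeltrami ψ p)
    (hφ.continuous.mul (continuous_laplaceBeltrami hψ))
  rw [integral_shellBump_mul_laplaceBeltrami hφ hψ, h2] at h1
  exact (mul_left_cancel₀ hc h1).symm

/-! ### Moments of the function `cos² r` -/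

theorem laplaceBeltrami_const {n : ℕ} (a : ℝ) (q : CP n) :
    laplaceBeltrami (fun _ : CP n => a) q = 0 := by
  simp [laplaceBeltrami, coordLaplacian, Function.comp_def]

theorem integral_laplaceBeltrami {n : ℕ} {φ : CP n → ℝ}
    (hφ : ContMDiff 𝓘(ℝ, Coord n) 𝓘(ℝ, ℝ) 2 φ) :
    ∫ q, laplaceBeltrami φ q ∂(volumeFS n) = 0 := by
  have h := integral_mul_laplaceBeltrami_comm hφ
    (contMDiff_const (c := (1 : ℝ)) : ContMDiff 𝓘(ℝ, Coord n) 𝓘(ℝ, ℝ) 2 fun _ : CP n => (1 : ℝ))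
  simpa [laplaceBeltrami_const] using h

theorem integrable_of_continuous {n : ℕ} {f : CP n → ℝ} (hf : Continuous f) :
    Integrable f (volumeFS n) := by
  rw [← integrableOn_univ]
  exact hf.continuousOn.integrableOn_compact isCompact_univ

theorem integrable_cosSq_pow_mul {n : ℕ} (p : CP n) (k : ℕ) {f : CP n → ℝ}
    (hf : Integrable f (volumeFS n)) : Integrable (fun q => cosSq p q ^ k * f q) (volumeFS n) := by
  refine hf.bdd_mul (c := 1) ((continuous_cosSq p).pow k).aestronglyMeasurable
    (.of_forall fun q => ?_)
  rw [Real.norm_of_nonneg (pow_nonneg (cosSq_nonneg p q) k)]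
  exact pow_le_one₀ (cosSq_nonneg p q) (cosSq_le_one p q)

/-- Since `Δ` maps `cos²ᵏ⁺² r` to a combination of `cos²ᵏ⁺² r` and `cos²ᵏ r`, integrating an
integrable function against `Δ (cos²ᵏ⁺² r)` relates two consecutive moments. -/
theorem integral_mul_laplaceBeltrami_cosSq_pow {n : ℕ} (p : CP n) (k : ℕ) {f : CP n → ℝ}
    (hf : Integrable f (volumeFS n)) :
    ∫ q, f q * laplaceBeltrami (fun q => cosSq p q ^ (k + 1)) q ∂(volumeFS n) =
      4 * (k + 1) * (k + 1 + n) * ∫ q, cosSq p q ^ (k + 1) * f q ∂(volumeFS n) -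
        4 * (k + 1) ^ 2 * ∫ q, cosSq p q ^ k * f q ∂(volumeFS n) := by
  rw [← integral_const_mul, ← integral_const_mul, ← integral_sub
    ((integrable_cosSq_pow_mul p _ hf).const_mul _) ((integrable_cosSq_pow_mul p _ hf).const_mul _)]
  refine integral_congr_ae (.of_forall fun q => ?_)
  simp only [laplaceBeltrami_cosSq_pow]
  ring

/-- The integral of `cos²ᵏ r(p, ·)` over `ℂℙⁿ`. -/
noncomputable def cosMoment (n k : ℕ) : ℝ := Real.pi ^ n * k.factorial / (n + k).factorial

theorem cosMoment_pos (n k : ℕ) : 0 < cosMoment n k := by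
  unfold cosMoment
  positivity

theorem cosMoment_zero (n : ℕ) : cosMoment n 0 = (volumeFS n).real Set.univ := by
  simp [cosMoment, volumeFS_real_univ]

theorem cosMoment_succ (n k : ℕ) :
    (k + 1 + n : ℝ) * cosMoment n (k + 1) = (k + 1) * cosMoment n k := by
  unfold cosMoment
  rw [← add_assoc, Nat.factorial_succ, Nat.factorial_succ]
  have : ((n + k).factorial : ℝ) ≠ 0 := by positivity
  push_cast
  field_simp
  ring

/-- A function orthogonal to all `Δ (cos²ᵏ⁺² r(p, ·))` has the moments of a constant. -/
theorem integral_cosSq_pow_mul_of_orthogonal {n : ℕ} (p : CP n) {f : CP n → ℝ}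
    (hf : Integrable f (volumeFS n))
    (h : ∀ k : ℕ, ∫ q, f q * laplaceBeltrami (fun q => cosSq p q ^ (k + 1)) q ∂(volumeFS n) = 0)
    (k : ℕ) : (cosMoment n 0) * ∫ q, cosSq p q ^ k * f q ∂(volumeFS n) =
      cosMoment n k * ∫ q, f q ∂(volumeFS n) := by
  induction k with
  | zero => simp
  | succ k ih =>
    have h1 := h k
    rw [integral_mul_laplaceBeltrami_cosSq_pow p k hf] at h1
    have hk : (k + 1 : ℝ) ≠ 0 := by positivity
    have hkn : (k + 1 + n : ℝ) ≠ 0 := by positivity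
    have h2 : (k + 1 + n : ℝ) * ∫ q, cosSq p q ^ (k + 1) * f q ∂(volumeFS n) =
        (k + 1) * ∫ q, cosSq p q ^ k * f q ∂(volumeFS n) := by
      refine mul_left_cancel₀ (mul_ne_zero four_ne_zero hk) ?_
      linear_combination h1
    refine mul_left_cancel₀ hkn ?_
    linear_combination cosMoment n 0 * h2 + (k + 1 : ℝ) * ih -
      (∫ q, f q ∂(volumeFS n)) * cosMoment_succ n k

theorem integral_cosSq_pow {n : ℕ} (p : CP n) (k : ℕ) :
    ∫ q, cosSq p q ^ k ∂(volumeFS n) = cosMoment n k := by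
  have h := integral_cosSq_pow_mul_of_orthogonal p (f := fun _ => 1)
    (integrable_of_continuous continuous_const)
    (fun k => by simpa using integral_laplaceBeltrami (contMDiff_cosSq_pow p (k + 1))) k
  simp only [mul_one, integral_const, smul_eq_mul, ← cosMoment_zero] at h
  exact mul_left_cancel₀ (cosMoment_pos n 0).ne' (h.trans (mul_comm _ _))

/-- The probability densities `cos²ᵏ r(p, ·) / cosMoment n k` concentrate at `p`. -/
theorem tendsto_integral_cosSq_pow_mul {n : ℕ} (p : CP n) {f : CP n → ℝ}
    (hf : Integrable f (volumeFS n)) (hfp : ContinuousAt f p) :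
    Tendsto (fun k => (cosMoment n k)⁻¹ * ∫ q, cosSq p q ^ k * f q ∂(volumeFS n)) atTop
      (𝓝 (f p)) := by
  have h := tendsto_setIntegral_pow_smul_of_unique_maximum_of_isCompact_of_integrableOn
    (μ := volumeFS n) (s := Set.univ) (c := cosSq p) (x₀ := p) (g := f) isCompact_univ
    (continuous_cosSq p).continuousOn
    (fun y _ hy => by rw [cosSq_self]; exact cosSq_lt_one hy.symm)
    (fun y _ => cosSq_nonneg p y) (by rw [cosSq_self]; exact one_pos) (by simp)
    hf.integrableOn hfp.continuousWithinAt
  simpa [integral_cosSq_pow] using h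

/-! ### The expansion of Green's function in powers of `cos² r` -/

/-- The coefficients of Green's function as a power series in `cos² r`. They are chosen such that
`Δ` maps the `k`-th term to `cos²ᵏ⁺² r / cosMoment n (k + 1) - cos²ᵏ r / cosMoment n k`. -/
noncomputable def greenCoeff (n k : ℕ) : ℝ := 1 / (4 * (k + 1) ^ 2 * cosMoment n k)

theorem greenCoeff_pos (n k : ℕ) : 0 < greenCoeff n k := by
  have := cosMoment_pos n k
  unfold greenCoeff
  positivity

theorem greenCoeff_mul_cosMoment_succ (n k : ℕ) :
    greenCoeff n k * cosMoment n (k + 1) = 1 / (4 * (k + 1) * (k + 1 + n)) := by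
  have h := cosMoment_succ n k
  have h0 := (cosMoment_pos n k).ne'
  unfold greenCoeff
  field_simp
  linear_combination h

theorem summable_greenCoeff_mul_cosMoment (n : ℕ) :
    Summable fun k => greenCoeff n k * cosMoment n (k + 1) := by
  have h : Summable fun k : ℕ => 1 / ((k + 1 : ℕ) : ℝ) ^ 2 :=
    (summable_nat_add_iff 1).2 (Real.summable_one_div_nat_pow.2 one_lt_two)
  refine h.of_nonneg_of_le (fun k => (mul_pos (greenCoeff_pos n k) (cosMoment_pos n _)).le)
    fun k => ?_
  rw [greenCoeff_mul_cosMoment_succ]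
  have hn : (0 : ℝ) ≤ n := n.cast_nonneg
  have hk : (0 : ℝ) ≤ k := k.cast_nonneg
  push_cast
  refine one_div_le_one_div_of_le (by positivity) ?_
  nlinarith [mul_nonneg hk hn]

/-- Green's function, up to a constant, as a function of `t = cos² r`. -/
noncomputable def greenSeries (n : ℕ) (t : ℝ) : ℝ := ∑' k, greenCoeff n k * t ^ (k + 1)

theorem integral_greenCoeff_mul_cosSq_pow {n : ℕ} (p : CP n) (k : ℕ) :
    ∫ q, greenCoeff n k * cosSq p q ^ (k + 1) ∂(volumeFS n) =
      greenCoeff n k * cosMoment n (k + 1) := by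
  rw [integral_const_mul, integral_cosSq_pow]

theorem hasSum_integral_greenCoeff {n : ℕ} (p : CP n) :
    HasSum (fun k => greenCoeff n k * cosMoment n (k + 1))
      (∫ q, greenSeries n (cosSq p q) ∂(volumeFS n)) := by
  have h := hasSum_integral_of_summable_integral_norm (μ := volumeFS n)
    (F := fun k q => greenCoeff n k * cosSq p q ^ (k + 1))
    (fun k => integrable_of_continuous (((continuous_cosSq p).pow _).const_mul _)) ?_
  · simp only [integral_greenCoeff_mul_cosSq_pow] at h
    exact h
  · refine (summable_greenCoeff_mul_cosMoment n).congr fun k => ?_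
    rw [← integral_greenCoeff_mul_cosSq_pow p]
    refine integral_congr_ae (.of_forall fun q => ?_)
    exact (Real.norm_of_nonneg (mul_nonneg (greenCoeff_pos n k).le
      (pow_nonneg (cosSq_nonneg p q) _))).symm

theorem integral_greenSeries {n : ℕ} (p : CP n) :
    ∫ q, greenSeries n (cosSq p q) ∂(volumeFS n) =
      ∑' k, greenCoeff n k * cosMoment n (k + 1) :=
  (hasSum_integral_greenCoeff p).tsum_eq.symm

theorem integrable_greenSeries {n : ℕ} (p : CP n) :
    Integrable (fun q => greenSeries n (cosSq p q)) (volumeFS n) := by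
  -- The integral is a sum of positive terms, so it is not the default value `0`.
  by_contra h
  have h1 := integral_undef h
  rw [integral_greenSeries] at h1
  exact ((summable_greenCoeff_mul_cosMoment n).tsum_pos
    (fun k => (mul_pos (greenCoeff_pos n k) (cosMoment_pos n _)).le) 0
    (mul_pos (greenCoeff_pos n 0) (cosMoment_pos n _))).ne' h1

/-- Integrating the terms of the series against `Δφ` gives a telescoping sum. -/
theorem integral_greenCoeff_mul_laplaceBeltrami {n : ℕ} {φ : CP n → ℝ}
    (hφ : ContMDiff 𝓘(ℝ, Coord n) 𝓘(ℝ, ℝ) 2 φ) (p : CP n) (k : ℕ) :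
    ∫ q, greenCoeff n k * cosSq p q ^ (k + 1) * laplaceBeltrami φ q ∂(volumeFS n) =
      (cosMoment n (k + 1))⁻¹ * (∫ q, cosSq p q ^ (k + 1) * φ q ∂(volumeFS n)) -
        (cosMoment n k)⁻¹ * ∫ q, cosSq p q ^ k * φ q ∂(volumeFS n) := by
  have h := integral_mul_laplaceBeltrami_comm hφ (contMDiff_cosSq_pow p (k + 1))
  rw [integral_mul_laplaceBeltrami_cosSq_pow p k (integrable_of_continuous hφ.continuous)] at h
  simp only [mul_assoc]
  rw [integral_const_mul, h]
  have h0 := (cosMoment_pos n k).ne'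
  have h1 : cosMoment n (k + 1) = (k + 1) * cosMoment n k / (k + 1 + n) := by
    rw [← cosMoment_succ]
    field_simp
  rw [h1, greenCoeff]
  field_simp

/-- Green's representation formula for the power series. -/
theorem integral_greenSeries_mul_laplaceBeltrami {n : ℕ} {φ : CP n → ℝ}
    (hφ : ContMDiff 𝓘(ℝ, Coord n) 𝓘(ℝ, ℝ) 2 φ) (p : CP n) :
    ∫ q, greenSeries n (cosSq p q) * laplaceBeltrami φ q ∂(volumeFS n) =
      φ p - 1 / (volumeFS n).real Set.univ * ∫ q, φ q ∂(volumeFS n) := by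
  obtain ⟨C, hC⟩ := exists_abs_laplaceBeltrami_le hφ
  have hL := continuous_laplaceBeltrami hφ
  have hterm : ∀ k : ℕ, Continuous fun q : CP n =>
      greenCoeff n k * cosSq p q ^ (k + 1) * laplaceBeltrami φ q := fun k =>
    (((continuous_cosSq p).pow _).const_mul _).mul hL
  have h := hasSum_integral_of_summable_integral_norm (μ := volumeFS n)
    (F := fun k q => greenCoeff n k * cosSq p q ^ (k + 1) * laplaceBeltrami φ q)
    (fun k => integrable_of_continuous (hterm k)) ?_
  · simp only [integral_greenCoeff_mul_laplaceBeltrami hφ p, tsum_mul_right] at h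
    have h1 := h.tendsto_sum_nat
    simp only [Finset.sum_range_sub fun k =>
      (cosMoment n k)⁻¹ * ∫ q, cosSq p q ^ k * φ q ∂(volumeFS n)] at h1
    have h2 := (tendsto_integral_cosSq_pow_mul p (integrable_of_continuous hφ.continuous)
      hφ.continuous.continuousAt).sub_const
        ((cosMoment n 0)⁻¹ * ∫ q, cosSq p q ^ 0 * φ q ∂(volumeFS n))
    have h3 := tendsto_nhds_unique h1 h2
    simp only [pow_zero, one_mul, cosMoment_zero] at h3
    rw [one_div]
    exact h3
  · refine ((summable_greenCoeff_mul_cosMoment n).mul_right C).of_nonneg_of_le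
      (fun k => integral_nonneg fun q => norm_nonneg _) fun k => ?_
    rw [← integral_greenCoeff_mul_cosSq_pow p, ← integral_mul_const]
    refine integral_mono (integrable_of_continuous (hterm k).norm) (integrable_of_continuous
      ((((continuous_cosSq p).pow _).const_mul _).mul_const C)) fun q => ?_
    dsimp only
    rw [norm_mul, Real.norm_of_nonneg (mul_nonneg (greenCoeff_pos n k).le
      (pow_nonneg (cosSq_nonneg p q) _))]
    exact mul_le_mul_of_nonneg_left (hC q) (mul_nonneg (greenCoeff_pos n k).le
      (pow_nonneg (cosSq_nonneg p q) _))

/-! ### Green's function in closed form -/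

theorem hasSum_choose_mul_pow_div (N : ℕ) {t : ℝ} (h0 : 0 ≤ t) (h1 : t < 1) :
    HasSum (fun k : ℕ => ((k + 1 + N).choose N : ℝ) * t ^ (k + 1) / (k + 1))
      (-Real.log (1 - t) + ∑ j ∈ Finset.Icc 1 N, (1 / (1 - t) ^ j - 1) / j) := by
  induction N with
  | zero => simpa using Real.hasSum_pow_div_log_of_abs_lt_one (abs_lt.2 ⟨by linarith, h1⟩)
  | succ N ih =>
    have hg := hasSum_choose_mul_geometric_of_norm_lt_one N (r := t)
      (by rwa [Real.norm_of_nonneg h0])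
    have hg2 := ((hasSum_nat_add_iff' 1).2 hg).div_const (N + 1 : ℝ)
    rw [Finset.sum_range_one] at hg2
    simp only [zero_add, Nat.choose_self, pow_zero, Nat.cast_one, mul_one] at hg2
    rw [← Finset.insert_Icc_right_eq_Icc_add_one (by omega), Finset.sum_insert (by simp),
      add_left_comm, add_comm _ (_ + _)]
    push_cast
    refine (ih.add hg2).congr_fun fun k => ?_
    have hc : ((k + 1 + N).choose (N + 1) : ℝ) * (N + 1) = (k + 1 + N).choose N * (k + 1) := by
      have := Nat.choose_succ_right_eq (k + 1 + N) N
      rw [show k + 1 + N - N = k + 1 by omega] at this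
      exact_mod_cast this
    rw [← add_assoc (k + 1) N 1, Nat.choose_succ_succ]
    push_cast
    field_simp
    linear_combination (t ^ (k + 1)) * hc

theorem greenCoeff_eq {n : ℕ} (hn : 1 ≤ n) (k : ℕ) :
    greenCoeff n k = ((n - 1).factorial : ℝ) / (4 * Real.pi ^ n) *
      ((k + 1 + (n - 1)).choose (n - 1) / (k + 1)) := by
  obtain ⟨N, rfl⟩ := Nat.exists_eq_add_of_le' hn
  rw [Nat.add_sub_cancel, Nat.add_comm (k + 1) N, Nat.cast_add_choose, greenCoeff, cosMoment,
    Nat.factorial_succ k,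
    show N + (k + 1) = N + 1 + k by omega]
  have : (k.factorial : ℝ) ≠ 0 := by positivity
  have : (N.factorial : ℝ) ≠ 0 := by positivity
  push_cast
  field_simp

theorem greenSeries_eq {n : ℕ} (hn : 1 ≤ n) {t : ℝ} (h0 : 0 ≤ t) (h1 : t < 1) :
    greenSeries n t = ((n - 1).factorial : ℝ) / (4 * Real.pi ^ n) *
      (-Real.log (1 - t) + ∑ j ∈ Finset.Icc 1 (n - 1), (1 / (1 - t) ^ j - 1) / j) := by
  rw [← (hasSum_choose_mul_pow_div (n - 1) h0 h1).tsum_eq, ← tsum_mul_left]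
  refine tsum_congr fun k => ?_
  rw [greenCoeff_eq hn]
  ring

/-- The explicit Green's function of `ℂℙⁿ`, as a function of `s = sin² r`. -/
noncomputable def greenProfile (n : ℕ) (s : ℝ) : ℝ :=
  -(((n - 1).factorial : ℝ) / (2 * Real.pi ^ n)) *
    (Real.log s / 2 - ∑ j ∈ Finset.Icc 1 (n - 1), 1 / (2 * (j : ℝ) * s ^ j))

/-- The explicit Green's function of `ℂℙⁿ`, in terms of the distance. -/
noncomputable def fsGreen {n : ℕ} (p q : CP n) : ℝ :=
  -(((n - 1).factorial : ℝ) / (2 * Real.pi ^ n)) *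
    (Real.log (Real.sin (fsDist p q)) -
      ∑ j ∈ Finset.Icc 1 (n - 1), 1 / (2 * (j : ℝ) * Real.sin (fsDist p q) ^ (2 * j)))

theorem fsGreen_eq_greenProfile {n : ℕ} (p q : CP n) :
    fsGreen p q = greenProfile n (1 - cosSq p q) := by
  have h := sub_nonneg.2 (cosSq_le_one p q)
  simp only [fsGreen, greenProfile, sin_fsDist, Real.log_sqrt h, pow_mul, Real.sq_sqrt h]

theorem fsGreen_eq_greenSeries {n : ℕ} (hn : 1 ≤ n) {p q : CP n} (h : p ≠ q) :
    fsGreen p q = greenSeries n (cosSq p q) +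
      ((n - 1).factorial : ℝ) / (4 * Real.pi ^ n) * ∑ j ∈ Finset.Icc 1 (n - 1), 1 / (j : ℝ) := by
  rw [fsGreen_eq_greenProfile, greenSeries_eq hn (cosSq_nonneg p q) (cosSq_lt_one h),
    greenProfile, ← mul_add, add_assoc, ← Finset.sum_add_distrib]
  have e : ∀ j : ℕ, 1 / (2 * (j : ℝ) * (1 - cosSq p q) ^ j) =
      ((1 / (1 - cosSq p q) ^ j - 1) / j + 1 / j) / 2 := by
    intro j
    rw [← add_div, sub_add_cancel, div_div, div_div]
    congr 1
    ring
  simp only [e, ← Finset.sum_div]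
  field_simp
  ring

theorem fsGreen_ae_eq {n : ℕ} (hn : 1 ≤ n) (p : CP n) :
    fsGreen p =ᵐ[volumeFS n] fun q => greenSeries n (cosSq p q) +
      ((n - 1).factorial : ℝ) / (4 * Real.pi ^ n) *
        ∑ j ∈ Finset.Icc 1 (n - 1), 1 / (j : ℝ) := by
  have h : ∀ᵐ q ∂(volumeFS n), q ∉ ({p} : Set (CP n)) :=
    measure_eq_zero_iff_ae_notMem.1 (volumeFS_singleton hn p)
  filter_upwards [h] with q hq
  exact fsGreen_eq_greenSeries hn (Ne.symm hq)

theorem contDiffAt_greenProfile {n : ℕ} {s : ℝ} (hs : s ≠ 0) :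
    ContDiffAt ℝ (⊤ : ℕ∞) (greenProfile n) s := by
  unfold greenProfile
  refine contDiffAt_const.mul ((((contDiffAt_id).log hs).div_const 2).sub
    (ContDiffAt.sum fun j hj => ?_))
  have hj0 : (j : ℝ) ≠ 0 := by
    have := (Finset.mem_Icc.1 hj).1
    positivity
  exact contDiffAt_const.div (contDiffAt_const.mul (contDiffAt_id.pow j))
    (mul_ne_zero (mul_ne_zero two_ne_zero hj0) (pow_ne_zero j hs))

theorem isGreenFunction_fsGreen {n : ℕ} (hn : 1 ≤ n) :
    IsGreenFunction (fsGreen : CP n → CP n → ℝ) where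
  integrable p := ((integrable_greenSeries p).add (integrable_const _)).congr
    (fsGreen_ae_eq hn p).symm
  representation φ hφ p := by
    obtain ⟨C, hC⟩ := exists_abs_laplaceBeltrami_le hφ
    have hL := continuous_laplaceBeltrami hφ
    have h1 : ∫ q, fsGreen p q * laplaceBeltrami φ q ∂(volumeFS n) =
        ∫ q, greenSeries n (cosSq p q) * laplaceBeltrami φ q ∂(volumeFS n) := by
      refine (integral_congr_ae ((fsGreen_ae_eq hn p).mul
        (ae_eq_refl (laplaceBeltrami φ)))).trans ?_
      simp only [Pi.mul_apply, add_mul]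
      rw [integral_add, integral_const_mul, integral_laplaceBeltrami hφ, mul_zero, add_zero]
      · exact (integrable_greenSeries p).mul_bdd hL.aestronglyMeasurable (.of_forall hC)
      · exact (integrable_of_continuous hL).const_mul _
    rw [h1, integral_greenSeries_mul_laplaceBeltrami hφ p]
    ring
  smooth := by
    intro x hx
    have h1 : (1 : ℝ) - cosSq x.1 x.2 ≠ 0 := (sub_pos.2 (cosSq_lt_one hx)).ne'
    have h2 : (fun x : CP n × CP n => fsGreen x.1 x.2) =
        greenProfile n ∘ fun x : CP n × CP n => 1 - cosSq x.1 x.2 :=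
      funext fun x => fsGreen_eq_greenProfile x.1 x.2
    rw [h2]
    exact ((contDiffAt_greenProfile h1).contMDiffAt.comp x
      ((contMDiff_const.sub contMDiff_cosSq_prod) x)).contMDiffWithinAt
  symm p q _ := by rw [fsGreen_eq_greenProfile, fsGreen_eq_greenProfile, cosSq_comm]
  integral_const := by
    refine ⟨(∑' k, greenCoeff n k * cosMoment n (k + 1)) + (volumeFS n).real Set.univ *
      (((n - 1).factorial : ℝ) / (4 * Real.pi ^ n) *
        ∑ j ∈ Finset.Icc 1 (n - 1), 1 / (j : ℝ)), fun p => ?_⟩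
    rw [integral_congr_ae (fsGreen_ae_eq hn p), integral_add (integrable_greenSeries p)
      (integrable_const _), integral_greenSeries, integral_const, smul_eq_mul]

/-! ### Uniqueness of Green's function -/

theorem IsGreenFunction.continuousAt {n : ℕ} {G : CP n → CP n → ℝ} (hG : IsGreenFunction G)
    {p w : CP n} (h : p ≠ w) : ContinuousAt (G p) w := by
  have ho : IsOpen {x : CP n × CP n | x.1 ≠ x.2} := isOpen_ne_fun continuous_fst continuous_snd
  have h1 : ContinuousAt (fun x : CP n × CP n => G x.1 x.2) (p, w) :=
    hG.smooth.continuousOn.continuousAt (ho.mem_nhds h)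
  exact h1.comp (f := fun q => (p, q)) (by fun_prop)

/-- The difference of two Green's functions is orthogonal to the image of `Δ`, so its moments
against `cos²ᵏ r(w, ·)` are those of a constant. As these functions concentrate at `w`, the
difference is constant. -/
theorem IsGreenFunction.exists_eq_add_const {n : ℕ} {G G' : CP n → CP n → ℝ}
    (hG : IsGreenFunction G) (hG' : IsGreenFunction G') :
    ∃ c : ℝ, ∀ p q, p ≠ q → G' p q = G p q + c := by
  obtain ⟨a, ha⟩ := hG.integral_const
  obtain ⟨b, hb⟩ := hG'.integral_const
  refine ⟨(cosMoment n 0)⁻¹ * (b - a), fun p w hpw => ?_⟩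
  have hint : Integrable (fun q => G' p q - G p q) (volumeFS n) :=
    (hG'.integrable p).sub (hG.integrable p)
  have horth : ∀ k : ℕ, ∫ q, (G' p q - G p q) *
      laplaceBeltrami (fun q => cosSq w q ^ (k + 1)) q ∂(volumeFS n) = 0 := by
    intro k
    have hφ := contMDiff_cosSq_pow (r := 2) w (k + 1)
    obtain ⟨C, hC⟩ := exists_abs_laplaceBeltrami_le hφ
    have hL := continuous_laplaceBeltrami hφ
    simp only [sub_mul]
    rw [integral_sub ((hG'.integrable p).mul_bdd hL.aestronglyMeasurable (.of_forall hC))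
      ((hG.integrable p).mul_bdd hL.aestronglyMeasurable (.of_forall hC))]
    have h1 := hG.representation _ hφ p
    have h2 := hG'.representation _ hφ p
    linarith
  have hmom := integral_cosSq_pow_mul_of_orthogonal w hint horth
  have hlim := tendsto_integral_cosSq_pow_mul w hint
    ((hG'.continuousAt hpw).sub (hG.continuousAt hpw))
  have hconst : ∀ k : ℕ, (cosMoment n k)⁻¹ *
      ∫ q, cosSq w q ^ k * (G' p q - G p q) ∂(volumeFS n) = (cosMoment n 0)⁻¹ * (b - a) := by
    intro k
    have h1 := hmom k
    rw [integral_sub (hG'.integrable p) (hG.integrable p), ha, hb] at h1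
    have h0 := (cosMoment_pos n 0).ne'
    have hk := (cosMoment_pos n k).ne'
    field_simp
    linear_combination h1
  simp only [hconst] at hlim
  linarith [tendsto_nhds_unique hlim tendsto_const_nhds]

/-! ### The vortex Hamiltonian -/

theorem vortexHamiltonian_fsGreen {n N : ℕ} (Γ : Fin N → ℝ) (ζ : ↥(bigDiagonal N (CP n))ᶜ) :
    vortexHamiltonian fsGreen Γ ζ =
      -(((n - 1).factorial : ℝ) / (2 * Real.pi ^ n)) *
        ∑ α, ∑ β ∈ Finset.Ioi α, Γ α * Γ β *
          (Real.log (Real.sin (fsDist (ζ.1 α) (ζ.1 β))) -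
            ∑ j ∈ Finset.Icc 1 (n - 1),
              1 / (2 * (j : ℝ) * Real.sin (fsDist (ζ.1 α) (ζ.1 β)) ^ (2 * j))) := by
  simp only [vortexHamiltonian, fsGreen, Finset.mul_sum]
  exact Finset.sum_congr rfl fun α _ => Finset.sum_congr rfl fun β _ => mul_left_comm _ _ _

theorem vortexHamiltonian_add_const {n N : ℕ} {G G' : CP n → CP n → ℝ} {c : ℝ}
    (h : ∀ p q, p ≠ q → G' p q = G p q + c) (Γ : Fin N → ℝ) (ζ : ↥(bigDiagonal N (CP n))ᶜ) :
    vortexHamiltonian G' Γ ζ =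
      vortexHamiltonian G Γ ζ + c * ∑ α, ∑ β ∈ Finset.Ioi α, Γ α * Γ β := by
  simp only [vortexHamiltonian, Finset.mul_sum, ← Finset.sum_add_distrib]
  refine Finset.sum_congr rfl fun α _ => Finset.sum_congr rfl fun β hβ => ?_
  have hne : ζ.1 α ≠ ζ.1 β := fun h => ζ.2 ⟨α, β, (Finset.mem_Ioi.1 hβ).ne, h⟩
  rw [h _ _ hne]
  ring

end VortexCP

theorem theorem1p3 (n : ℕ) (hn : 1 ≤ n) :
    (∀ p q : CP n, geodesicDist p q = ENNReal.ofReal (fsDist p q)) ∧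
    (∃ G : CP n → CP n → ℝ, IsGreenFunction G ∧
      ∀ (N : ℕ) (Γ : Fin N → ℝ), (∀ k, Γ k ≠ 0) → ∀ ζ : ↥(bigDiagonal N (CP n))ᶜ,
        vortexHamiltonian G Γ ζ =
          -(((n - 1).factorial : ℝ) / (2 * Real.pi ^ n)) *
            ∑ α, ∑ β ∈ Finset.Ioi α, Γ α * Γ β *
              (Real.log (Real.sin (fsDist (ζ.1 α) (ζ.1 β))) -
                ∑ j ∈ Finset.Icc 1 (n - 1),
                  1 / (2 * (j : ℝ) * Real.sin (fsDist (ζ.1 α) (ζ.1 β)) ^ (2 * j)))) ∧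
    (∀ G : CP n → CP n → ℝ, IsGreenFunction G →
      ∃ c : ℝ, ∀ (N : ℕ) (Γ : Fin N → ℝ), (∀ k, Γ k ≠ 0) → ∀ ζ : ↥(bigDiagonal N (CP n))ᶜ,
        vortexHamiltonian G Γ ζ =
          -(((n - 1).factorial : ℝ) / (2 * Real.pi ^ n)) *
            ∑ α, ∑ β ∈ Finset.Ioi α, Γ α * Γ β *
              (Real.log (Real.sin (fsDist (ζ.1 α) (ζ.1 β))) -
                ∑ j ∈ Finset.Icc 1 (n - 1),
                  1 / (2 * (j : ℝ) * Real.sin (fsDist (ζ.1 α) (ζ.1 β)) ^ (2 * j))) +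
          c * ∑ α, ∑ β ∈ Finset.Ioi α, Γ α * Γ β) := by
  refine ⟨geodesicDist_eq, ⟨fsGreen, isGreenFunction_fsGreen hn,
    fun N Γ _ ζ => vortexHamiltonian_fsGreen Γ ζ⟩, fun G hG => ?_⟩
  obtain ⟨c, hc⟩ := (isGreenFunction_fsGreen hn).exists_eq_add_const hG
  refine ⟨c, fun N Γ _ ζ => ?_⟩
  rw [vortexHamiltonian_add_const hc, vortexHamiltonian_fsGreen]
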